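/- Let $d\ge 1$, $n\ge 2$, $\beta\ge 2$, $L,M,\alpha,\sigma,p_{\min},p_{\max}>0$, let $\ell$ be the biggest integer strictly smaller than $\beta$, let $\Theta\subset\mathbb R^d$ be compact and convex, and let $\Theta'=\{x+y:x\in\Theta,\|y\|\le 1\}$ ($\|\cdot\|$ is the Euclidean norm). \textbf{Assumptions.} (1) The kernel $K:\mathbb R^d\to[0,\infty)$ is bounded, $L_K$-Lipschitz, has support in the closed unit ball, and $\int K=1$. (2)–(4) We observe $y_i=f(\mathbf x_i)+\xi_i$, $i=1,\dots,n$, where $\mathbf x_1,\dots,\mathbf x_n,\xi_1,\dots,\xi_n$ are mutually independent random elements; $\mathbf E\xi_i=0$ and $\mathbf E\exp(|\xi_i|/\sigma)\le 2$; the $\mathbf x_i$ have a common Lebesgue density $p$ on $\mathbb R^d$ with $p_{\min}\le p\le p_{\max}$ on $\Theta'$; the function $f:\mathbb R^d\to\mathbb R$ attains its minimum $f^*$ over $\Theta$ at some $\mathbf x^*\in\Theta$, is bounded by $M$ in absolute value on $\Theta'$, satisfies $f(y)\ge f(x)+\langle\nabla f(x),y-x\rangle+\frac\alpha2\|x-y\|^2$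 for all $x,y\in\Theta$, is $\ell$ times differentiable, and satisfies $$\Big|f(x')-\sum_{|m|\le\ell}\frac1{m!}D^mf(x)(x'-x)^m\Big|\le L\|x'-x\|^\beta\qquad\text{for all }x,x'\in\mathbb R^d.$$ \textbf{Algorithm.} Let $U(u)=(u^m/m!)_{|m|\le\ell}$, $h_k=\big(\frac{\log(k+1)}k\big)^{\frac1{2\beta+d}}$, $\lambda_k=\big(\frac{\log(k+1)}k\big)^{\frac\beta{2\beta+d}}$, $\eta_k=\frac2{\alpha k}$, and, with $u_{i,k}(z)=(\mathbf x_i-z)/h_k$, $$B_k(z)=\frac1{kh_k^d}\sum_{i=1}^kU(u_{i,k}(z))U(u_{i,k}(z))^\top K(u_{i,k}(z)),\qquad \mathbf D_k(z)=\frac1{kh_k^d}\sum_{i=1}^ky_iU(u_{i,k}(z))K(u_{i,k}(z)).$$ Let $A$ be the matrix that selects the $d$ coordinates with $|m|=1$. Choose any $\mathbf z_1\in\Theta$ and, for $k=1,\dots,n$, let $\mathbf z_{k+1}$ be the Euclidean projection onto $\Theta$ of $\mathbf z_k-\eta_kh_k^{-1}A(B_k(\mathbf z_k)+\lambda_kI)^{-1}\mathbf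 D_k(\mathbf z_k)$. Put $\bar{\mathbf z}_n=\frac1n\sum_{k=1}^n\mathbf z_k$. \textbf{Theorem 2.} Under these assumptions, $$\mathbf E\big[f(\bar{\mathbf z}_n)-f^*\big]\le C\min\Big(1,\Big(\frac{\log n}n\Big)^{\frac{2(\beta-1)}{2\beta+d}}\alpha^{-1}\Big),$$ where the constant $C>0$ depends only on $d,\Theta,\beta,L,M,p_{\max},p_{\min},K,\sigma$ (not on $n$, $\alpha$, $f$, $\mathbf z_1$ or otherwise on the law of the data), and its dependence on $d$ is at most polynomial, with a degree depending only on $\beta$, in the following sense: $C=C_0d^{\,q}$, where $q$ depends only on $\beta$, and $C_0$ depends only on $\beta,L,M,p_{\max},p_{\min},\sigma$, on the diameter of $\Theta$, and on an upper bound of $K$, the constant $L_K$ and the smallest eigenvalue of $\int U(u)U(u)^\top K(u)\,du$. -/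

import Mathlib

open MeasureTheory ProbabilityTheory

namespace PassiveGD

/-- Euclidean space of dimension `d`. -/
abbrev E (d : ℕ) : Type := EuclideanSpace ℝ (Fin d)

/-- The biggest integer (strictly) smaller than `β`, for `β > 0`. -/
noncomputable def ell (β : ℝ) : ℕ := ⌈β⌉₊ - 1

section MultiIndex

variable {d ℓ : ℕ}

/-- The `d`-dimensional multi-indices `m` with `|m| ≤ ℓ`
(every coordinate of such an `m` is automatically at most `ℓ`). -/
abbrev MIdx (d ℓ : ℕ) : Type := {m : Fin d → Fin (ℓ + 1) // ∑ i, (m i : ℕ) ≤ ℓ}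

/-- The coordinates of a multi-index as natural numbers. -/
def MIdx.coord (m : MIdx d ℓ) (i : Fin d) : ℕ := (m.1 i : ℕ)

/-- `m! = m₁! ⋯ m_d!`, as a real number. -/
noncomputable def MIdx.fact (m : MIdx d ℓ) : ℝ := ∏ i, ((m.coord i).factorial : ℝ)

/-- The monomial `u ^ m = u₁ ^ m₁ ⋯ u_d ^ m_d`. -/
noncomputable def MIdx.monomial (m : MIdx d ℓ) (u : E d) : ℝ := ∏ i, u i ^ m.coord i

/-- The partial derivative in the `i`-th coordinate. -/
noncomputable def partialDeriv (i : Fin d) (g : E d → ℝ) : E d → ℝ :=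
  fun x => fderiv ℝ g x (EuclideanSpace.single i 1)

/-- `D ^ m f = ∂₁ ^ m₁ ⋯ ∂_d ^ m_d f`. -/
noncomputable def MIdx.deriv (m : MIdx d ℓ) (f : E d → ℝ) : E d → ℝ :=
  (List.finRange d).foldr (fun i g => (partialDeriv i)^[m.coord i] g) f

/-- The vector `U(u)` of scaled monomials `u ^ m / m!`, `|m| ≤ ℓ`, indexed by the multi-indices
themselves instead of by an enumeration of them. -/
noncomputable def monoVec (d ℓ : ℕ) (u : E d) : MIdx d ℓ → ℝ := fun m => m.monomial u / m.fact

end MultiIndex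

/-- The Hölder class of `ℓ = ell β` times differentiable functions whose Taylor polynomial of order
`ℓ` at every point approximates them up to `L ‖x' - x‖ ^ β`. -/
structure HolderClass {d : ℕ} (β L : ℝ) (f : E d → ℝ) : Prop where
  differentiable : ∀ k < ell β, Differentiable ℝ (iteratedFDeriv ℝ k f)
  taylor : ∀ x x' : E d,
    |f x' - ∑ m : MIdx d (ell β), 1 / m.fact * m.deriv f x * m.monomial (x' - x)|
      ≤ L * ‖x' - x‖ ^ β

/-- The assumption on the kernel; `Kmax` is an upper bound for the kernel and `LK` a Lipschitz
constant. -/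
structure IsKernel {d : ℕ} (K : E d → ℝ) (Kmax LK : ℝ) : Prop where
  support : tsupport K ⊆ Metric.closedBall 0 1
  nonneg : ∀ u, 0 ≤ K u
  integral_eq_one : ∫ u, K u = 1
  le_max : ∀ u, K u ≤ Kmax
  lipschitz : ∀ x y, |K x - K y| ≤ LK * ‖x - y‖

/-- The matrix `∫ U(u) U(u)ᵀ K(u) du`. -/
noncomputable def kernelGram {d : ℕ} (β : ℝ) (K : E d → ℝ) :
    Matrix (MIdx d (ell β)) (MIdx d (ell β)) ℝ :=
  fun m m' => ∫ u, monoVec d (ell β) u m * monoVec d (ell β) u m' * K u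

/-- The smallest eigenvalue of a real symmetric matrix, as the infimum of its quadratic form over
the Euclidean unit sphere. -/
noncomputable def minEigenvalue {ι : Type*} [Fintype ι] (A : Matrix ι ι ℝ) : ℝ :=
  sInf {r : ℝ | ∃ v : ι → ℝ, ∑ i, v i ^ 2 = 1 ∧ r = ∑ i, ∑ j, v i * A i j * v j}

/-- `Θ' = {x + y : x ∈ Θ, ‖y‖ ≤ 1}`. -/
def enlarge {d : ℕ} (Θ : Set (E d)) : Set (E d) := {w | ∃ x ∈ Θ, ∃ y : E d, ‖y‖ ≤ 1 ∧ w = x + y}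

/-- The assumption on the regression function, with minimizer `xstar` on `Θ`. -/
structure IsObjective {d : ℕ} (Θ : Set (E d)) (β L M α : ℝ) (f : E d → ℝ) (xstar : E d) :
    Prop where
  mem : xstar ∈ Θ
  isMin : ∀ x ∈ Θ, f xstar ≤ f x
  holder : HolderClass β L f
  strongConvex : ∀ x ∈ Θ, ∀ y ∈ Θ,
    f x + inner ℝ (gradient f x) (y - x) + α / 2 * ‖x - y‖ ^ 2 ≤ f y
  bounded : ∀ x ∈ enlarge Θ, |f x| ≤ M

/-- The assumptions on the random design points `X i` and the noise variables `ξ i`, `i < n`.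
The pairs `(X i, ξ i)` are independent and `X i` is independent of `ξ i`, so that all the `X i`
and `ξ i` are mutually independent. -/
structure IsSample {d n : ℕ} {Ω : Type*} [MeasurableSpace Ω] (P : Measure Ω) (Θ : Set (E d))
    (pmin pmax σ : ℝ) (X : Fin n → Ω → E d) (ξ : Fin n → Ω → ℝ) : Prop where
  measurable_design : ∀ i, Measurable (X i)
  measurable_noise : ∀ i, Measurable (ξ i)
  indep_pairs : iIndepFun (fun i ω => (X i ω, ξ i ω)) P
  indep_noise_design : ∀ i i', IndepFun (ξ i) (X i') P
  noise_integrable : ∀ i, Integrable (ξ i) P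
  noise_mean : ∀ i, ∫ ω, ξ i ω ∂P = 0
  exp_integrable : ∀ i, Integrable (fun ω => Real.exp (|ξ i ω| / σ)) P
  exp_le : ∀ i, ∫ ω, Real.exp (|ξ i ω| / σ) ∂P ≤ 2
  density : ∃ p : E d → ℝ, Measurable p ∧ (∀ x, 0 ≤ p x) ∧
    (∀ i, P.map (X i) = volume.withDensity (fun x => ENNReal.ofReal (p x))) ∧
    ∀ x ∈ enlarge Θ, pmin ≤ p x ∧ p x ≤ pmax

section Algorithm

variable {d n : ℕ}

/-- The bandwidth `h_k`. -/
noncomputable def bandwidth (d : ℕ) (β : ℝ) (k : ℕ) : ℝ :=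
  (Real.log (k + 1) / k) ^ (1 / (2 * β + d))

/-- The regularization parameter `λ_k`. -/
noncomputable def regParam (d : ℕ) (β : ℝ) (k : ℕ) : ℝ :=
  (Real.log (k + 1) / k) ^ (β / (2 * β + d))

/-- The step size `η_k`. -/
noncomputable def stepSize (α : ℝ) (k : ℕ) : ℝ := 2 / (α * k)

/-- The indices of the first `k` of the `n` observations. -/
def firstIdx (n k : ℕ) : Finset (Fin n) := Finset.univ.filter (fun i => (i : ℕ) < k)

/-- The matrix `B_k(z)` computed from the first `k` design points. -/
noncomputable def Bmat (β : ℝ) (K : E d → ℝ) (x : Fin n → E d) (k : ℕ) (z : E d) :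
    Matrix (MIdx d (ell β)) (MIdx d (ell β)) ℝ :=
  (1 / (k * bandwidth d β k ^ d)) • ∑ i ∈ firstIdx n k,
    K ((bandwidth d β k)⁻¹ • (x i - z)) •
      Matrix.vecMulVec (monoVec d (ell β) ((bandwidth d β k)⁻¹ • (x i - z)))
        (monoVec d (ell β) ((bandwidth d β k)⁻¹ • (x i - z)))

/-- The vector `D_k(z)` computed from the first `k` observations. -/
noncomputable def Dvec (β : ℝ) (K : E d → ℝ) (x : Fin n → E d) (y : Fin n → ℝ) (k : ℕ) (z : E d) :
    MIdx d (ell β) → ℝ :=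
  (1 / (k * bandwidth d β k ^ d)) • ∑ i ∈ firstIdx n k,
    (y i * K ((bandwidth d β k)⁻¹ • (x i - z))) •
      monoVec d (ell β) ((bandwidth d β k)⁻¹ • (x i - z))

/-- The matrix `A` that selects the entries whose multi-indices are the unit vectors. -/
def Amat (d ℓ : ℕ) : Matrix (Fin d) (MIdx d ℓ) ℝ :=
  fun i m => if m.coord = Pi.single i 1 then 1 else 0

/-- The regularized local polynomial gradient estimator
`h_k⁻¹ A (B_k(z) + λ_k I)⁻¹ D_k(z)`. -/
noncomputable def gradEst (β : ℝ) (K : E d → ℝ) (x : Fin n → E d) (y : Fin n → ℝ) (k : ℕ)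
    (z : E d) : E d :=
  WithLp.toLp 2 ((bandwidth d β k)⁻¹ • (Amat d (ell β)).mulVec
    (((Bmat β K x k z + regParam d β k • (1 : Matrix (MIdx d (ell β)) (MIdx d (ell β)) ℝ))⁻¹).mulVec
      (Dvec β K x y k z)))

/-- Euclidean projection onto `Θ`: a nearest point of `Θ` (unique if `Θ` is closed, convex and
nonempty). -/
noncomputable def proj (Θ : Set (E d)) (x : E d) : E d :=
  Classical.epsilon (fun y => y ∈ Θ ∧ ∀ w ∈ Θ, ‖x - y‖ ≤ ‖x - w‖)

/-- The iterates of the algorithm on the data `(x i, y i)`: `iterate … j` is `z_{j+1}`. -/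
noncomputable def iterate (Θ : Set (E d)) (β α : ℝ) (K : E d → ℝ) (z₁ : E d) (x : Fin n → E d)
    (y : Fin n → ℝ) : ℕ → E d
  | 0 => z₁
  | j + 1 => proj Θ (iterate Θ β α K z₁ x y j -
      stepSize α (j + 1) • gradEst β K x y (j + 1) (iterate Θ β α K z₁ x y j))

/-- The average `(1 / n) ∑_{k=1}^n z_k` of the outputs of the algorithm. -/
noncomputable def average (Θ : Set (E d)) (β α : ℝ) (K : E d → ℝ) (z₁ : E d) (x : Fin n → E d)
    (y : Fin n → ℝ) : E d :=
  (1 / (n : ℝ)) • ∑ j ∈ Finset.range n, iterate Θ β α K z₁ x y j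

end Algorithm

end PassiveGD

open PassiveGD

universe u

/-!
The proof combines projected gradient descent for strongly convex functions with an error bound for
the local polynomial gradient estimator that is uniform over `Θ`.

*Optimization.* With the steps `2 / (α k)`, the squared distances to the minimizer telescope, and
the sum of the excess values `f(z_k) - f*` is at most of the order of `α⁻¹` times the sum of the
squared errors `‖ĝ_k - ∇f‖²` and of `‖∇f‖² / k` (`sum_descent`). The iterate `z_k` depends on the
same data as the estimator `ĝ_k`, so the error has to be bounded uniformly over `z ∈ Θ`.

*Error of the estimator.* Let `ρ = h ^ β = λ` and let `θ = (h ^ |m| D ^ m f(z))_m`. The data vector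
is `D = B θ + b`, where `b` collects the remainder of the Taylor expansion and the noise, so the
error `e = (B + λ)⁻¹ D - θ` solves `(B + λ) e = b - λ θ`, and its norm is at most
`(‖b‖ + λ ‖θ‖) / (μ + λ)` if `μ` bounds the spectrum of `B` from below (`ridge_error`). If `ρ Δ`
bounds the deviation of the entries of `B` from their expectations, one may take
`μ = c = pmin κ / 2` unless `ν ρ Δ > c`, where `ν` is the number of multi-indices; in that
exceptional case `μ = 0` costs a factor `1 / ρ < ν Δ / c`. In both cases the error is at most
`h⁻¹ ρ` times a polynomial in `Δ` and in the size `Γ` of the noise relative to `ρ`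
(`norm_gradEst_sub_le`). Its square is controlled by the fourth moments of `Δ` and `Γ`, and no
estimate of probabilities is needed.

*Uniform deviations.* Both `Δ` and `Γ` are suprema over `Θ` of normalized centred sums of
`ζ_i φ((X_i - z) / h)` with `ζ_i = 1` or `ζ_i = ξ_i`. Their exponential moments at the scale
`t = ρ / (2 σ Kmax)` are at most of the order of a power of `k`, since `k h ^ d ρ² = log (k + 1)`;
so are those of the maximum over a net of `Θ` with mesh `1 / k`. Hence the logarithm of the sum of
the exponentials over the net has a fourth moment of order `log (k + 1) ^ 4`, which is exactly what
the normalization compensates (`exists_uniform_deviation`).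

*Dimension.* The dimension enters through the number of multi-indices, which is at most
`(d + 1) ^ ℓ`, and through the logarithm of the size of the net. The remaining quantities are
normalized by `∫ K = 1`; in particular the derivatives of `f` are bounded by integrating the
square of its Taylor polynomial against `K`, which gives `‖θ‖² ≤ (M + L)² / κ`
(`sum_taylorVec_sq_le`).
-/

namespace PassiveGD

/-! ### Euclidean projection onto a compact convex set -/

section Projection

variable {d : ℕ} {Θ : Set (E d)}

theorem proj_spec (hc : IsCompact Θ) (hne : Θ.Nonempty) (x : E d) :
    proj Θ x ∈ Θ ∧ ∀ w ∈ Θ, ‖x - proj Θ x‖ ≤ ‖x - w‖ := by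
  obtain ⟨y, hy, hmin⟩ := hc.exists_isMinOn hne
    (f := fun w => ‖x - w‖) (by fun_prop)
  exact Classical.epsilon_spec (p := fun y => y ∈ Θ ∧ ∀ w ∈ Θ, ‖x - y‖ ≤ ‖x - w‖)
    ⟨y, hy, fun w hw => hmin hw⟩

theorem inner_sub_proj_nonpos (hc : IsCompact Θ) (hconv : Convex ℝ Θ) (x : E d) {w : E d}
    (hw : w ∈ Θ) : inner ℝ (x - proj Θ x) (w - proj Θ x) ≤ 0 := by
  obtain ⟨hmem, hmin⟩ := proj_spec hc ⟨w, hw⟩ x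
  refine (norm_eq_iInf_iff_real_inner_le_zero hconv hmem).1 ?_ w hw
  have : Nonempty Θ := ⟨⟨w, hw⟩⟩
  refine le_antisymm (le_ciInf fun v => hmin v v.2) ?_
  exact ciInf_le (f := fun v : Θ => ‖x - v‖)
    ⟨0, by rintro _ ⟨v, rfl⟩; exact norm_nonneg _⟩ ⟨_, hmem⟩

theorem norm_proj_sub_proj_le (hc : IsCompact Θ) (hconv : Convex ℝ Θ) (hne : Θ.Nonempty)
    (x y : E d) : ‖proj Θ x - proj Θ y‖ ≤ ‖x - y‖ := by
  have h1 := inner_sub_proj_nonpos hc hconv x (proj_spec hc hne y).1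
  have h2 := inner_sub_proj_nonpos hc hconv y (proj_spec hc hne x).1
  have h3 : ‖proj Θ x - proj Θ y‖ ^ 2 ≤ inner ℝ (x - y) (proj Θ x - proj Θ y) := by
    rw [← real_inner_self_eq_norm_sq]
    simp only [inner_sub_left, inner_sub_right] at *
    have := real_inner_comm (proj Θ x) (proj Θ y)
    linarith
  have h4 := real_inner_le_norm (x - y) (proj Θ x - proj Θ y)
  by_contra! hlt
  nlinarith [norm_nonneg (x - y), norm_nonneg (proj Θ x - proj Θ y)]

theorem continuous_proj (hc : IsCompact Θ) (hconv : Convex ℝ Θ) (hne : Θ.Nonempty) :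
    Continuous (proj Θ) := by
  refine (LipschitzWith.of_dist_le_mul (K := 1) fun x y => ?_).continuous
  simpa [dist_eq_norm] using norm_proj_sub_proj_le hc hconv hne x y

theorem norm_proj_sub_le (hc : IsCompact Θ) (hconv : Convex ℝ Θ) (x : E d) {w : E d}
    (hw : w ∈ Θ) : ‖proj Θ x - w‖ ≤ ‖x - w‖ := by
  have h1 := inner_sub_proj_nonpos hc hconv x hw
  have h4 := real_inner_le_norm (x - w) (proj Θ x - w)
  have h3 : ‖proj Θ x - w‖ ^ 2 ≤ inner ℝ (x - w) (proj Θ x - w) := by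
    rw [← real_inner_self_eq_norm_sq]
    simp only [inner_sub_left, inner_sub_right] at *
    linarith
  by_contra! hlt
  nlinarith [norm_nonneg (x - w), norm_nonneg (proj Θ x - w)]

end Projection

/-! ### Projected gradient descent with inexact gradients -/

section Descent

variable {F : Type*} [NormedAddCommGroup F] [InnerProductSpace ℝ F]

/-- One step of projected gradient descent with an inexact gradient `g` in place of `G`. The
weights of the squared distances to the minimizer are chosen so as to telescope. -/
theorem descent_step {α : ℝ} (hα : 0 < α) (j : ℕ) {z z' g G xs : F} {δ : ℝ}
    (hz' : ‖z' - xs‖ ≤ ‖z - stepSize α (j + 1) • g - xs‖)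
    (hconv : δ + α / 2 * ‖z - xs‖ ^ 2 ≤ inner ℝ G (z - xs)) :
    δ ≤ α * j / 4 * ‖z - xs‖ ^ 2 - α * (j + 1) / 4 * ‖z' - xs‖ ^ 2
      + α⁻¹ * (3 * ‖g - G‖ ^ 2 + 2 * ‖G‖ ^ 2 * (1 / (j + 1))) := by
  have hj : (0 : ℝ) < j + 1 := by positivity
  set η := stepSize α (j + 1) with hη
  have hη' : η = 2 / (α * (j + 1)) := by simp [hη, stepSize]
  have h1 : ‖z' - xs‖ ^ 2 ≤ ‖z - xs‖ ^ 2 - 2 * η * inner ℝ g (z - xs) + η ^ 2 * ‖g‖ ^ 2 := by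
    have : z - η • g - xs = (z - xs) - η • g := by abel
    rw [this] at hz'
    calc _ ≤ ‖(z - xs) - η • g‖ ^ 2 := by gcongr
      _ = _ := by
        rw [norm_sub_sq_real, inner_smul_right, norm_smul, mul_pow, Real.norm_eq_abs, sq_abs,
          real_inner_comm]; ring
  have h2 : inner ℝ G (z - xs) = inner ℝ g (z - xs) - inner ℝ (g - G) (z - xs) := by
    rw [inner_sub_left]; ring
  have h3 : -inner ℝ (g - G) (z - xs) ≤ α⁻¹ * ‖g - G‖ ^ 2 + α / 4 * ‖z - xs‖ ^ 2 := by
    have h := abs_real_inner_le_norm (g - G) (z - xs)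
    have h' := neg_abs_le (inner ℝ (g - G) (z - xs))
    have h'' : 0 ≤ α⁻¹ * (‖g - G‖ - α / 2 * ‖z - xs‖) ^ 2 := by positivity
    have e : α⁻¹ * (‖g - G‖ - α / 2 * ‖z - xs‖) ^ 2
      = α⁻¹ * ‖g - G‖ ^ 2 + α / 4 * ‖z - xs‖ ^ 2 - ‖g - G‖ * ‖z - xs‖ := by
      field_simp; ring
    linarith
  have h4 : ‖g‖ ^ 2 ≤ 2 * ‖g - G‖ ^ 2 + 2 * ‖G‖ ^ 2 := by
    have : ‖g‖ ≤ ‖g - G‖ + ‖G‖ := by simpa using norm_add_le (g - G) G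
    nlinarith [norm_nonneg g, sq_nonneg (‖g - G‖ - ‖G‖)]
  have h5 : inner ℝ g (z - xs) ≤ α * (j + 1) / 4 * (‖z - xs‖ ^ 2 - ‖z' - xs‖ ^ 2)
      + α⁻¹ * (1 / (j + 1)) * ‖g‖ ^ 2 := by
    have h6 : 0 ≤ (α * (j + 1) / 4) * (‖z - xs‖ ^ 2 - 2 * η * inner ℝ g (z - xs)
        + η ^ 2 * ‖g‖ ^ 2 - ‖z' - xs‖ ^ 2) := mul_nonneg (by positivity) (by linarith)
    have e : (α * (j + 1) / 4) * (‖z - xs‖ ^ 2 - 2 * η * inner ℝ g (z - xs)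
        + η ^ 2 * ‖g‖ ^ 2 - ‖z' - xs‖ ^ 2) = α * (j + 1) / 4 * (‖z - xs‖ ^ 2 - ‖z' - xs‖ ^ 2)
      + α⁻¹ * (1 / (j + 1)) * ‖g‖ ^ 2 - inner ℝ g (z - xs) := by
      rw [hη']; field_simp; ring
    linarith
  have h7 : α⁻¹ * (1 / (j + 1)) * ‖g‖ ^ 2
      ≤ α⁻¹ * (2 * ‖g - G‖ ^ 2 + 2 * ‖G‖ ^ 2 * (1 / (j + 1))) := by
    have hone : 1 / ((j : ℝ) + 1) ≤ 1 := by
      rw [div_le_one hj]; linarith [Nat.cast_nonneg (α := ℝ) j]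
    have h0 : 0 ≤ 1 / ((j : ℝ) + 1) := by positivity
    rw [mul_assoc]
    refine mul_le_mul_of_nonneg_left ?_ (by positivity)
    nlinarith [sq_nonneg ‖g - G‖]
  have e : α * (j + 1) / 4 * (‖z - xs‖ ^ 2 - ‖z' - xs‖ ^ 2)
      = α * j / 4 * ‖z - xs‖ ^ 2 + α / 4 * ‖z - xs‖ ^ 2 - α * (j + 1) / 4 * ‖z' - xs‖ ^ 2 := by
    ring
  linarith

theorem sum_descent {α : ℝ} (hα : 0 < α) (n : ℕ) {z g G : ℕ → F} {xs : F} {δ : ℕ → ℝ}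
    (hz : ∀ j < n, ‖z (j + 1) - xs‖ ≤ ‖z j - stepSize α (j + 1) • g j - xs‖)
    (hconv : ∀ j < n, δ j + α / 2 * ‖z j - xs‖ ^ 2 ≤ inner ℝ (G j) (z j - xs)) :
    ∑ j ∈ Finset.range n, δ j ≤
      ∑ j ∈ Finset.range n, α⁻¹ * (3 * ‖g j - G j‖ ^ 2 + 2 * ‖G j‖ ^ 2 * (1 / (j + 1))) := by
  have key : ∀ m ≤ n, ∑ j ∈ Finset.range m, δ j + α * m / 4 * ‖z m - xs‖ ^ 2 ≤
      ∑ j ∈ Finset.range m, α⁻¹ * (3 * ‖g j - G j‖ ^ 2 + 2 * ‖G j‖ ^ 2 * (1 / (j + 1))) := by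
    intro m
    induction m with
    | zero => simp
    | succ m ih =>
      intro hm
      have h := descent_step hα m (hz m hm) (hconv m hm)
      have := ih (by omega)
      rw [Finset.sum_range_succ, Finset.sum_range_succ]
      push_cast
      linarith
  have h0 : 0 ≤ α * n / 4 * ‖z n - xs‖ ^ 2 := by positivity
  linarith [key n le_rfl]

end Descent

/-! ### Averages of the rates -/

section Rates

theorem sum_inv_le_log (n : ℕ) (hn : 2 ≤ n) :
    ∑ j ∈ Finset.range n, 1 / ((j : ℝ) + 1) ≤ 3 * Real.log n := by
  have h := harmonic_le_one_add_log n
  have h2 : (harmonic n : ℝ) = ∑ j ∈ Finset.range n, 1 / ((j : ℝ) + 1) := by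
    simp [harmonic, one_div]
  have h3 : (1 / 2 : ℝ) ≤ Real.log n := by
    have := Real.log_le_log (by norm_num) (show (2 : ℝ) ≤ n by exact_mod_cast hn)
    linarith [Real.log_two_gt_d9]
  linarith

theorem sum_rpow_neg_le {r : ℝ} (hr0 : 0 ≤ r) (hr1 : r < 1) (n : ℕ) :
    ∑ j ∈ Finset.range n, ((j : ℝ) + 1) ^ (-r) ≤ (n : ℝ) ^ (1 - r) / (1 - r) := by
  have h1r : 0 < 1 - r := by linarith
  induction n with
  | zero => simp [Real.zero_rpow h1r.ne']
  | succ n ih =>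
    rw [Finset.sum_range_succ]
    have hn : (0 : ℝ) < n + 1 := by positivity
    -- Bernoulli's inequality for `(n / (n + 1)) ^ (1 - r)`
    have hb := rpow_one_add_le_one_add_mul_self (s := -(1 / ((n : ℝ) + 1))) (p := 1 - r)
      (by rw [neg_le_neg_iff, div_le_one hn]; linarith [Nat.cast_nonneg (α := ℝ) n])
      h1r.le (by linarith)
    have e1 : 1 + -(1 / ((n : ℝ) + 1)) = n / (n + 1) := by field_simp; ring
    rw [e1, Real.div_rpow (by positivity) hn.le, div_le_iff₀ (by positivity)] at hb
    have e2 : ((n : ℝ) + 1) ^ (-r) = ((n : ℝ) + 1) ^ (1 - r) / (n + 1) := by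
      rw [eq_div_iff hn.ne', show (1 - r) = -r + 1 by ring, Real.rpow_add_one hn.ne']
    have e3 : (n : ℝ) ^ (1 - r) / (1 - r) ≤
        ((n : ℝ) + 1) ^ (1 - r) / (1 - r) - ((n : ℝ) + 1) ^ (-r) := by
      rw [div_le_iff₀ h1r, sub_mul, div_mul_cancel₀ _ h1r.ne', e2]
      calc _ ≤ _ := hb
        _ = _ := by ring
    push_cast
    linarith

/-- The average of the rates `(log (k + 1) / k) ^ r` over `k = 1, …, n` is of the order of the
last of them. -/
theorem avg_rate_le {r : ℝ} (hr0 : 0 ≤ r) (hr1 : r < 1) (n : ℕ) (hn : 2 ≤ n) :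
    (1 / (n : ℝ)) * ∑ j ∈ Finset.range n, (Real.log ((j : ℝ) + 1 + 1) / (j + 1)) ^ r ≤
      2 / (1 - r) * (Real.log n / n) ^ r := by
  have hn' : (2 : ℝ) ≤ n := by exact_mod_cast hn
  have hn0 : (0 : ℝ) < n := by linarith
  have hlog : 0 < Real.log n := Real.log_pos (by linarith)
  have hlog2 : Real.log ((n : ℝ) + 1) ≤ 2 * Real.log n := by
    have : 2 * Real.log n = Real.log ((n : ℝ) ^ 2) := by rw [Real.log_pow]; norm_num
    rw [this]
    exact Real.log_le_log (by linarith) (by nlinarith)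
  have hterm : ∀ j ∈ Finset.range n, (Real.log ((j : ℝ) + 1 + 1) / (j + 1)) ^ r ≤
      2 * Real.log n ^ r * ((j : ℝ) + 1) ^ (-r) := by
    intro j hj
    have hj' : (j : ℝ) + 1 ≤ n := by exact_mod_cast Finset.mem_range.1 hj
    have hj0 : (0 : ℝ) < j + 1 := by positivity
    have hl0 : 0 ≤ Real.log ((j : ℝ) + 1 + 1) := Real.log_nonneg (by linarith)
    rw [Real.div_rpow hl0 hj0.le, Real.rpow_neg hj0.le, div_eq_mul_inv]
    gcongr
    calc Real.log ((j : ℝ) + 1 + 1) ^ r ≤ (2 * Real.log n) ^ r := by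
          refine Real.rpow_le_rpow hl0 (le_trans (Real.log_le_log (by linarith) ?_) hlog2) hr0
          linarith
      _ = 2 ^ r * Real.log n ^ r := Real.mul_rpow (by norm_num) hlog.le
      _ ≤ 2 * Real.log n ^ r := by
          gcongr
          calc (2 : ℝ) ^ r ≤ 2 ^ (1 : ℝ) := Real.rpow_le_rpow_of_exponent_le (by norm_num) hr1.le
            _ = 2 := by norm_num
  have h1r : 0 < 1 - r := by linarith
  calc (1 / (n : ℝ)) * ∑ j ∈ Finset.range n, (Real.log ((j : ℝ) + 1 + 1) / (j + 1)) ^ r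
      ≤ (1 / (n : ℝ)) * ∑ j ∈ Finset.range n, 2 * Real.log n ^ r * ((j : ℝ) + 1) ^ (-r) := by
        gcongr with j hj; exact hterm j hj
    _ = (1 / (n : ℝ)) * (2 * Real.log n ^ r) * ∑ j ∈ Finset.range n, ((j : ℝ) + 1) ^ (-r) := by
        rw [← Finset.mul_sum]; ring
    _ ≤ (1 / (n : ℝ)) * (2 * Real.log n ^ r) * ((n : ℝ) ^ (1 - r) / (1 - r)) := by
        gcongr; exact sum_rpow_neg_le hr0 hr1 n
    _ = 2 / (1 - r) * (Real.log n / n) ^ r := by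
        rw [Real.div_rpow hlog.le hn0.le, Real.rpow_sub hn0, Real.rpow_one]
        field_simp

theorem avg_inv_le {r : ℝ} (hr1 : r ≤ 1) (n : ℕ) (hn : 2 ≤ n) :
    (1 / (n : ℝ)) * ∑ j ∈ Finset.range n, 1 / ((j : ℝ) + 1) ≤ 3 * (Real.log n / n) ^ r := by
  have hn' : (2 : ℝ) ≤ n := by exact_mod_cast hn
  have hn0 : (0 : ℝ) < n := by linarith
  have hlog : 0 < Real.log n := Real.log_pos (by linarith)
  have h1 : Real.log n / n ≤ 1 := by
    rw [div_le_one hn0]; linarith [Real.log_le_sub_one_of_pos hn0]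
  calc _ ≤ (1 / (n : ℝ)) * (3 * Real.log n) := by gcongr; exact sum_inv_le_log n hn
    _ = 3 * (Real.log n / n) ^ (1 : ℝ) := by rw [Real.rpow_one]; ring
    _ ≤ _ := by
      gcongr 3 * ?_
      exact Real.rpow_le_rpow_of_exponent_ge (by positivity) h1 hr1

end Rates

/-! ### Multi-indices and monomials -/

section MultiIndices

variable {d ℓ : ℕ}

/-- A multi-index of degree at most `ℓ + 1` has degree at most `ℓ`, or it arises from such a
multi-index by adding a unit vector. -/
theorem exists_finset_sum_le (d ℓ : ℕ) : ∃ T : Finset (Fin d → ℕ), T.card ≤ (d + 1) ^ ℓ ∧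
    ∀ m : Fin d → ℕ, ∑ i, m i ≤ ℓ → m ∈ T := by
  classical
  induction ℓ with
  | zero =>
    refine ⟨{0}, by simp, fun m hm => ?_⟩
    rw [Finset.mem_singleton]
    ext i
    have := Finset.single_le_sum (f := m) (fun i _ => Nat.zero_le _) (Finset.mem_univ i)
    simp only [Pi.zero_apply]; omega
  | succ ℓ ih =>
    obtain ⟨T, hT, hmem⟩ := ih
    refine ⟨Finset.image (fun q : (Fin d → ℕ) × Option (Fin d) =>
      q.1 + q.2.elim 0 (fun i => Pi.single i 1)) (T ×ˢ Finset.univ), ?_, fun m hm => ?_⟩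
    · refine Finset.card_image_le.trans ?_
      rw [Finset.card_product, pow_succ]
      simpa using Nat.mul_le_mul_right (d + 1) hT
    · rw [Finset.mem_image]
      by_cases hz : ∃ i, m i ≠ 0
      · obtain ⟨i, hi⟩ := hz
        have hle : Pi.single i 1 ≤ m := by
          intro j
          by_cases hj : j = i
          · subst hj; simp; omega
          · simp [hj]
        have he : m - Pi.single i 1 + Pi.single i 1 = m := tsub_add_cancel_of_le hle
        refine ⟨(m - Pi.single i 1, some i), ?_, by simpa using he⟩
        rw [Finset.mem_product]
        refine ⟨hmem _ ?_, Finset.mem_univ _⟩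
        have hsum := congrArg (fun f : Fin d → ℕ => ∑ j, f j) he
        simp only [Pi.add_apply, Finset.sum_add_distrib] at hsum
        have : ∑ j, (Pi.single i 1 : Fin d → ℕ) j = 1 := by simp
        simp only at *
        omega
      · push Not at hz
        refine ⟨(m, none), ?_, by simp⟩
        rw [Finset.mem_product]
        exact ⟨hmem _ (by simp [hz]), Finset.mem_univ _⟩

theorem MIdx.coord_injective : Function.Injective (MIdx.coord : MIdx d ℓ → Fin d → ℕ) := by
  intro m m' h
  apply Subtype.ext
  funext i
  exact Fin.ext (congrFun h i)

theorem MIdx.sum_coord_le (m : MIdx d ℓ) : ∑ i, m.coord i ≤ ℓ := m.2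

theorem card_MIdx_le (d ℓ : ℕ) : Fintype.card (MIdx d ℓ) ≤ (d + 1) ^ ℓ := by
  classical
  obtain ⟨T, hT, hmem⟩ := exists_finset_sum_le d ℓ
  refine le_trans ?_ hT
  rw [← Finset.card_univ]
  exact Finset.card_le_card_of_injOn MIdx.coord (fun m _ => hmem _ m.sum_coord_le)
    MIdx.coord_injective.injOn

/-- The multi-index with the given coordinates, whose sum is at most `ℓ`. -/
def MIdx.ofCoord (c : Fin d → ℕ) (h : ∑ i, c i ≤ ℓ) : MIdx d ℓ :=
  ⟨fun i => ⟨c i, Nat.lt_succ_of_le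
    ((Finset.single_le_sum (f := c) (fun _ _ => Nat.zero_le _) (Finset.mem_univ i)).trans h)⟩, h⟩

@[simp] theorem MIdx.coord_ofCoord (c : Fin d → ℕ) (h : ∑ i, c i ≤ ℓ) :
    (MIdx.ofCoord c h).coord = c := rfl

/-- The multi-index `0`. -/
def zeroIdx (d ℓ : ℕ) : MIdx d ℓ := MIdx.ofCoord 0 (by simp)

instance : Nonempty (MIdx d ℓ) := ⟨zeroIdx d ℓ⟩

/-- The multi-index that is the `i`-th unit vector. -/
def unitIdx (hℓ : 1 ≤ ℓ) (i : Fin d) : MIdx d ℓ := MIdx.ofCoord (Pi.single i 1) (by simpa using hℓ)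

theorem unitIdx_injective (hℓ : 1 ≤ ℓ) : Function.Injective (unitIdx (d := d) hℓ) := by
  intro i j h
  have := congrFun (congrArg MIdx.coord h) i
  by_contra hne
  simp [unitIdx, hne] at this

theorem MIdx.one_le_fact (m : MIdx d ℓ) : 1 ≤ m.fact := by
  rw [MIdx.fact, ← Nat.cast_prod]
  exact_mod_cast Finset.prod_pos fun i _ => Nat.factorial_pos _

theorem MIdx.abs_monomial_le (m : MIdx d ℓ) {u : E d} (hu : ‖u‖ ≤ 1) : |m.monomial u| ≤ 1 := by
  rw [MIdx.monomial, Finset.abs_prod]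
  refine Finset.prod_le_one (fun _ _ => abs_nonneg _) fun i _ => ?_
  rw [abs_pow]
  exact pow_le_one₀ (abs_nonneg _) ((PiLp.norm_apply_le u i).trans hu)

theorem abs_monoVec_le (m : MIdx d ℓ) {u : E d} (hu : ‖u‖ ≤ 1) : |monoVec d ℓ u m| ≤ 1 := by
  have h1 := m.one_le_fact
  rw [monoVec, abs_div, abs_of_pos (by linarith : 0 < m.fact), div_le_one (by linarith)]
  exact (m.abs_monomial_le hu).trans h1

/-- Monomials are Lipschitz on the unit cube, with the degree as a constant that does not involve the
number of factors. -/
theorem abs_prod_pow_sub_prod_pow_le {ι : Type*} (s : Finset ι) (k : ι → ℕ) {a b : ι → ℝ}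
    {δ : ℝ} (ha : ∀ i, |a i| ≤ 1) (hb : ∀ i, |b i| ≤ 1) (hab : ∀ i, |a i - b i| ≤ δ) :
    |∏ i ∈ s, a i ^ k i - ∏ i ∈ s, b i ^ k i| ≤ (∑ i ∈ s, (k i : ℝ)) * δ := by
  classical
  induction s using Finset.induction_on with
  | empty => simp
  | insert i s hi ih =>
    rw [Finset.prod_insert hi, Finset.prod_insert hi, Finset.sum_insert hi]
    have e : a i ^ k i * ∏ j ∈ s, a j ^ k j - b i ^ k i * ∏ j ∈ s, b j ^ k j
      = (a i ^ k i - b i ^ k i) * ∏ j ∈ s, a j ^ k j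
        + b i ^ k i * (∏ j ∈ s, a j ^ k j - ∏ j ∈ s, b j ^ k j) := by ring
    have h1 : |∏ j ∈ s, a j ^ k j| ≤ 1 := by
      rw [Finset.abs_prod]
      refine Finset.prod_le_one (fun _ _ => abs_nonneg _) fun j _ => ?_
      rw [abs_pow]; exact pow_le_one₀ (abs_nonneg _) (ha j)
    have h2 : |b i ^ k i| ≤ 1 := by rw [abs_pow]; exact pow_le_one₀ (abs_nonneg _) (hb i)
    have h3 : |a i ^ k i - b i ^ k i| ≤ k i * δ := by
      refine (abs_pow_sub_pow_le _ _ _).trans ?_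
      have hmax : max |a i| |b i| ^ (k i - 1) ≤ 1 :=
        pow_le_one₀ (le_max_of_le_left (abs_nonneg _)) (max_le (ha i) (hb i))
      have hδ := hab i
      have h0 := abs_nonneg (a i - b i)
      have hk : (0 : ℝ) ≤ k i := Nat.cast_nonneg _
      calc |a i - b i| * k i * max |a i| |b i| ^ (k i - 1) ≤ |a i - b i| * k i * 1 := by gcongr
        _ ≤ k i * δ := by nlinarith
    rw [e]
    calc _ ≤ |a i ^ k i - b i ^ k i| * |∏ j ∈ s, a j ^ k j|
        + |b i ^ k i| * |∏ j ∈ s, a j ^ k j - ∏ j ∈ s, b j ^ k j| := by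
          rw [← abs_mul, ← abs_mul]; exact abs_add_le _ _
      _ ≤ k i * δ * 1 + 1 * ((∑ j ∈ s, (k j : ℝ)) * δ) := by
          gcongr
          exact (abs_nonneg _).trans h3
      _ = _ := by ring

theorem abs_monoVec_sub_le (m : MIdx d ℓ) {u v : E d} (hu : ‖u‖ ≤ 1) (hv : ‖v‖ ≤ 1) :
    |monoVec d ℓ u m - monoVec d ℓ v m| ≤ ℓ * ‖u - v‖ := by
  have h1 := m.one_le_fact
  have h0 : 0 < m.fact := by linarith
  rw [monoVec, monoVec, ← sub_div, abs_div, abs_of_pos h0, div_le_iff₀ h0]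
  have h2 : |m.monomial u - m.monomial v| ≤ (∑ i, (m.coord i : ℝ)) * ‖u - v‖ :=
    abs_prod_pow_sub_prod_pow_le _ _ (fun i => (PiLp.norm_apply_le u i).trans hu)
      (fun i => (PiLp.norm_apply_le v i).trans hv)
      (fun i => by simpa using PiLp.norm_apply_le (u - v) i)
  have h3 : (∑ i, (m.coord i : ℝ)) ≤ ℓ := by exact_mod_cast m.sum_coord_le
  calc _ ≤ _ := h2
    _ ≤ ℓ * ‖u - v‖ := by gcongr
    _ ≤ ℓ * ‖u - v‖ * m.fact := le_mul_of_one_le_right (by positivity) h1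

@[fun_prop]
theorem continuous_monoVec (m : MIdx d ℓ) : Continuous fun u => monoVec d ℓ u m := by
  unfold monoVec MIdx.monomial
  fun_prop

theorem monoVec_zeroIdx (u : E d) : monoVec d ℓ u (zeroIdx d ℓ) = 1 := by
  simp [monoVec, zeroIdx, MIdx.monomial, MIdx.fact]

/-- The degree `|m|` of a multi-index. -/
def MIdx.deg (m : MIdx d ℓ) : ℕ := ∑ i, m.coord i

theorem MIdx.monomial_smul (m : MIdx d ℓ) (h : ℝ) (u : E d) :
    m.monomial (h • u) = h ^ m.deg * m.monomial u := by
  simp [MIdx.monomial, MIdx.deg, mul_pow, Finset.prod_mul_distrib, Finset.prod_pow_eq_pow_sum]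

@[simp] theorem deg_unitIdx (hℓ : 1 ≤ ℓ) (i : Fin d) : (unitIdx hℓ i).deg = 1 := by
  simp [MIdx.deg, unitIdx]

theorem deriv_unitIdx (hℓ : 1 ≤ ℓ) (i : Fin d) (f : E d → ℝ) :
    (unitIdx hℓ i).deriv f = partialDeriv i f := by
  have key : ∀ l : List (Fin d), l.Nodup →
      l.foldr (fun j g => (partialDeriv j)^[(Pi.single i 1 : Fin d → ℕ) j] g) f =
        if i ∈ l then partialDeriv i f else f := by
    intro l
    induction l with
    | nil => simp
    | cons j l ih =>
      intro hl
      rw [List.nodup_cons] at hl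
      rw [List.foldr_cons, ih hl.2]
      by_cases hj : j = i
      · subst hj; simp [hl.1]
      · simp [hj, Ne.symm hj]
  have := key (List.finRange d) (List.nodup_finRange d)
  simpa [MIdx.deriv, unitIdx] using this

theorem gradient_apply (f : E d → ℝ) (x : E d) (i : Fin d) :
    gradient f x i = partialDeriv i f x := by
  have h := EuclideanSpace.inner_single_left (𝕜 := ℝ) i 1 (gradient f x)
  rw [partialDeriv, ← InnerProductSpace.toDual_symm_apply (𝕜 := ℝ), real_inner_comm]
  simpa [gradient] using h.symm

end MultiIndices

/-! ### The kernel and its moments -/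

section Kernel

variable {d : ℕ} {K : E d → ℝ} {Kmax LK : ℝ}

theorem IsKernel.continuous (hK : IsKernel K Kmax LK) : Continuous K := by
  have h0 : 0 ≤ max LK 0 := le_max_right _ _
  refine (LipschitzWith.of_dist_le_mul (K := ⟨max LK 0, h0⟩) fun x y => ?_).continuous
  rw [Real.dist_eq, dist_eq_norm]
  exact (hK.lipschitz x y).trans (mul_le_mul_of_nonneg_right (le_max_left _ _) (norm_nonneg _))

theorem IsKernel.eq_zero (hK : IsKernel K Kmax LK) {u : E d} (hu : 1 < ‖u‖) : K u = 0 := by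
  by_contra h
  have := hK.support (subset_tsupport K h)
  simp at this
  linarith

theorem IsKernel.hasCompactSupport (hK : IsKernel K Kmax LK) : HasCompactSupport K :=
  HasCompactSupport.of_support_subset_isCompact (isCompact_closedBall (0 : E d) 1)
    ((subset_tsupport K).trans hK.support)

theorem IsKernel.exists_pos (hK : IsKernel K Kmax LK) : ∃ u, 0 < K u := by
  by_contra! h
  have h0 : K = 0 := funext fun u => le_antisymm (h u) (hK.nonneg u)
  have := hK.integral_eq_one
  simp [h0] at this

theorem IsKernel.Kmax_pos (hK : IsKernel K Kmax LK) : 0 < Kmax := by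
  obtain ⟨u, hu⟩ := hK.exists_pos
  exact hu.trans_le (hK.le_max u)

/-- The integrand of the entries of the Gram matrix `∫ U(u) U(u)ᵀ K(u) du`. -/
noncomputable def momentKernel {ℓ : ℕ} (K : E d → ℝ) (m m' : MIdx d ℓ) (u : E d) : ℝ :=
  monoVec d ℓ u m * monoVec d ℓ u m' * K u

variable {ℓ : ℕ}

theorem abs_momentKernel_le (hK : IsKernel K Kmax LK) (m m' : MIdx d ℓ) (u : E d) :
    |momentKernel K m m' u| ≤ K u := by
  rw [momentKernel, abs_mul, abs_mul, abs_of_nonneg (hK.nonneg u)]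
  rcases le_or_gt ‖u‖ 1 with hu | hu
  · refine mul_le_of_le_one_left (hK.nonneg u) ?_
    exact mul_le_one₀ (abs_monoVec_le m hu) (abs_nonneg _) (abs_monoVec_le m' hu)
  · simp [hK.eq_zero hu]

theorem IsKernel.LK_nonneg (hK : IsKernel K Kmax LK) (hd : 1 ≤ d) : 0 ≤ LK := by
  have h := (abs_nonneg _).trans (hK.lipschitz (EuclideanSpace.single ⟨0, hd⟩ 1) 0)
  simpa using h

/-- The cutoff at the boundary of the unit ball is harmless, since `momentKernel` is dominated by the
Lipschitz function `K`, which vanishes outside. -/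
theorem momentKernel_lipschitz (hK : IsKernel K Kmax LK) (hd : 1 ≤ d) (m m' : MIdx d ℓ)
    (u v : E d) :
    |momentKernel K m m' u - momentKernel K m m' v| ≤ (2 * ℓ * Kmax + LK) * ‖u - v‖ := by
  have hKm := hK.Kmax_pos
  have hLK := hK.LK_nonneg hd
  have outside : ∀ u v : E d, 1 < ‖v‖ →
      |momentKernel K m m' u - momentKernel K m m' v| ≤ (2 * ℓ * Kmax + LK) * ‖u - v‖ := by
    intro u v hv
    have h1 : momentKernel K m m' v = 0 := by simp [momentKernel, hK.eq_zero hv]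
    have h2 := hK.lipschitz u v
    rw [hK.eq_zero hv, sub_zero, abs_of_nonneg (hK.nonneg u)] at h2
    rw [h1, sub_zero]
    have h3 : 0 ≤ 2 * ℓ * Kmax * ‖u - v‖ := by positivity
    linarith [abs_momentKernel_le hK m m' u]
  rcases lt_or_ge 1 ‖v‖ with hv | hv
  · exact outside u v hv
  rcases lt_or_ge 1 ‖u‖ with hu | hu
  · rw [abs_sub_comm, norm_sub_rev]
    exact outside v u hu
  have e : momentKernel K m m' u - momentKernel K m m' v
      = (monoVec d ℓ u m - monoVec d ℓ v m) * (monoVec d ℓ u m' * K u)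
        + monoVec d ℓ v m * ((monoVec d ℓ u m' - monoVec d ℓ v m') * K u)
        + monoVec d ℓ v m * (monoVec d ℓ v m' * (K u - K v)) := by
    simp only [momentKernel]; ring
  have hKu : |K u| ≤ Kmax := by rw [abs_of_nonneg (hK.nonneg u)]; exact hK.le_max u
  rw [e]
  refine (abs_add_three _ _ _).trans ?_
  simp only [abs_mul]
  have a1 := abs_monoVec_le m hv
  have a2 := abs_monoVec_le m' hv
  have a3 := abs_monoVec_le m' hu
  have b1 := abs_monoVec_sub_le m hu hv
  have b2 := abs_monoVec_sub_le m' hu hv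
  have b3 := hK.lipschitz u v
  calc _ ≤ ℓ * ‖u - v‖ * (1 * Kmax) + 1 * (ℓ * ‖u - v‖ * Kmax)
        + 1 * (1 * (LK * ‖u - v‖)) := by gcongr
    _ = _ := by ring

theorem continuous_momentKernel (hK : IsKernel K Kmax LK) (m m' : MIdx d ℓ) :
    Continuous (momentKernel K m m') := by
  have := hK.continuous
  unfold momentKernel
  fun_prop

theorem integrable_kernel (hK : IsKernel K Kmax LK) : Integrable K :=
  hK.continuous.integrable_of_hasCompactSupport hK.hasCompactSupport

theorem integrable_momentKernel (hK : IsKernel K Kmax LK) (m m' : MIdx d ℓ) :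
    Integrable (momentKernel K m m') :=
  (integrable_kernel hK).mono' (continuous_momentKernel hK m m').aestronglyMeasurable
    (Filter.Eventually.of_forall fun u => abs_momentKernel_le hK m m' u)

end Kernel

/-! ### The Gram matrix of the kernel -/

section Gram

variable {ι : Type*} [Fintype ι]

/-- Nonnegativity of the quadratic form makes the set in the definition of `minEigenvalue` bounded
below, so that its infimum is not a junk value. -/
theorem minEigenvalue_mul_le (A : Matrix ι ι ℝ)
    (hA : ∀ v : ι → ℝ, 0 ≤ ∑ i, ∑ j, v i * A i j * v j) (v : ι → ℝ) :
    minEigenvalue A * ∑ i, v i ^ 2 ≤ ∑ i, ∑ j, v i * A i j * v j := by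
  have hs0 : 0 ≤ ∑ i, v i ^ 2 := Finset.sum_nonneg fun i _ => sq_nonneg _
  rcases hs0.eq_or_lt with h0 | hpos
  · rw [← h0, mul_zero]; exact hA v
  set t := ∑ i, v i ^ 2 with ht
  have hsq : Real.sqrt t ^ 2 = t := Real.sq_sqrt hs0
  have hsp : 0 < Real.sqrt t := Real.sqrt_pos.2 hpos
  have hinv : t⁻¹ = (Real.sqrt t)⁻¹ * (Real.sqrt t)⁻¹ := by rw [← mul_inv, ← sq, hsq]
  have hle : minEigenvalue A ≤
      ∑ i, ∑ j, ((Real.sqrt t)⁻¹ * v i) * A i j * ((Real.sqrt t)⁻¹ * v j) := by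
    refine csInf_le ⟨0, ?_⟩ ⟨fun i => (Real.sqrt t)⁻¹ * v i, ?_, rfl⟩
    · rintro r ⟨w, -, rfl⟩; exact hA w
    · simp only [mul_pow, ← Finset.mul_sum, ← ht, inv_pow, hsq]
      exact inv_mul_cancel₀ hpos.ne'
  have e : ∑ i, ∑ j, ((Real.sqrt t)⁻¹ * v i) * A i j * ((Real.sqrt t)⁻¹ * v j)
      = t⁻¹ * ∑ i, ∑ j, v i * A i j * v j := by
    rw [Finset.mul_sum]
    refine Finset.sum_congr rfl fun i _ => ?_
    rw [Finset.mul_sum]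
    refine Finset.sum_congr rfl fun j _ => ?_
    rw [hinv]; ring
  rw [e] at hle
  calc minEigenvalue A * t ≤ (t⁻¹ * ∑ i, ∑ j, v i * A i j * v j) * t := by gcongr
    _ = _ := by field_simp

theorem minEigenvalue_pos [Nonempty ι] (A : Matrix ι ι ℝ)
    (hA : ∀ v : ι → ℝ, v ≠ 0 → 0 < ∑ i, ∑ j, v i * A i j * v j) : 0 < minEigenvalue A := by
  classical
  set S : Set (ι → ℝ) := {v | ∑ i, v i ^ 2 = 1} with hS
  have hcomp : IsCompact S := by
    refine Metric.isCompact_of_isClosed_isBounded (isClosed_eq (by fun_prop) (by fun_prop)) ?_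
    refine (Metric.isBounded_closedBall (x := (0 : ι → ℝ)) (r := 1)).subset fun v hv => ?_
    rw [mem_closedBall_zero_iff, pi_norm_le_iff_of_nonneg zero_le_one]
    intro i
    have h1 : v i ^ 2 ≤ ∑ i, v i ^ 2 :=
      Finset.single_le_sum (f := fun i => v i ^ 2) (fun i _ => sq_nonneg _) (Finset.mem_univ i)
    have hv' : ∑ i, v i ^ 2 = 1 := hv
    rw [Real.norm_eq_abs, ← sq_le_one_iff_abs_le_one]
    linarith
  obtain ⟨i₀⟩ := ‹Nonempty ι›
  have hne : S.Nonempty := ⟨Pi.single i₀ 1, by simp [hS, Pi.single_apply, ite_pow]⟩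
  obtain ⟨v, hv, hmin⟩ := hcomp.exists_isMinOn hne
    (f := fun v => ∑ i, ∑ j, v i * A i j * v j) (by fun_prop)
  have hv0 : v ≠ 0 := by
    rintro rfl
    simp [hS] at hv
  refine (hA v hv0).trans_le (le_csInf ⟨_, v, hv, rfl⟩ ?_)
  rintro r ⟨w, hw, rfl⟩
  exact hmin hw

variable {d : ℕ} {K : E d → ℝ} {Kmax LK β : ℝ}

theorem sum_sum_mul_eq_sq (v U : ι → ℝ) :
    ∑ i, ∑ j, v i * (U i * U j) * v j = (∑ i, v i * U i) ^ 2 := by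
  rw [sq, Finset.sum_mul_sum]
  refine Finset.sum_congr rfl fun i _ => Finset.sum_congr rfl fun j _ => by ring

theorem sq_sum_mul_kernel {ℓ : ℕ} (K : E d → ℝ) (v : MIdx d ℓ → ℝ) (u : E d) :
    (∑ m, v m * monoVec d ℓ u m) ^ 2 * K u
      = ∑ m, ∑ m', v m * momentKernel K m m' u * v m' := by
  rw [← sum_sum_mul_eq_sq, Finset.sum_mul]
  refine Finset.sum_congr rfl fun i _ => ?_
  rw [Finset.sum_mul]
  refine Finset.sum_congr rfl fun j _ => ?_
  rw [momentKernel]; ring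

theorem sum_mul_integral_momentKernel {ℓ : ℕ} {A : Type*} [MeasurableSpace A] {μ : Measure A}
    {u : A → E d} (hint : ∀ m m' : MIdx d ℓ, Integrable (fun a => momentKernel K m m' (u a)) μ)
    (v : MIdx d ℓ → ℝ) :
    ∑ m, ∑ m', v m * (∫ a, momentKernel K m m' (u a) ∂μ) * v m'
      = ∫ a, (∑ m, v m * monoVec d ℓ (u a) m) ^ 2 * K (u a) ∂μ := by
  have hint' : ∀ i j, Integrable (fun a => v i * momentKernel K i j (u a) * v j) μ := fun i j =>
    ((hint i j).const_mul _).mul_const _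
  calc _ = ∑ i, ∑ j, ∫ a, v i * momentKernel K i j (u a) * v j ∂μ := by
        refine Finset.sum_congr rfl fun i _ => Finset.sum_congr rfl fun j _ => ?_
        rw [integral_mul_const, integral_const_mul]
    _ = ∫ a, ∑ i, ∑ j, v i * momentKernel K i j (u a) * v j ∂μ := by
        rw [integral_finsetSum _ fun i _ => integrable_finsetSum _ fun j _ => hint' i j]
        exact Finset.sum_congr rfl fun i _ => (integral_finsetSum _ fun j _ => hint' i j).symm
    _ = _ := by
        simp only [sq_sum_mul_kernel]

theorem sum_mul_kernelGram (hK : IsKernel K Kmax LK) (v : MIdx d (ell β) → ℝ) :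
    ∑ i, ∑ j, v i * kernelGram β K i j * v j
      = ∫ u, (∑ m, v m * monoVec d (ell β) u m) ^ 2 * K u :=
  sum_mul_integral_momentKernel (integrable_momentKernel hK) v

theorem integrable_sq_mul_kernel (hK : IsKernel K Kmax LK) {ℓ : ℕ} (v : MIdx d ℓ → ℝ) :
    Integrable fun u => (∑ m, v m * monoVec d ℓ u m) ^ 2 * K u := by
  have := hK.continuous
  refine Continuous.integrable_of_hasCompactSupport (by fun_prop) ?_
  exact hK.hasCompactSupport.mul_left

/-- The functions `u ^ m / m!` are linearly independent on every nonempty open set. -/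
theorem eq_zero_of_sum_monoVec_eq_zero {ℓ : ℕ} {v : MIdx d ℓ → ℝ} {S : Set (E d)}
    (hS : IsOpen S) (hne : S.Nonempty) (h : ∀ u ∈ S, ∑ m, v m * monoVec d ℓ u m = 0) :
    v = 0 := by
  classical
  set p : MvPolynomial (Fin d) ℝ :=
    ∑ m : MIdx d ℓ, MvPolynomial.monomial (Finsupp.equivFunOnFinite.symm m.coord) (v m / m.fact)
    with hp
  have heval : ∀ x : Fin d → ℝ, MvPolynomial.eval x p =
      ∑ m, v m * monoVec d ℓ (WithLp.toLp 2 x) m := by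
    intro x
    rw [hp, map_sum]
    refine Finset.sum_congr rfl fun m _ => ?_
    rw [MvPolynomial.eval_monomial, Finsupp.prod_fintype _ _ (by simp)]
    simp [monoVec, MIdx.monomial]
    ring
  have hp0 : p = 0 := by
    obtain ⟨u₀, hu₀⟩ := hne
    have hS' : IsOpen ((WithLp.toLp 2 : (Fin d → ℝ) → E d) ⁻¹' S) :=
      hS.preimage (PiLp.continuous_toLp 2 _)
    obtain ⟨ε, hε, hball⟩ := Metric.isOpen_iff.1 hS' (WithLp.ofLp u₀) (by simpa using hu₀)
    refine MvPolynomial.funext_set (fun i => Metric.ball (u₀ i) ε) (fun i => ?_) fun x hx => ?_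
    · rw [Real.ball_eq_Ioo]; exact Set.Ioo_infinite (by linarith)
    · rw [map_zero, heval]
      refine h _ (hball ?_)
      rw [ball_pi _ hε]; exact hx
  funext m
  have hc := congrArg (MvPolynomial.coeff (Finsupp.equivFunOnFinite.symm m.coord)) hp0
  rw [hp, MvPolynomial.coeff_sum, Finset.sum_eq_single m] at hc
  · have := m.one_le_fact
    simp at hc
    rcases hc with hc | hc
    · simpa using hc
    · linarith
  · intro m' _ hne'
    rw [MvPolynomial.coeff_monomial, if_neg]
    intro he
    exact hne' (MIdx.coord_injective (Finsupp.equivFunOnFinite.symm.injective he))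
  · simp

theorem minEigenvalue_kernelGram_pos (hK : IsKernel K Kmax LK) :
    0 < minEigenvalue (kernelGram β K) := by
  refine minEigenvalue_pos _ fun v hv => ?_
  rw [sum_mul_kernelGram hK]
  have hKc := hK.continuous
  have hc : Continuous fun u => (∑ m, v m * monoVec d (ell β) u m) ^ 2 * K u := by fun_prop
  by_contra hle
  apply hv
  obtain ⟨u₁, hu₁⟩ := hK.exists_pos
  refine eq_zero_of_sum_monoVec_eq_zero (S := {u | 0 < K u})
    (isOpen_lt continuous_const hKc) ⟨u₁, hu₁⟩ fun u hu => ?_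
  by_contra hne
  refine hle (hc.integral_pos_of_hasCompactSupport_nonneg_nonzero
    hK.hasCompactSupport.mul_left
    (fun u => mul_nonneg (sq_nonneg _) (hK.nonneg u)) (x := u) ?_)
  exact mul_ne_zero (pow_ne_zero 2 hne) (ne_of_gt hu)

theorem minEigenvalue_kernelGram_mul_le (hK : IsKernel K Kmax LK) (v : MIdx d (ell β) → ℝ) :
    minEigenvalue (kernelGram β K) * ∑ m, v m ^ 2
      ≤ ∫ u, (∑ m, v m * monoVec d (ell β) u m) ^ 2 * K u := by
  rw [← sum_mul_kernelGram hK]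
  refine minEigenvalue_mul_le _ (fun w => ?_) v
  rw [sum_mul_kernelGram hK]
  exact integral_nonneg fun u => mul_nonneg (sq_nonneg _) (hK.nonneg u)

end Gram

/-! ### The bandwidth -/

section Bandwidth

variable {d : ℕ} {β : ℝ} {k : ℕ}

theorem log_div_pos (hk : 1 ≤ k) : 0 < Real.log (k + 1) / k := by
  have hk' : (1 : ℝ) ≤ k := by exact_mod_cast hk
  exact div_pos (Real.log_pos (by linarith)) (by linarith)

theorem log_div_le_one (hk : 1 ≤ k) : Real.log (k + 1) / k ≤ 1 := by
  have hk' : (1 : ℝ) ≤ k := by exact_mod_cast hk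
  rw [div_le_one (by linarith)]
  linarith [Real.log_le_sub_one_of_pos (show (0 : ℝ) < k + 1 by linarith)]

theorem half_le_log (hk : 1 ≤ k) : 1 / 2 ≤ Real.log ((k : ℝ) + 1) := by
  have hk' : (1 : ℝ) ≤ k := by exact_mod_cast hk
  have := Real.log_le_log (by norm_num) (show (2 : ℝ) ≤ k + 1 by linarith)
  linarith [Real.log_two_gt_d9]

theorem bandwidth_pos (hk : 1 ≤ k) : 0 < bandwidth d β k :=
  Real.rpow_pos_of_pos (log_div_pos hk) _

theorem bandwidth_le_one (hβ : 2 ≤ β) (hk : 1 ≤ k) : bandwidth d β k ≤ 1 :=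
  Real.rpow_le_one (log_div_pos hk).le (log_div_le_one hk) (by positivity)

theorem regParam_pos (hk : 1 ≤ k) : 0 < regParam d β k :=
  Real.rpow_pos_of_pos (log_div_pos hk) _

theorem regParam_le_one (hβ : 2 ≤ β) (hk : 1 ≤ k) : regParam d β k ≤ 1 :=
  Real.rpow_le_one (log_div_pos hk).le (log_div_le_one hk) (by positivity)

theorem bandwidth_rpow (hk : 1 ≤ k) : bandwidth d β k ^ β = regParam d β k := by
  rw [bandwidth, regParam, ← Real.rpow_mul (log_div_pos hk).le]
  congr 1; ring

theorem regParam_le_bandwidth (hβ : 2 ≤ β) (hk : 1 ≤ k) :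
    regParam d β k ≤ bandwidth d β k := by
  rw [← bandwidth_rpow hk]
  calc _ ≤ bandwidth d β k ^ (1 : ℝ) :=
        Real.rpow_le_rpow_of_exponent_ge (bandwidth_pos hk) (bandwidth_le_one hβ hk) (by linarith)
    _ = _ := Real.rpow_one _

/-- The bandwidth balances bias and variance: `k h_k ^ d = log (k + 1) λ_k⁻²`. -/
theorem regParam_sq_mul (hβ : 2 ≤ β) (hk : 1 ≤ k) :
    regParam d β k ^ 2 * (k * bandwidth d β k ^ d) = Real.log (k + 1) := by
  have h0 := log_div_pos hk
  have hk' : (1 : ℝ) ≤ k := by exact_mod_cast hk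
  have e : regParam d β k ^ 2 * bandwidth d β k ^ d = Real.log (k + 1) / k := by
    rw [bandwidth, regParam, ← Real.rpow_natCast, ← Real.rpow_natCast, ← Real.rpow_mul h0.le,
      ← Real.rpow_mul h0.le, ← Real.rpow_add h0]
    have h2 : 2 * β + d ≠ 0 := by positivity
    have h1 : β / (2 * β + d) * (2 : ℕ) + 1 / (2 * β + d) * d = 1 := by
      field_simp
      push_cast; ring
    rw [h1, Real.rpow_one]
  calc _ = k * (regParam d β k ^ 2 * bandwidth d β k ^ d) := by ring
    _ = _ := by rw [e]; field_simp

theorem inv_mul_bandwidth_pow (hβ : 2 ≤ β) (hk : 1 ≤ k) :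
    1 / (k * bandwidth d β k ^ d) = regParam d β k ^ 2 / Real.log (k + 1) := by
  have hk' : (1 : ℝ) ≤ k := by exact_mod_cast hk
  have h1 := bandwidth_pos (d := d) (β := β) hk
  rw [← regParam_sq_mul (d := d) hβ hk]
  have h2 := regParam_pos (d := d) (β := β) hk
  field_simp

theorem sq_inv_bandwidth_mul_regParam (hk : 1 ≤ k) :
    ((bandwidth d β k)⁻¹ * regParam d β k) ^ 2
      = (Real.log (k + 1) / k) ^ (2 * (β - 1) / (2 * β + d)) := by
  have h0 := log_div_pos hk
  rw [bandwidth, regParam, ← Real.rpow_neg h0.le, ← Real.rpow_add h0, ← Real.rpow_natCast,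
    ← Real.rpow_mul h0.le]
  congr 1; push_cast; ring

end Bandwidth

/-! ### Ridge regression -/

section Ridge

variable {ι : Type*} [Fintype ι]

theorem norm_toLp_sq (v : ι → ℝ) : ‖WithLp.toLp 2 v‖ ^ 2 = ∑ i, v i ^ 2 := by
  rw [EuclideanSpace.real_norm_sq_eq]

theorem norm_toLp_le_card_mul {v : ι → ℝ} {c : ℝ} (hv : ∀ i, |v i| ≤ c) :
    ‖WithLp.toLp 2 v‖ ≤ Fintype.card ι * c := by
  have h1 : ‖WithLp.toLp 2 v‖ ≤ ∑ i, |v i| := by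
    refine le_of_sq_le_sq ?_ (Finset.sum_nonneg fun _ _ => abs_nonneg _)
    rw [norm_toLp_sq]
    calc ∑ i, v i ^ 2 = ∑ i, |v i| ^ 2 := by simp
      _ ≤ _ := Finset.sum_sq_le_sq_sum_of_nonneg fun i _ => abs_nonneg _
  refine h1.trans ((Finset.sum_le_sum fun i _ => hv i).trans ?_)
  simp

/-- Stability of ridge regression: if the data `B θ + b` deviate by `b` from those of `θ`, then
`(B + λ)⁻¹ (B θ + b)` is as close to `θ` as the spectral gap `μ` of `B` permits. -/
theorem ridge_error [DecidableEq ι] {B : Matrix ι ι ℝ} {lam μ : ℝ} (hlam : 0 < lam) (hμ : 0 ≤ μ)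
    (hB : ∀ v : ι → ℝ, μ * ∑ i, v i ^ 2 ≤ ∑ i, ∑ j, v i * B i j * v j) (θ b : ι → ℝ) :
    ‖WithLp.toLp 2 (((B + lam • (1 : Matrix ι ι ℝ))⁻¹).mulVec (B.mulVec θ + b) - θ)‖ * (μ + lam)
      ≤ ‖WithLp.toLp 2 b‖ + lam * ‖WithLp.toLp 2 θ‖ := by
  set A := B + lam • (1 : Matrix ι ι ℝ) with hA
  have hAv : ∀ v : ι → ℝ, A.mulVec v = B.mulVec v + lam • v := fun v => by
    rw [hA, Matrix.add_mulVec, Matrix.smul_mulVec, Matrix.one_mulVec]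
  have hquad : ∀ v : ι → ℝ, (μ + lam) * ∑ i, v i ^ 2 ≤ ∑ i, v i * A.mulVec v i := by
    intro v
    have e : ∑ i, v i * A.mulVec v i = ∑ i, ∑ j, v i * B i j * v j + lam * ∑ i, v i ^ 2 := by
      rw [hAv, Finset.mul_sum, ← Finset.sum_add_distrib]
      refine Finset.sum_congr rfl fun i _ => ?_
      simp only [Pi.add_apply, Pi.smul_apply, smul_eq_mul, Matrix.mulVec, dotProduct, mul_add,
        Finset.mul_sum, mul_assoc]
      ring
    rw [e]; linarith [hB v]
  have hdet : A.det ≠ 0 := by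
    intro h
    obtain ⟨v, hv, hv0⟩ := Matrix.exists_mulVec_eq_zero_iff.2 h
    have h1 := hquad v
    rw [hv0] at h1
    simp only [Pi.zero_apply, mul_zero, Finset.sum_const_zero] at h1
    have h2 : ∑ i, v i ^ 2 = 0 :=
      le_antisymm (by by_contra! h3; nlinarith [mul_pos (by linarith : 0 < μ + lam) h3])
        (Finset.sum_nonneg fun _ _ => sq_nonneg _)
    apply hv
    funext i
    have := (Finset.sum_eq_zero_iff_of_nonneg fun i _ => sq_nonneg (v i)).1 h2 i
      (Finset.mem_univ i)
    simpa using this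
  set e := A⁻¹.mulVec (B.mulVec θ + b) - θ with he
  have hAe : A.mulVec e = b - lam • θ := by
    rw [he, Matrix.mulVec_sub, Matrix.mulVec_mulVec, Matrix.mul_nonsing_inv _ hdet.isUnit,
      Matrix.one_mulVec, hAv]
    abel
  have h1 := hquad e
  rw [hAe, ← norm_toLp_sq] at h1
  have h2 : ∑ i, e i * (b - lam • θ) i ≤ ‖WithLp.toLp 2 e‖ * ‖WithLp.toLp 2 (b - lam • θ)‖ := by
    have := real_inner_le_norm (WithLp.toLp 2 e) (WithLp.toLp 2 (b - lam • θ))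
    rw [PiLp.inner_apply] at this
    refine le_trans (le_of_eq ?_) this
    refine Finset.sum_congr rfl fun i _ => ?_
    simp [mul_comm]
  have h3 : ‖WithLp.toLp 2 (b - lam • θ)‖ ≤ ‖WithLp.toLp 2 b‖ + lam * ‖WithLp.toLp 2 θ‖ := by
    rw [WithLp.toLp_sub, WithLp.toLp_smul]
    refine (norm_sub_le _ _).trans ?_
    rw [norm_smul, Real.norm_of_nonneg hlam.le]
  refine le_trans ?_ h3
  rcases (norm_nonneg (WithLp.toLp 2 e)).eq_or_lt with h0 | h0
  · rw [← h0, zero_mul]; exact norm_nonneg _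
  · by_contra! hlt
    nlinarith [mul_lt_mul_of_pos_left hlt h0]

end Ridge

/-! ### Taylor coefficients -/

section Taylor

variable {d : ℕ} {Θ : Set (E d)} {K f : E d → ℝ} {β L M Kmax LK : ℝ}

/-- The coefficients `h ^ |m| D ^ m f(z)` of the Taylor polynomial of `f` at `z` with respect to
the basis `U(· / h)`. -/
noncomputable def taylorVec (β : ℝ) (f : E d → ℝ) (z : E d) (h : ℝ) : MIdx d (ell β) → ℝ :=
  fun m => h ^ m.deg * m.deriv f z

theorem abs_sub_taylorVec_le (hf : HolderClass β L f) (z u : E d) {h : ℝ} (hh : 0 < h) :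
    |f (z + h • u) - ∑ m, taylorVec β f z h m * monoVec d (ell β) u m|
      ≤ L * (h * ‖u‖) ^ β := by
  have := hf.taylor z (z + h • u)
  rw [add_sub_cancel_left, norm_smul, Real.norm_of_nonneg hh.le] at this
  refine le_trans (le_of_eq ?_) this
  congr 2
  refine Finset.sum_congr rfl fun m _ => ?_
  rw [MIdx.monomial_smul, taylorVec, monoVec]
  ring

/-- The derivatives of `f` are controlled by testing the Taylor polynomial against the kernel,
which has a bound free of the dimension. -/
theorem sum_taylorVec_sq_le (hβ : 2 ≤ β) (hL : 0 < L) (hK : IsKernel K Kmax LK)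
    (hf : HolderClass β L f) (hM : ∀ x ∈ enlarge Θ, |f x| ≤ M) {z : E d} (hz : z ∈ Θ) {h : ℝ}
    (hh0 : 0 ≤ h) (hh : h ≤ 1) :
    ∑ m, taylorVec β f z h m ^ 2 ≤ (M + L) ^ 2 / minEigenvalue (kernelGram β K) := by
  have hκ := minEigenvalue_kernelGram_pos (β := β) hK
  have h1 : ∑ m, taylorVec β f z h m ^ 2 ≤ ∑ m, taylorVec β f z 1 m ^ 2 := by
    refine Finset.sum_le_sum fun m _ => ?_
    rw [taylorVec, taylorVec, mul_pow, mul_pow, one_pow, one_pow]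
    have : (h ^ m.deg) ^ 2 ≤ 1 := pow_le_one₀ (by positivity) (pow_le_one₀ hh0 hh)
    exact mul_le_mul_of_nonneg_right this (sq_nonneg _)
  refine h1.trans ?_
  rw [le_div_iff₀ hκ, mul_comm]
  refine (minEigenvalue_kernelGram_mul_le hK _).trans ?_
  have hbound : ∀ u, (∑ m, taylorVec β f z 1 m * monoVec d (ell β) u m) ^ 2 * K u
      ≤ (M + L) ^ 2 * K u := by
    intro u
    rcases lt_or_ge 1 ‖u‖ with hu | hu
    · simp [hK.eq_zero hu]
    refine mul_le_mul_of_nonneg_right ?_ (hK.nonneg u)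
    have ht := abs_sub_taylorVec_le hf z u one_pos
    rw [one_smul, one_mul] at ht
    have hfu := hM (z + u) ⟨z, hz, u, hu, rfl⟩
    have hpow : ‖u‖ ^ β ≤ 1 := Real.rpow_le_one (norm_nonneg _) hu (by linarith)
    have : L * ‖u‖ ^ β ≤ L := mul_le_of_le_one_right hL.le hpow
    rw [← sq_abs]
    refine pow_le_pow_left₀ (abs_nonneg _) ?_ 2
    rw [abs_le] at *
    constructor <;> linarith
  calc _ ≤ ∫ u, (M + L) ^ 2 * K u :=
        integral_mono (integrable_sq_mul_kernel hK _) ((integrable_kernel hK).const_mul _) hbound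
    _ = (M + L) ^ 2 := by rw [integral_const_mul, hK.integral_eq_one, mul_one]

theorem one_le_ell (hβ : 2 ≤ β) : 1 ≤ ell β := by
  have : 2 ≤ ⌈β⌉₊ := by
    have := Nat.le_ceil β
    exact_mod_cast hβ.trans this
  unfold ell; omega

theorem sum_unitIdx_sq_le {ℓ : ℕ} (hℓ : 1 ≤ ℓ) (v : MIdx d ℓ → ℝ) :
    ∑ i, v (unitIdx hℓ i) ^ 2 ≤ ∑ m, v m ^ 2 := by
  classical
  rw [← Finset.sum_image (f := fun m => v m ^ 2) (s := Finset.univ) (g := unitIdx hℓ)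
    fun i _ j _ h => unitIdx_injective hℓ h]
  exact Finset.sum_le_sum_of_subset_of_nonneg (Finset.subset_univ _) fun _ _ _ => sq_nonneg _

theorem norm_gradient_sq_le (hβ : 2 ≤ β) (f : E d → ℝ) (z : E d) :
    ‖gradient f z‖ ^ 2 ≤ ∑ m, taylorVec β f z 1 m ^ 2 := by
  rw [EuclideanSpace.real_norm_sq_eq]
  refine le_trans (le_of_eq ?_) (sum_unitIdx_sq_le (one_le_ell hβ) _)
  refine Finset.sum_congr rfl fun i _ => ?_
  rw [taylorVec, one_pow, one_mul, deriv_unitIdx, gradient_apply]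

theorem Amat_mulVec {ℓ : ℕ} (hℓ : 1 ≤ ℓ) (v : MIdx d ℓ → ℝ) (i : Fin d) :
    (Amat d ℓ).mulVec v i = v (unitIdx hℓ i) := by
  classical
  rw [Matrix.mulVec, dotProduct, Finset.sum_eq_single (unitIdx hℓ i)]
  · simp [Amat, unitIdx]
  · intro m _ hm
    have : m.coord ≠ Pi.single i 1 := fun h => hm (MIdx.coord_injective h)
    simp [Amat, this]
  · simp

end Taylor

/-! ### Deterministic error bound for the gradient estimator -/

section GradientError

variable {d n : ℕ} {Θ : Set (E d)} {K f : E d → ℝ} {β L M Kmax LK : ℝ}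

theorem Bmat_apply (x : Fin n → E d) (k : ℕ) (z : E d) (m m' : MIdx d (ell β)) :
    Bmat β K x k z m m' = 1 / (k * bandwidth d β k ^ d) *
      ∑ i ∈ firstIdx n k, momentKernel K m m' ((bandwidth d β k)⁻¹ • (x i - z)) := by
  rw [Bmat, Matrix.smul_apply, Matrix.sum_apply, smul_eq_mul]
  congr 1
  refine Finset.sum_congr rfl fun i _ => ?_
  rw [Matrix.smul_apply, Matrix.vecMulVec_apply, momentKernel, smul_eq_mul]
  ring

theorem Dvec_apply (x : Fin n → E d) (y : Fin n → ℝ) (k : ℕ) (z : E d) (m : MIdx d (ell β)) :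
    Dvec β K x y k z m = 1 / (k * bandwidth d β k ^ d) *
      ∑ i ∈ firstIdx n k,
        y i * momentKernel K m (zeroIdx d _) ((bandwidth d β k)⁻¹ • (x i - z)) := by
  rw [Dvec, Pi.smul_apply, Finset.sum_apply, smul_eq_mul]
  congr 1
  refine Finset.sum_congr rfl fun i _ => ?_
  rw [Pi.smul_apply, momentKernel, monoVec_zeroIdx, smul_eq_mul]
  ring

theorem Bmat_quadForm_nonneg (hK : IsKernel K Kmax LK) (x : Fin n → E d) {k : ℕ} (hk : 1 ≤ k)
    (z : E d) (v : MIdx d (ell β) → ℝ) :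
    0 ≤ ∑ m, ∑ m', v m * Bmat β K x k z m m' * v m' := by
  have hh := bandwidth_pos (d := d) (β := β) hk
  have e : ∑ m, ∑ m', v m * Bmat β K x k z m m' * v m' = 1 / (k * bandwidth d β k ^ d) *
      ∑ i ∈ firstIdx n k, (∑ m, v m * monoVec d (ell β) ((bandwidth d β k)⁻¹ • (x i - z)) m) ^ 2
        * K ((bandwidth d β k)⁻¹ • (x i - z)) := by
    simp only [Bmat_apply, sq_sum_mul_kernel]
    rw [Finset.sum_comm (s := firstIdx n k), Finset.mul_sum]
    refine Finset.sum_congr rfl fun m _ => ?_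
    rw [Finset.sum_comm (s := firstIdx n k), Finset.mul_sum]
    refine Finset.sum_congr rfl fun m' _ => ?_
    rw [← Finset.sum_mul, ← Finset.mul_sum]
    ring
  rw [e]
  exact mul_nonneg (by positivity) (Finset.sum_nonneg fun i _ =>
    mul_nonneg (sq_nonneg _) (hK.nonneg _))

theorem sum_sum_sub_le {ι : Type*} [Fintype ι] {A : Matrix ι ι ℝ} {δ : ℝ}
    (h : ∀ i j, |A i j| ≤ δ) (v : ι → ℝ) :
    -(Fintype.card ι * δ * ∑ i, v i ^ 2) ≤ ∑ i, ∑ j, v i * A i j * v j := by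
  have hterm : ∀ i j, -(δ * (v i ^ 2 / 2 + v j ^ 2 / 2)) ≤ v i * A i j * v j := by
    intro i j
    have h1 : |v i * A i j * v j| ≤ δ * (|v i| * |v j|) := by
      rw [abs_mul, abs_mul]
      nlinarith [h i j, mul_nonneg (abs_nonneg (v i)) (abs_nonneg (v j))]
    have h2 : |v i| * |v j| ≤ v i ^ 2 / 2 + v j ^ 2 / 2 := by
      nlinarith [sq_nonneg (|v i| - |v j|), sq_abs (v i), sq_abs (v j)]
    have hδ := (abs_nonneg _).trans (h i j)
    linarith [neg_abs_le (v i * A i j * v j), mul_le_mul_of_nonneg_left h2 hδ]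
  calc -(Fintype.card ι * δ * ∑ i, v i ^ 2)
      = ∑ i, ∑ j, -(δ * (v i ^ 2 / 2 + v j ^ 2 / 2)) := by
        simp only [Finset.sum_neg_distrib, ← Finset.mul_sum, Finset.sum_add_distrib,
          Finset.sum_const, Finset.card_univ, nsmul_eq_mul, ← Finset.sum_div]
        ring
    _ ≤ _ := Finset.sum_le_sum fun i _ => Finset.sum_le_sum fun j _ => hterm i j

/-- The error of the gradient estimator, in terms of the deviation `Δ` of the Gram matrix `B`
from its expectation `Bbar` and of the size `Γ` of the noise, both in units of `λ_k`. The factor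
`1 + ν Δ`, where `ν` is the number of multi-indices, covers the case that the deviation spoils the
spectral gap of `B`, in which only the regularization is left. -/
theorem norm_gradEst_sub_le (hβ : 2 ≤ β) (hL : 0 < L) (hK : IsKernel K Kmax LK)
    (hf : HolderClass β L f) {x : Fin n → E d} {ξ : Fin n → ℝ} {k : ℕ} (hk : 1 ≤ k) {z : E d}
    {Bbar : Matrix (MIdx d (ell β)) (MIdx d (ell β)) ℝ} {c pmax Δ Γ T : ℝ} (hc : 0 < c)
    (hBbar : ∀ v : MIdx d (ell β) → ℝ,
      2 * c * ∑ m, v m ^ 2 ≤ ∑ m, ∑ m', v m * Bbar m m' * v m')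
    (hBbar0 : Bbar (zeroIdx d _) (zeroIdx d _) ≤ pmax) (hT0 : 0 ≤ T)
    (hT : ∑ m, taylorVec β f z (bandwidth d β k) m ^ 2 ≤ T ^ 2)
    (hΔ : ∀ m m', |Bmat β K x k z m m' - Bbar m m'| ≤ regParam d β k * Δ)
    (hΓ : ∀ m : MIdx d (ell β), |1 / (k * bandwidth d β k ^ d) * ∑ i ∈ firstIdx n k,
      ξ i * momentKernel K m (zeroIdx d _) ((bandwidth d β k)⁻¹ • (x i - z))|
        ≤ regParam d β k * Γ) :
    ‖gradEst β K x (fun i => f (x i) + ξ i) k z - gradient f z‖ ≤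
      (bandwidth d β k)⁻¹ * regParam d β k *
        ((T + Fintype.card (MIdx d (ell β)) * (L * (pmax + Δ) + Γ)) / c *
          (1 + Fintype.card (MIdx d (ell β)) * Δ)) := by
  set h := bandwidth d β k with hh
  set ρ := regParam d β k with hρ
  set ν : ℝ := (Fintype.card (MIdx d (ell β)) : ℝ) with hν
  set B := Bmat β K x k z with hB
  have hh0 : 0 < h := bandwidth_pos hk
  have hρ0 : 0 < ρ := regParam_pos hk
  have hρ1 : ρ ≤ 1 := regParam_le_one hβ hk
  have hν0 : 0 < ν := by rw [hν]; exact_mod_cast Fintype.card_pos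
  have hk0 : (0 : ℝ) < k := by exact_mod_cast hk
  have hΔ0 : 0 ≤ Δ := by
    have := (abs_nonneg _).trans (hΔ (zeroIdx d _) (zeroIdx d _))
    exact nonneg_of_mul_nonneg_right this hρ0
  have hΓ0 : 0 ≤ Γ := by
    have := (abs_nonneg _).trans (hΓ (zeroIdx d _))
    exact nonneg_of_mul_nonneg_right this hρ0
  set u : Fin n → E d := fun i => h⁻¹ • (x i - z) with hu
  have hxu : ∀ i, z + h • u i = x i := fun i => by
    rw [hu]; simp only; rw [smul_inv_smul₀ hh0.ne']; abel
  set θ := taylorVec β f z h with hθ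
  set r : Fin n → ℝ := fun i => f (x i) - ∑ m, θ m * monoVec d (ell β) (u i) m with hr
  set b : MIdx d (ell β) → ℝ := fun m => 1 / (k * h ^ d) * ∑ i ∈ firstIdx n k,
    (r i + ξ i) * momentKernel K m (zeroIdx d _) (u i) with hb
  have hD : Dvec β K x (fun i => f (x i) + ξ i) k z = B.mulVec θ + b := by
    funext m
    rw [Dvec_apply, Pi.add_apply, Matrix.mulVec, dotProduct, hb]
    simp only [hB, Bmat_apply]
    have e1 : ∑ m', 1 / (k * bandwidth d β k ^ d) * (∑ i ∈ firstIdx n k,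
        momentKernel K m m' ((bandwidth d β k)⁻¹ • (x i - z))) * θ m'
        = 1 / (k * h ^ d) * ∑ i ∈ firstIdx n k,
          (∑ m', θ m' * monoVec d (ell β) (u i) m') * momentKernel K m (zeroIdx d _) (u i) := by
      simp only [mul_assoc, ← Finset.mul_sum, ← hh]
      congr 1
      simp only [Finset.sum_mul]
      rw [Finset.sum_comm]
      refine Finset.sum_congr rfl fun i _ => Finset.sum_congr rfl fun m' _ => ?_
      simp only [momentKernel, monoVec_zeroIdx, hu]
      ring
    rw [e1, ← mul_add, ← Finset.sum_add_distrib]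
    congr 1
    refine Finset.sum_congr rfl fun i _ => ?_
    simp only [hr, hu]
    ring
  -- the remainder of the Taylor expansion is of order `h ^ β` where the kernel does not vanish
  have hrK : ∀ (m : MIdx d (ell β)) (i), |r i * momentKernel K m (zeroIdx d _) (u i)| ≤ L * ρ * K (u i) := by
    intro m i
    rcases lt_or_ge 1 ‖u i‖ with hui | hui
    · simp [momentKernel, hK.eq_zero hui]
    rw [abs_mul]
    refine mul_le_mul ?_ (abs_momentKernel_le hK _ _ _) (abs_nonneg _) (by positivity)
    have h1 := abs_sub_taylorVec_le hf z (u i) hh0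
    rw [hxu] at h1
    refine h1.trans ?_
    rw [hρ, ← bandwidth_rpow hk, ← hh]
    gcongr
    exact mul_le_of_le_one_right hh0.le hui
  have hB00 : 1 / (k * h ^ d) * ∑ i ∈ firstIdx n k, K (u i) ≤ pmax + Δ := by
    have h1 := (abs_le.1 (hΔ (zeroIdx d _) (zeroIdx d _))).2
    have h2 : B (zeroIdx d _) (zeroIdx d _)
        = 1 / (k * h ^ d) * ∑ i ∈ firstIdx n k, K (u i) := by
      rw [hB, Bmat_apply]
      simp [momentKernel, monoVec_zeroIdx, hu, hh]
    rw [← h2]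
    have h3 : ρ * Δ ≤ Δ := mul_le_of_le_one_left hΔ0 hρ1
    linarith
  have hbm : ∀ m, |b m| ≤ ρ * (L * (pmax + Δ) + Γ) := by
    intro m
    have e : b m = 1 / (k * h ^ d) * ∑ i ∈ firstIdx n k,
          r i * momentKernel K m (zeroIdx d _) (u i)
        + 1 / (k * h ^ d) * ∑ i ∈ firstIdx n k,
          ξ i * momentKernel K m (zeroIdx d _) (u i) := by
      rw [← mul_add, ← Finset.sum_add_distrib]
      simp only [hb, add_mul]
    rw [e]
    refine (abs_add_le _ _).trans ?_
    rw [mul_add]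
    refine add_le_add ?_ (hΓ m)
    rw [abs_mul, abs_of_pos (by positivity : 0 < 1 / (k * h ^ d))]
    calc 1 / (k * h ^ d) * |∑ i ∈ firstIdx n k, r i * momentKernel K m (zeroIdx d _) (u i)|
        ≤ 1 / (k * h ^ d) * ∑ i ∈ firstIdx n k, L * ρ * K (u i) := by
          gcongr
          exact (Finset.abs_sum_le_sum_abs _ _).trans (Finset.sum_le_sum fun i _ => hrK m i)
      _ = L * ρ * (1 / (k * h ^ d) * ∑ i ∈ firstIdx n k, K (u i)) := by
          rw [← Finset.mul_sum]; ring
      _ ≤ L * ρ * (pmax + Δ) := by gcongr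
      _ = _ := by ring
  have hbn : ‖WithLp.toLp 2 b‖ ≤ ν * (ρ * (L * (pmax + Δ) + Γ)) := norm_toLp_le_card_mul hbm
  have hθn : ‖WithLp.toLp 2 θ‖ ≤ T := by
    refine le_of_sq_le_sq ?_ hT0
    rw [norm_toLp_sq]; exact hT
  set e := ((B + ρ • (1 : Matrix _ _ ℝ))⁻¹).mulVec (B.mulVec θ + b) - θ with he
  have hgrad : ‖gradEst β K x (fun i => f (x i) + ξ i) k z - gradient f z‖
      ≤ h⁻¹ * ‖WithLp.toLp 2 e‖ := by
    refine le_of_sq_le_sq ?_ (by positivity)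
    rw [mul_pow, norm_toLp_sq, EuclideanSpace.real_norm_sq_eq]
    refine le_trans (le_of_eq ?_)
      (mul_le_mul_of_nonneg_left (sum_unitIdx_sq_le (one_le_ell hβ) e) (sq_nonneg _))
    rw [Finset.mul_sum]
    refine Finset.sum_congr rfl fun i _ => ?_
    have e1 : (gradEst β K x (fun i => f (x i) + ξ i) k z - gradient f z) i
        = h⁻¹ * e (unitIdx (one_le_ell hβ) i) := by
      rw [PiLp.sub_apply, gradient_apply, gradEst, hD]
      simp only [Pi.smul_apply, Amat_mulVec (one_le_ell hβ), smul_eq_mul]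
      rw [he, Pi.sub_apply, mul_sub]
      congr 1
      rw [hθ, taylorVec, deg_unitIdx, deriv_unitIdx, pow_one, inv_mul_cancel_left₀ hh0.ne']
    rw [e1, mul_pow]
  set S := T + ν * (L * (pmax + Δ) + Γ) with hS
  -- both `b` and the bias of the regularization are of order `ρ`
  have hnum : ‖WithLp.toLp 2 b‖ + ρ * ‖WithLp.toLp 2 θ‖ ≤ ρ * S := by
    have : ρ * ‖WithLp.toLp 2 θ‖ ≤ ρ * T := by gcongr
    rw [hS, mul_add]; linarith
  have hS0 : 0 ≤ S := by
    have : 0 ≤ ρ * S := le_trans (by positivity) hnum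
    exact nonneg_of_mul_nonneg_right this hρ0
  have hen : ‖WithLp.toLp 2 e‖ ≤ ρ * (S / c * (1 + ν * Δ)) := by
    rcases le_or_gt (ν * (ρ * Δ)) c with hgood | hbad
    · have hgap : ∀ v : MIdx d (ell β) → ℝ,
          c * ∑ m, v m ^ 2 ≤ ∑ m, ∑ m', v m * B m m' * v m' := by
        intro v
        have h1 := sum_sum_sub_le (A := B - Bbar) (fun m m' => by simpa using hΔ m m') v
        have h2 : ∑ m, ∑ m', v m * (B - Bbar) m m' * v m'
            = ∑ m, ∑ m', v m * B m m' * v m' - ∑ m, ∑ m', v m * Bbar m m' * v m' := by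
          simp only [← Finset.sum_sub_distrib, Matrix.sub_apply]
          refine Finset.sum_congr rfl fun i _ => Finset.sum_congr rfl fun j _ => by ring
        have h3 : 0 ≤ ∑ m, v m ^ 2 := Finset.sum_nonneg fun _ _ => sq_nonneg _
        have h4 := mul_le_mul_of_nonneg_right hgood h3
        have := hBbar v
        rw [h2] at h1
        linarith
      have h1 := (ridge_error hρ0 hc.le hgap θ b).trans hnum
      have h2 : ‖WithLp.toLp 2 e‖ ≤ ρ * (S / c) := by
        rw [mul_div_assoc', le_div_iff₀ hc]
        refine le_trans ?_ h1
        gcongr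
        linarith
      refine h2.trans ?_
      gcongr
      exact le_mul_of_one_le_right (by positivity) (le_add_of_nonneg_right (by positivity))
    -- without a spectral gap, the regularization `ρ` alone bounds the inverse, and `c < ν ρ Δ`
    -- compensates the loss
    · have h1 := (ridge_error hρ0 le_rfl (fun v => by
        rw [zero_mul]; exact Bmat_quadForm_nonneg hK x hk z v) θ b).trans hnum
      rw [zero_add, mul_comm] at h1
      have h2 : ‖WithLp.toLp 2 e‖ ≤ S := le_of_mul_le_mul_left h1 hρ0
      refine h2.trans ?_
      have h3 : c ≤ ρ * (1 + ν * Δ) := by nlinarith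
      calc S = S / c * c := by field_simp
        _ ≤ S / c * (ρ * (1 + ν * Δ)) := by gcongr
        _ = _ := by ring
  calc _ ≤ h⁻¹ * ‖WithLp.toLp 2 e‖ := hgrad
    _ ≤ h⁻¹ * (ρ * (S / c * (1 + ν * Δ))) := by gcongr
    _ = _ := by ring

end GradientError

/-! ### Elementary inequalities -/

section Elementary

theorem exp_le_one_add_add_sq_mul (x : ℝ) : Real.exp x ≤ 1 + x + x ^ 2 * Real.exp |x| := by
  have h := Complex.norm_exp_sub_sum_le_norm_mul_exp (x : ℂ) 2
  have e : Complex.exp x - ∑ m ∈ Finset.range 2, (x : ℂ) ^ m / (m.factorial : ℂ)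
      = ((Real.exp x - (1 + x) : ℝ) : ℂ) := by
    simp [Finset.sum_range_succ]
  rw [e, Complex.norm_real, Complex.norm_real, Real.norm_eq_abs, Real.norm_eq_abs, sq_abs] at h
  linarith [le_abs_self (Real.exp x - (1 + x))]

theorem sq_mul_exp_half_le {t : ℝ} (ht : 0 ≤ t) : t ^ 2 * Real.exp (t / 2) ≤ 8 * Real.exp t := by
  have h := Real.quadratic_le_exp_of_nonneg (x := t / 2) (by linarith)
  have h2 : t ^ 2 ≤ 8 * Real.exp (t / 2) := by nlinarith
  have e : Real.exp t = Real.exp (t / 2) * Real.exp (t / 2) := by rw [← Real.exp_add]; ring_nf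
  rw [e, ← mul_assoc]
  exact mul_le_mul_of_nonneg_right h2 (Real.exp_pos _).le

theorem pow_four_le_exp {t : ℝ} (ht : 0 ≤ t) : t ^ 4 ≤ 24 * Real.exp t := by
  have h := Real.pow_div_factorial_le_exp t ht 4
  have : ((4 : ℕ).factorial : ℝ) = 24 := by norm_num [Nat.factorial]
  rw [this, div_le_iff₀ (by norm_num)] at h
  linarith

theorem add_pow_four_le (a b : ℝ) : (a + b) ^ 4 ≤ 8 * (a ^ 4 + b ^ 4) := by
  nlinarith [sq_nonneg (a - b), sq_nonneg (a ^ 2 - b ^ 2), sq_nonneg (a + b),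
    mul_nonneg (sq_nonneg (a - b)) (sq_nonneg (a + b)), sq_nonneg ((a - b) ^ 2),
    mul_nonneg (sq_nonneg (a - b)) (add_nonneg (sq_nonneg a) (sq_nonneg b))]

/-- The fourth power of the logarithm exceeds its value at `A` at most linearly; integrated over
`y`, this bounds the fourth moment of a logarithm by that of the logarithm of the mean. -/
theorem log_pow_four_le {y A : ℝ} (hy : 1 ≤ y) (hA : 1 ≤ A) :
    Real.log y ^ 4 ≤ 8 * Real.log A ^ 4 + 192 * (y / A) := by
  have hy0 : 0 < y := by linarith
  have hA0 : 0 < A := by linarith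
  have hly := Real.log_nonneg hy
  have hlA := Real.log_nonneg hA
  rcases le_or_gt (Real.log y) (Real.log A) with h | h
  · have h1 : Real.log y ^ 4 ≤ Real.log A ^ 4 := pow_le_pow_left₀ hly h 4
    have h2 : 0 ≤ Real.log A ^ 4 := by positivity
    have h3 : 0 ≤ y / A := by positivity
    linarith
  · have h1 := pow_four_le_exp (sub_nonneg.2 h.le)
    rw [← Real.log_div hy0.ne' hA0.ne', Real.exp_log (by positivity)] at h1
    rw [Real.log_div hy0.ne' hA0.ne'] at h1
    have h2 := add_pow_four_le (Real.log A) (Real.log y - Real.log A)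
    rw [add_sub_cancel] at h2
    linarith

end Elementary

/-! ### A single observation -/

section Observation

variable {d : ℕ} {Θ : Set (E d)} {K : E d → ℝ} {Kmax LK : ℝ}
  {Ω : Type*} [MeasurableSpace Ω] {P : Measure Ω}

/-- The law `μ` has a Lebesgue density that lies between `pmin` and `pmax` on `Θ'`. -/
def HasDensityBounds (μ : Measure (E d)) (Θ : Set (E d)) (pmin pmax : ℝ) : Prop :=
  ∃ p : E d → ℝ, Measurable p ∧ (∀ x, 0 ≤ p x) ∧
    μ = volume.withDensity (fun x => ENNReal.ofReal (p x)) ∧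
    ∀ x ∈ enlarge Θ, pmin ≤ p x ∧ p x ≤ pmax

theorem integral_comp_scaled (g : E d → ℝ) (z : E d) {h : ℝ} (hh : 0 < h) :
    ∫ x, g (h⁻¹ • (x - z)) = h ^ d * ∫ u, g u := by
  rw [integral_sub_right_eq_self (fun x => g (h⁻¹ • x)) z, Measure.integral_comp_smul]
  simp [abs_of_pos hh]

/-- The expectation of a function of the scaled design point that lives on the unit ball, compared
with its Lebesgue integral. -/
theorem integral_scaled_bounds {μ : Measure (E d)} {pmin pmax : ℝ}
    (hμ : HasDensityBounds μ Θ pmin pmax) {g : E d → ℝ} (hg0 : ∀ u, 0 ≤ g u)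
    (hg1 : ∀ u, 1 < ‖u‖ → g u = 0) (hgi : Integrable g) {z : E d} (hz : z ∈ Θ) {h : ℝ}
    (hh : 0 < h) (hh1 : h ≤ 1) :
    Integrable (fun x => g (h⁻¹ • (x - z))) μ ∧
    pmin * (h ^ d * ∫ u, g u) ≤ ∫ x, g (h⁻¹ • (x - z)) ∂μ ∧
    ∫ x, g (h⁻¹ • (x - z)) ∂μ ≤ pmax * (h ^ d * ∫ u, g u) := by
  obtain ⟨p, hpm, hp0, rfl, hpb⟩ := hμ
  set G : E d → ℝ := fun x => g (h⁻¹ • (x - z)) with hG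
  have hGi : Integrable G :=
    ((hgi.comp_smul (inv_ne_zero hh.ne')).comp_sub_right z)
  have hbd : ∀ x, pmin * G x ≤ p x * G x ∧ p x * G x ≤ pmax * G x := by
    intro x
    rcases lt_or_ge 1 ‖h⁻¹ • (x - z)‖ with hx | hx
    · simp [hG, hg1 _ hx]
    have hmem : x ∈ enlarge Θ := by
      refine ⟨z, hz, x - z, ?_, by abel⟩
      rw [norm_smul, norm_inv, Real.norm_of_nonneg hh.le, inv_mul_le_iff₀ hh, mul_one] at hx
      exact hx.trans hh1
    obtain ⟨h1, h2⟩ := hpb x hmem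
    exact ⟨mul_le_mul_of_nonneg_right h1 (hg0 _), mul_le_mul_of_nonneg_right h2 (hg0 _)⟩
  have hpi : Integrable fun x => p x * G x := by
    refine (hGi.const_mul pmax).mono' (hpm.aestronglyMeasurable.mul hGi.1)
      (Filter.Eventually.of_forall fun x => ?_)
    rw [Real.norm_of_nonneg (mul_nonneg (hp0 x) (hg0 _))]
    exact (hbd x).2
  have hI : ∫ x, G x ∂(volume.withDensity fun x => ENNReal.ofReal (p x)) = ∫ x, p x * G x := by
    rw [integral_withDensity_eq_integral_toReal_smul hpm.ennreal_ofReal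
      (Filter.Eventually.of_forall fun _ => ENNReal.ofReal_lt_top)]
    simp [ENNReal.toReal_ofReal (hp0 _)]
  refine ⟨?_, ?_, ?_⟩
  · rw [integrable_withDensity_iff_integrable_smul' hpm.ennreal_ofReal
      (Filter.Eventually.of_forall fun _ => ENNReal.ofReal_lt_top)]
    simpa [ENNReal.toReal_ofReal (hp0 _)] using hpi
  · rw [hI, ← integral_comp_scaled g z hh, ← integral_const_mul]
    exact integral_mono (hGi.const_mul _) hpi fun x => (hbd x).1
  · rw [hI, ← integral_comp_scaled g z hh, ← integral_const_mul]
    exact integral_mono hpi (hGi.const_mul _) fun x => (hbd x).2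

variable {pmin pmax σ : ℝ} {X : Ω → E d} {ζ : Ω → ℝ}

theorem abs_le_mul_exp (hσ : 0 < σ) (t : ℝ) : |t| ≤ σ * Real.exp (|t| / σ) := by
  have h := Real.add_one_le_exp (|t| / σ)
  calc |t| = σ * (|t| / σ) := by field_simp
    _ ≤ σ * Real.exp (|t| / σ) := by gcongr; linarith

theorem integrable_of_exp (hσ : 0 < σ) (hζ : Measurable ζ)
    (hexp : Integrable (fun ω => Real.exp (|ζ ω| / σ)) P) : Integrable ζ P :=
  (hexp.const_mul σ).mono' hζ.aestronglyMeasurable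
    (Filter.Eventually.of_forall fun ω => abs_le_mul_exp hσ (ζ ω))

theorem integral_abs_le (hσ : 0 < σ) (hζ : Measurable ζ)
    (hexp : Integrable (fun ω => Real.exp (|ζ ω| / σ)) P)
    (hexp2 : ∫ ω, Real.exp (|ζ ω| / σ) ∂P ≤ 2) : ∫ ω, |ζ ω| ∂P ≤ 2 * σ := by
  calc ∫ ω, |ζ ω| ∂P ≤ ∫ ω, σ * Real.exp (|ζ ω| / σ) ∂P :=
        integral_mono (integrable_of_exp hσ hζ hexp).abs (hexp.const_mul σ)
          fun ω => abs_le_mul_exp hσ (ζ ω)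
    _ ≤ 2 * σ := by rw [integral_const_mul]; nlinarith

theorem abs_pow_four_le_mul_exp (hσ : 0 < σ) (t : ℝ) :
    |t| ^ 4 ≤ 24 * σ ^ 4 * Real.exp (|t| / σ) := by
  have h := pow_four_le_exp (t := |t| / σ) (by positivity)
  rw [div_pow, div_le_iff₀ (by positivity)] at h
  linarith

theorem integrable_abs_pow_four (hσ : 0 < σ) (hζ : Measurable ζ)
    (hexp : Integrable (fun ω => Real.exp (|ζ ω| / σ)) P) :
    Integrable (fun ω => |ζ ω| ^ 4) P :=
  (hexp.const_mul (24 * σ ^ 4)).mono' (by fun_prop) (Filter.Eventually.of_forall fun ω => by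
    rw [Real.norm_of_nonneg (by positivity)]; exact abs_pow_four_le_mul_exp hσ (ζ ω))

theorem integral_abs_pow_four_le (hσ : 0 < σ) (hζ : Measurable ζ)
    (hexp : Integrable (fun ω => Real.exp (|ζ ω| / σ)) P)
    (hexp2 : ∫ ω, Real.exp (|ζ ω| / σ) ∂P ≤ 2) : ∫ ω, |ζ ω| ^ 4 ∂P ≤ 48 * σ ^ 4 := by
  calc ∫ ω, |ζ ω| ^ 4 ∂P ≤ ∫ ω, 24 * σ ^ 4 * Real.exp (|ζ ω| / σ) ∂P :=
        integral_mono (integrable_abs_pow_four hσ hζ hexp) (hexp.const_mul _)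
          fun ω => abs_pow_four_le_mul_exp hσ (ζ ω)
    _ ≤ _ := by
        rw [integral_const_mul]
        have : 0 < σ ^ 4 := by positivity
        nlinarith

/-- A weighted kernel evaluation `ζ φ((X - z) / h)` has a sub-Gaussian moment generating function
near the origin, with a variance proxy of the order `h ^ d` of the chance that `X` is near `z`. -/
theorem exp_moment_le [IsProbabilityMeasure P] (hσ : 0 < σ) (hK : IsKernel K Kmax LK) (hX : Measurable X)
    (hζ : Measurable ζ) (hind : IndepFun ζ X P)
    (hexp : Integrable (fun ω => Real.exp (|ζ ω| / σ)) P)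
    (hexp2 : ∫ ω, Real.exp (|ζ ω| / σ) ∂P ≤ 2)
    (hlaw : HasDensityBounds (P.map X) Θ pmin pmax)
    {φ : E d → ℝ} (hφm : Measurable φ) (hφ : ∀ u, |φ u| ≤ K u) {z : E d} (hz : z ∈ Θ) {h : ℝ}
    (hh : 0 < h) (hh1 : h ≤ 1) {s : ℝ} (hs : |s| * Kmax ≤ 1 / (2 * σ)) :
    Integrable (fun ω => Real.exp (s * (ζ ω * φ (h⁻¹ • (X ω - z))
      - ∫ ω', ζ ω' * φ (h⁻¹ • (X ω' - z)) ∂P))) P ∧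
    ∫ ω, Real.exp (s * (ζ ω * φ (h⁻¹ • (X ω - z))
      - ∫ ω', ζ ω' * φ (h⁻¹ • (X ω' - z)) ∂P)) ∂P
      ≤ Real.exp (s ^ 2 * (16 * σ ^ 2 * Kmax * pmax * h ^ d)) := by
  have hKm := hK.Kmax_pos
  have hKc := hK.continuous
  set u : Ω → E d := fun ω => h⁻¹ • (X ω - z) with hu
  have hum : Measurable u := by fun_prop
  set Z : Ω → ℝ := fun ω => ζ ω * φ (u ω) with hZ
  have hZm : Measurable Z := hζ.mul (hφm.comp hum)
  set W : Ω → ℝ := fun ω => Real.exp (|ζ ω| / σ) with hW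
  obtain ⟨hki, -, hkle⟩ := integral_scaled_bounds hlaw hK.nonneg (fun _ => hK.eq_zero)
    (integrable_kernel hK) hz hh hh1
  have hkm : AEStronglyMeasurable (fun x => K (h⁻¹ • (x - z))) (P.map X) := hki.1
  rw [integral_map hX.aemeasurable hkm, hK.integral_eq_one, mul_one] at hkle
  have hKi : Integrable (fun ω => K (u ω)) P := hki.comp_measurable hX
  have hWK : IndepFun W (fun ω => K (u ω)) P :=
    hind.comp (φ := fun t => Real.exp (|t| / σ)) (ψ := fun x => K (h⁻¹ • (x - z)))
      (by fun_prop) (by fun_prop)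
  have hWKi : Integrable (fun ω => W ω * K (u ω)) P := hWK.integrable_mul hexp hKi
  have hWKle : ∫ ω, W ω * K (u ω) ∂P ≤ 2 * (pmax * h ^ d) := by
    rw [hWK.integral_fun_mul_eq_mul_integral hexp.1 hKi.1]
    have h0 : 0 ≤ ∫ ω, K (u ω) ∂P := integral_nonneg fun ω => hK.nonneg _
    calc _ ≤ 2 * ∫ ω, K (u ω) ∂P := mul_le_mul_of_nonneg_right hexp2 h0
      _ ≤ _ := by gcongr
  have hφmax : ∀ ω, |φ (u ω)| ≤ Kmax := fun ω => (hφ _).trans (hK.le_max _)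
  have hsZ : ∀ ω, |s * Z ω| ≤ (|ζ ω| / σ) / 2 := by
    intro ω
    rw [hZ, abs_mul, abs_mul]
    calc |s| * (|ζ ω| * |φ (u ω)|) ≤ |s| * (|ζ ω| * Kmax) := by gcongr; exact hφmax ω
      _ = |ζ ω| * (|s| * Kmax) := by ring
      _ ≤ |ζ ω| * (1 / (2 * σ)) := by gcongr
      _ = _ := by field_simp
  have hZi : Integrable Z P := by
    refine ((integrable_of_exp hσ hζ hexp).abs.mul_const Kmax).mono' hZm.aestronglyMeasurable
      (Filter.Eventually.of_forall fun ω => ?_)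
    rw [Real.norm_eq_abs, hZ, abs_mul]
    exact mul_le_mul_of_nonneg_left (hφmax ω) (abs_nonneg _)
  have hei : Integrable (fun ω => Real.exp (s * Z ω)) P := by
    refine hexp.mono' (by fun_prop) (Filter.Eventually.of_forall fun ω => ?_)
    rw [Real.norm_of_nonneg (Real.exp_pos _).le, Real.exp_le_exp]
    have h1 := hsZ ω
    have h2 : 0 ≤ |ζ ω| / σ := by positivity
    linarith [le_abs_self (s * Z ω)]
  -- the second-order term keeps one factor `K`, whose mean is of order `h ^ d`
  have hpt : ∀ ω, Real.exp (s * Z ω)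
      ≤ 1 + s * Z ω + s ^ 2 * (8 * σ ^ 2 * Kmax) * (W ω * K (u ω)) := by
    intro ω
    refine (exp_le_one_add_add_sq_mul (s * Z ω)).trans ?_
    have h2 : 0 ≤ |ζ ω| / σ := by positivity
    have h3 := sq_mul_exp_half_le h2
    have h4 : φ (u ω) ^ 2 ≤ Kmax * K (u ω) := by
      rw [← sq_abs, sq]
      exact mul_le_mul (hφmax ω) (hφ _) (abs_nonneg _) hKm.le
    have h5 : Real.exp |s * Z ω| ≤ Real.exp ((|ζ ω| / σ) / 2) := Real.exp_le_exp.2 (hsZ ω)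
    have h6 : (s * Z ω) ^ 2 * Real.exp |s * Z ω|
        ≤ s ^ 2 * (8 * σ ^ 2 * Kmax) * (W ω * K (u ω)) := by
      calc (s * Z ω) ^ 2 * Real.exp |s * Z ω|
          ≤ (s * Z ω) ^ 2 * Real.exp ((|ζ ω| / σ) / 2) := by gcongr
        _ = s ^ 2 * φ (u ω) ^ 2 * (σ ^ 2 * ((|ζ ω| / σ) ^ 2 * Real.exp ((|ζ ω| / σ) / 2))) := by
            rw [div_pow, sq_abs, hZ]; field_simp
        _ ≤ s ^ 2 * (Kmax * K (u ω)) * (σ ^ 2 * (8 * Real.exp (|ζ ω| / σ))) := by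
            have := hK.nonneg (u ω)
            gcongr
        _ = _ := by rw [hW]; ring
    linarith
  have hmain : ∫ ω, Real.exp (s * Z ω) ∂P
      ≤ Real.exp (s * ∫ ω, Z ω ∂P) * Real.exp (s ^ 2 * (16 * σ ^ 2 * Kmax * pmax * h ^ d)) := by
    rw [← Real.exp_add]
    refine le_trans ?_ (Real.add_one_le_exp _)
    have hi1 : Integrable (fun ω => 1 + s * Z ω) P :=
      (integrable_const 1).add (hZi.const_mul s)
    have hi2 : Integrable (fun ω => s ^ 2 * (8 * σ ^ 2 * Kmax) * (W ω * K (u ω))) P :=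
      hWKi.const_mul _
    calc ∫ ω, Real.exp (s * Z ω) ∂P
        ≤ ∫ ω, (1 + s * Z ω + s ^ 2 * (8 * σ ^ 2 * Kmax) * (W ω * K (u ω))) ∂P :=
          integral_mono hei (hi1.add hi2) hpt
      _ = 1 + s * ∫ ω, Z ω ∂P + s ^ 2 * (8 * σ ^ 2 * Kmax) * ∫ ω, W ω * K (u ω) ∂P := by
          rw [integral_add hi1 hi2, integral_add (integrable_const 1) (hZi.const_mul s),
            integral_const_mul, integral_const_mul]
          simp
      _ ≤ 1 + s * ∫ ω, Z ω ∂P + s ^ 2 * (8 * σ ^ 2 * Kmax) * (2 * (pmax * h ^ d)) := by gcongr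
      _ = _ := by ring
  have e : ∀ ω, Real.exp (s * (Z ω - ∫ ω', Z ω' ∂P))
      = Real.exp (s * Z ω) * Real.exp (-(s * ∫ ω', Z ω' ∂P)) := fun ω => by
    rw [← Real.exp_add]; ring_nf
  change Integrable (fun ω => Real.exp (s * (Z ω - ∫ ω', Z ω' ∂P))) P ∧
    ∫ ω, Real.exp (s * (Z ω - ∫ ω', Z ω' ∂P)) ∂P ≤ _
  constructor
  · simp only [e]; exact hei.mul_const _
  · simp only [e]
    rw [integral_mul_const, Real.exp_neg, mul_inv_le_iff₀ (Real.exp_pos _), mul_comm]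
    exact hmain

end Observation

/-! ### Exponential moments of centred sums -/

section Sum

variable {d : ℕ} {Θ : Set (E d)} {K : E d → ℝ} {Kmax LK : ℝ}
  {Ω : Type*} [MeasurableSpace Ω] {P : Measure Ω} {pmin pmax σ : ℝ}
  {ι : Type*} {X : ι → Ω → E d} {ζ : ι → Ω → ℝ}

/-- Design points `X i` with sub-exponential weights `ζ i`; the weights are the noise variables,
or constantly one. -/
structure IsWeightedDesign (P : Measure Ω) (Θ : Set (E d)) (pmin pmax σ : ℝ) (X : ι → Ω → E d)
    (ζ : ι → Ω → ℝ) : Prop where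
  measurable_design : ∀ i, Measurable (X i)
  measurable_weight : ∀ i, Measurable (ζ i)
  indep_pairs : iIndepFun (fun i ω => (X i ω, ζ i ω)) P
  indep : ∀ i, IndepFun (ζ i) (X i) P
  exp_integrable : ∀ i, Integrable (fun ω => Real.exp (|ζ i ω| / σ)) P
  exp_le : ∀ i, ∫ ω, Real.exp (|ζ i ω| / σ) ∂P ≤ 2
  law : ∀ i, HasDensityBounds (P.map (X i)) Θ pmin pmax

/-- The centred sum `∑ i, (ζ_i φ((X_i - z) / h) - E[ζ_i φ((X_i - z) / h)])`. -/
noncomputable def centredSum (P : Measure Ω) (X : ι → Ω → E d) (ζ : ι → Ω → ℝ) (s : Finset ι)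
    (φ : E d → ℝ) (h : ℝ) (z : E d) (ω : Ω) : ℝ :=
  ∑ i ∈ s, (ζ i ω * φ (h⁻¹ • (X i ω - z)) - ∫ ω', ζ i ω' * φ (h⁻¹ • (X i ω' - z)) ∂P)

theorem measurable_centredSum (hD : IsWeightedDesign P Θ pmin pmax σ X ζ) (s : Finset ι)
    {φ : E d → ℝ} (hφm : Measurable φ) (h : ℝ) (z : E d) :
    Measurable (centredSum P X ζ s φ h z) := by
  unfold centredSum
  have hX := hD.measurable_design
  have hζ := hD.measurable_weight
  fun_prop

theorem exp_moment_centredSum_le [IsProbabilityMeasure P] (hσ : 0 < σ) (hK : IsKernel K Kmax LK)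
    (hD : IsWeightedDesign P Θ pmin pmax σ X ζ) (s : Finset ι)
    {φ : E d → ℝ} (hφm : Measurable φ) (hφ : ∀ u, |φ u| ≤ K u) {z : E d} (hz : z ∈ Θ) {h : ℝ}
    (hh : 0 < h) (hh1 : h ≤ 1) {t : ℝ} (ht : |t| * Kmax ≤ 1 / (2 * σ)) :
    Integrable (fun ω => Real.exp (t * centredSum P X ζ s φ h z ω)) P ∧
    ∫ ω, Real.exp (t * centredSum P X ζ s φ h z ω) ∂P
      ≤ Real.exp (s.card * (t ^ 2 * (16 * σ ^ 2 * Kmax * pmax * h ^ d))) := by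
  set Z : ι → Ω → ℝ := fun i ω => ζ i ω * φ (h⁻¹ • (X i ω - z))
    - ∫ ω', ζ i ω' * φ (h⁻¹ • (X i ω' - z)) ∂P with hZ
  have hX := hD.measurable_design
  have hζ := hD.measurable_weight
  have hZm : ∀ i, Measurable (Z i) := by fun_prop
  have hind : iIndepFun Z P := by
    refine hD.indep_pairs.comp (fun i q => q.2 * φ (h⁻¹ • (q.1 - z))
      - ∫ ω', ζ i ω' * φ (h⁻¹ • (X i ω' - z)) ∂P) fun i => ?_
    fun_prop
  have hone := fun i => exp_moment_le hσ hK (hD.measurable_design i) (hD.measurable_weight i)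
    (hD.indep i) (hD.exp_integrable i) (hD.exp_le i) (hD.law i) hφm hφ hz hh hh1 ht
  have e : centredSum P X ζ s φ h z = ∑ i ∈ s, Z i := by
    funext ω; simp [centredSum, hZ]
  rw [e]
  refine ⟨hind.integrable_exp_mul_sum hZm fun i _ => (hone i).1, ?_⟩
  have := hind.mgf_sum hZm s (t := t)
  rw [mgf] at this
  rw [this, Real.exp_nat_mul, ← Finset.prod_const]
  refine Finset.prod_le_prod (fun i _ => mgf_nonneg) fun i _ => (hone i).2

theorem exp_moment_abs_centredSum_le [IsProbabilityMeasure P] (hσ : 0 < σ) (hK : IsKernel K Kmax LK)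
    (hD : IsWeightedDesign P Θ pmin pmax σ X ζ) (s : Finset ι)
    {φ : E d → ℝ} (hφm : Measurable φ) (hφ : ∀ u, |φ u| ≤ K u) {z : E d} (hz : z ∈ Θ) {h : ℝ}
    (hh : 0 < h) (hh1 : h ≤ 1) {t : ℝ} (ht0 : 0 ≤ t) (ht : t * Kmax ≤ 1 / (2 * σ)) :
    Integrable (fun ω => Real.exp (t * |centredSum P X ζ s φ h z ω|)) P ∧
    ∫ ω, Real.exp (t * |centredSum P X ζ s φ h z ω|) ∂P
      ≤ 2 * Real.exp (s.card * (t ^ 2 * (16 * σ ^ 2 * Kmax * pmax * h ^ d))) := by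
  obtain ⟨i1, b1⟩ := exp_moment_centredSum_le hσ hK hD s hφm hφ hz hh hh1 (t := t)
    (by rwa [abs_of_nonneg ht0])
  obtain ⟨i2, b2⟩ := exp_moment_centredSum_le hσ hK hD s hφm hφ hz hh hh1 (t := -t)
    (by rwa [abs_neg, abs_of_nonneg ht0])
  have hm := measurable_centredSum hD s hφm h z
  have hpt : ∀ ω, Real.exp (t * |centredSum P X ζ s φ h z ω|)
      ≤ Real.exp (t * centredSum P X ζ s φ h z ω)
        + Real.exp (-t * centredSum P X ζ s φ h z ω) := by
    intro ω
    rcases abs_cases (centredSum P X ζ s φ h z ω) with ⟨h1, -⟩ | ⟨h1, -⟩ <;> rw [h1]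
    · linarith [Real.exp_pos (-t * centredSum P X ζ s φ h z ω)]
    · rw [mul_neg, neg_mul]; linarith [Real.exp_pos (t * centredSum P X ζ s φ h z ω)]
  have hint : Integrable (fun ω => Real.exp (t * |centredSum P X ζ s φ h z ω|)) P :=
    (i1.add i2).mono' (by fun_prop) (Filter.Eventually.of_forall fun ω => by
      rw [Real.norm_of_nonneg (Real.exp_pos _).le]; exact hpt ω)
  refine ⟨hint, (integral_mono hint (i1.add i2) hpt).trans ?_⟩
  simp only [Pi.add_apply]
  rw [integral_add i1 i2]
  rw [neg_sq] at b2
  linarith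

end Sum

/-! ### Finite nets -/

section Net

variable {d : ℕ} {Θ : Set (E d)}

theorem exists_finset_representatives {α T : Type*} [Fintype T] (c : α → T) {S : Set α}
    (hS : S.Nonempty) : ∃ N : Finset α, N.Nonempty ∧ ↑N ⊆ S ∧ N.card ≤ Fintype.card T ∧
      ∀ z ∈ S, ∃ z' ∈ N, c z = c z' := by
  classical
  obtain ⟨z₀, hz₀⟩ := hS
  have hg : ∀ t : T, ∃ z ∈ S, t ∈ c '' S → c z = t := by
    intro t
    by_cases h : t ∈ c '' S
    · obtain ⟨z, hz, hzt⟩ := h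
      exact ⟨z, hz, fun _ => hzt⟩
    · exact ⟨z₀, hz₀, fun h' => absurd h' h⟩
  choose g hgS hgc using hg
  refine ⟨Finset.univ.image g, ⟨g (c z₀), by simp⟩, ?_, Finset.card_image_le, fun z hz => ?_⟩
  · intro z hz
    obtain ⟨t, -, rfl⟩ := Finset.mem_image.1 hz
    exact hgS t
  · exact ⟨g (c z), by simp, (hgc (c z) ⟨z, hz, rfl⟩).symm⟩

theorem abs_sub_lt_one_of_natFloor_eq {a b : ℝ} (ha : 0 ≤ a) (hb : 0 ≤ b)
    (h : ⌊a⌋₊ = ⌊b⌋₊) : |a - b| < 1 := by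
  have h1 := Nat.floor_le ha
  have h2 := Nat.floor_le hb
  have h3 := Nat.lt_floor_add_one a
  have h4 := Nat.lt_floor_add_one b
  rw [h] at h1 h3
  rw [abs_lt]; constructor <;> linarith

/-- A finite net of `Θ` at scale `1 / k`, with one point in every occupied cell of a cubic grid. -/
theorem exists_net (hd : 1 ≤ d) (hb : Bornology.IsBounded Θ) (hne : Θ.Nonempty) {k : ℕ}
    (hk : 1 ≤ k) : ∃ N : Finset (E d), N.Nonempty ∧ ↑N ⊆ Θ ∧
      (N.card : ℝ) ≤ ((2 * Metric.diam Θ + 1) * d * k) ^ d ∧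
      ∀ z ∈ Θ, ∃ z' ∈ N, ‖z - z'‖ ≤ 1 / k := by
  obtain ⟨z₀, hz₀⟩ := hne
  set D := Metric.diam Θ with hD
  have hD0 : 0 ≤ D := Metric.diam_nonneg
  have hd' : (1 : ℝ) ≤ d := by exact_mod_cast hd
  have hk' : (1 : ℝ) ≤ k := by exact_mod_cast hk
  have hdk : (1 : ℝ) ≤ d * k := one_le_mul_of_one_le_of_one_le hd' hk'
  set a : E d → Fin d → ℝ := fun z i => (z i - z₀ i + D) * (d * k) with ha
  have hcoord : ∀ z ∈ Θ, ∀ i, |z i - z₀ i| ≤ D := by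
    intro z hz i
    have h1 := PiLp.norm_apply_le (z - z₀) i
    rw [← dist_eq_norm] at h1
    exact h1.trans (Metric.dist_le_diam_of_mem hb hz hz₀)
  have ha0 : ∀ z ∈ Θ, ∀ i, 0 ≤ a z i := fun z hz i =>
    mul_nonneg (by linarith [(abs_le.1 (hcoord z hz i)).1]) (by linarith)
  set m := ⌊2 * D * (d * k)⌋₊ with hm
  have hafl : ∀ z ∈ Θ, ∀ i, ⌊a z i⌋₊ ≤ m := by
    intro z hz i
    refine Nat.floor_le_floor ?_
    have := (abs_le.1 (hcoord z hz i)).2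
    simp only [ha]
    gcongr
    linarith
  obtain ⟨N, hN1, hN2, hN3, hN4⟩ := exists_finset_representatives
    (fun z (i : Fin d) => (Fin.ofNat (m + 1) ⌊a z i⌋₊)) ⟨z₀, hz₀⟩
  refine ⟨N, hN1, hN2, ?_, fun z hz => ?_⟩
  · have h1 : (N.card : ℝ) ≤ ((m : ℝ) + 1) ^ d := by
      refine (Nat.cast_le.2 hN3).trans (le_of_eq ?_)
      simp
    refine h1.trans (pow_le_pow_left₀ (by positivity) ?_ d)
    have h2 : (m : ℝ) ≤ 2 * D * (d * k) := Nat.floor_le (by positivity)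
    nlinarith
  · obtain ⟨z', hz', hc⟩ := hN4 z hz
    refine ⟨z', hz', ?_⟩
    have hz'Θ := hN2 hz'
    have hi : ∀ i, |(z - z') i| ≤ 1 / (d * k) := by
      intro i
      have h1 := congrArg Fin.val (congrFun hc i)
      simp only [Fin.ofNat, Nat.mod_eq_of_lt (Nat.lt_succ_of_le (hafl z hz i)),
        Nat.mod_eq_of_lt (Nat.lt_succ_of_le (hafl z' hz'Θ i))] at h1
      have h2 := abs_sub_lt_one_of_natFloor_eq (ha0 z hz i) (ha0 z' hz'Θ i) h1
      have e : a z i - a z' i = (z - z') i * (d * k) := by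
        simp only [ha, PiLp.sub_apply]; ring
      rw [e, abs_mul, abs_of_pos (by linarith : (0 : ℝ) < d * k)] at h2
      rw [le_div_iff₀ (by linarith)]
      exact h2.le
    have h3 := norm_toLp_le_card_mul hi
    calc ‖z - z'‖ ≤ Fintype.card (Fin d) * (1 / (d * k)) := h3
      _ = 1 / k := by rw [Fintype.card_fin]; field_simp

end Net

/-! ### Uniform deviations -/

section Uniform

variable {d : ℕ} {Θ : Set (E d)} {K : E d → ℝ} {Kmax LK β : ℝ}
  {Ω : Type*} [MeasurableSpace Ω] {P : Measure Ω} {pmin pmax σ : ℝ}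
  {ι : Type*} {X : ι → Ω → E d} {ζ : ι → Ω → ℝ}

theorem integrable_weighted (hσ : 0 < σ) (hK : IsKernel K Kmax LK)
    (hD : IsWeightedDesign P Θ pmin pmax σ X ζ) {φ : E d → ℝ} (hφm : Measurable φ)
    (hφ : ∀ u, |φ u| ≤ K u) (i : ι) (h : ℝ) (z : E d) :
    Integrable (fun ω => ζ i ω * φ (h⁻¹ • (X i ω - z))) P := by
  have hX := hD.measurable_design
  have hζ := hD.measurable_weight
  refine ((integrable_of_exp hσ (hζ i) (hD.exp_integrable i)).abs.mul_const Kmax).mono'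
    (by fun_prop) (Filter.Eventually.of_forall fun ω => ?_)
  rw [Real.norm_eq_abs, abs_mul]
  exact mul_le_mul_of_nonneg_left ((hφ _).trans (hK.le_max _)) (abs_nonneg _)

theorem abs_centredSum_sub_le (hσ : 0 < σ) (hK : IsKernel K Kmax LK)
    (hD : IsWeightedDesign P Θ pmin pmax σ X ζ) (s : Finset ι) {φ : E d → ℝ}
    (hφm : Measurable φ) (hφ : ∀ u, |φ u| ≤ K u) {Lφ : ℝ} (hL0 : 0 ≤ Lφ)
    (hL : ∀ u v, |φ u - φ v| ≤ Lφ * ‖u - v‖) {h : ℝ} (hh : 0 < h) (z z' : E d) (ω : Ω) :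
    |centredSum P X ζ s φ h z ω - centredSum P X ζ s φ h z' ω|
      ≤ ∑ i ∈ s, (|ζ i ω| + 2 * σ) * (Lφ * (h⁻¹ * ‖z - z'‖)) := by
  have hLz : ∀ x : E d, |φ (h⁻¹ • (x - z)) - φ (h⁻¹ • (x - z'))| ≤ Lφ * (h⁻¹ * ‖z - z'‖) := by
    intro x
    refine (hL _ _).trans (le_of_eq ?_)
    rw [← smul_sub, norm_smul, norm_inv, Real.norm_of_nonneg hh.le, sub_sub_sub_cancel_left,
      norm_sub_rev]
  rw [centredSum, centredSum, ← Finset.sum_sub_distrib]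
  refine (Finset.abs_sum_le_sum_abs _ _).trans (Finset.sum_le_sum fun i _ => ?_)
  have i1 := integrable_weighted hσ hK hD hφm hφ i h z
  have i2 := integrable_weighted hσ hK hD hφm hφ i h z'
  have hζi := integrable_of_exp hσ (hD.measurable_weight i) (hD.exp_integrable i)
  have hpt : ∀ ω, |ζ i ω * φ (h⁻¹ • (X i ω - z)) - ζ i ω * φ (h⁻¹ • (X i ω - z'))|
      ≤ |ζ i ω| * (Lφ * (h⁻¹ * ‖z - z'‖)) := by
    intro ω
    rw [← mul_sub, abs_mul]
    exact mul_le_mul_of_nonneg_left (hLz _) (abs_nonneg _)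
  have hE : |∫ ω, ζ i ω * φ (h⁻¹ • (X i ω - z)) ∂P - ∫ ω, ζ i ω * φ (h⁻¹ • (X i ω - z')) ∂P|
      ≤ 2 * σ * (Lφ * (h⁻¹ * ‖z - z'‖)) := by
    rw [← integral_sub i1 i2]
    calc _ ≤ ∫ ω, |ζ i ω * φ (h⁻¹ • (X i ω - z)) - ζ i ω * φ (h⁻¹ • (X i ω - z'))| ∂P :=
          abs_integral_le_integral_abs
      _ ≤ ∫ ω, |ζ i ω| * (Lφ * (h⁻¹ * ‖z - z'‖)) ∂P :=
          integral_mono (i1.sub i2).abs (hζi.abs.mul_const _) hpt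
      _ ≤ _ := by
          rw [integral_mul_const]
          exact mul_le_mul_of_nonneg_right
            (integral_abs_le hσ (hD.measurable_weight i) (hD.exp_integrable i) (hD.exp_le i))
            (by positivity)
  rw [sub_sub_sub_comm, add_mul]
  exact (abs_sub _ _).trans (add_le_add (hpt ω) hE)

/-- The factor in the bound on the fourth moment of the uniform deviation; it does not depend on
the dimension. -/
noncomputable def deviationConst (σ Kmax pmax Lφ D : ℝ) : ℝ :=
  8 * ((2 * σ * Kmax) ^ 4 * (8 * (2 * Real.log (2 * D + 1) + 4 + 4 * pmax / Kmax) ^ 4 + 3072)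
    + (2 * Lφ) ^ 4 * (512 * σ ^ 4))

theorem log_card_net_le (hd : 1 ≤ d) {k : ℕ} (hk : 1 ≤ k) {D c a : ℝ} (hD : 0 ≤ D) (ha : 0 ≤ a)
    (hc1 : 1 ≤ c) (hc : c ≤ ((2 * D + 1) * d * k) ^ d) :
    Real.log (c * (2 * Real.exp (Real.log (k + 1) * a))) / Real.log (k + 1)
      ≤ (2 * Real.log (2 * D + 1) + 4 + a) * d ^ 2 := by
  have hd' : (1 : ℝ) ≤ d := by exact_mod_cast hd
  have hk' : (1 : ℝ) ≤ k := by exact_mod_cast hk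
  have hl := half_le_log hk
  set l := Real.log ((k : ℝ) + 1) with hl'
  have hl0 : 0 < l := by linarith
  have h1 : Real.log c ≤ d * (Real.log (2 * D + 1) + d + l) := by
    calc Real.log c ≤ Real.log (((2 * D + 1) * d * k) ^ d) := Real.log_le_log (by linarith) hc
      _ = d * (Real.log (2 * D + 1) + Real.log d + Real.log k) := by
          rw [Real.log_pow, Real.log_mul (by positivity) (by positivity),
            Real.log_mul (by positivity) (by positivity)]
      _ ≤ _ := by
          have e1 : Real.log d ≤ d := (Real.log_le_sub_one_of_pos (by linarith)).trans (by linarith)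
          have e2 : Real.log k ≤ l := Real.log_le_log (by linarith) (by linarith)
          gcongr
  have h2 : Real.log 2 ≤ l := Real.log_le_log (by norm_num) (by linarith)
  have hlD : 0 ≤ Real.log (2 * D + 1) := Real.log_nonneg (by linarith)
  rw [Real.log_mul (by positivity) (by positivity), Real.log_mul (by norm_num) (by positivity),
    Real.log_exp, div_le_iff₀ hl0]
  have hdd : (d : ℝ) ≤ d ^ 2 := by nlinarith
  have hd1 : (1 : ℝ) ≤ d ^ 2 := by nlinarith
  have f1 : d * Real.log (2 * D + 1) ≤ 2 * Real.log (2 * D + 1) * d ^ 2 * l := by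
    have : d * Real.log (2 * D + 1) ≤ d ^ 2 * Real.log (2 * D + 1) := by gcongr
    nlinarith [mul_nonneg (sq_nonneg (d : ℝ)) hlD]
  have f2 : (d : ℝ) * d ≤ 2 * d ^ 2 * l := by nlinarith
  have f3 : (d : ℝ) * l ≤ d ^ 2 * l := by gcongr
  have f4 : l ≤ d ^ 2 * l := by nlinarith
  have f5 : l * a ≤ d ^ 2 * (l * a) := le_mul_of_one_le_left (by positivity) hd1
  nlinarith

/-- Uniform deviation bound: the normalized centred sums are of the order `λ_k` uniformly over
`Θ`, up to a factor `Q` whose fourth moment is bounded. The exponential moment at the scale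
`λ_k / (2 σ Kmax)` is of the order of a power of `k`, as is the number of points of a net of `Θ`,
and by the choice of the bandwidth both only contribute logarithms that the normalization
absorbs. -/
theorem exists_uniform_deviation [IsProbabilityMeasure P] (hβ : 2 ≤ β) (hd : 1 ≤ d) (hσ : 0 < σ)
    (hpmax : 0 ≤ pmax) (hb : Bornology.IsBounded Θ) (hne : Θ.Nonempty) (hK : IsKernel K Kmax LK)
    (hD : IsWeightedDesign P Θ pmin pmax σ X ζ) {s : Finset ι} {k : ℕ} (hk : 1 ≤ k)
    (hs : s.card = k) {φ : E d → ℝ} (hφm : Measurable φ) (hφ : ∀ u, |φ u| ≤ K u) {Lφ : ℝ}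
    (hL0 : 0 ≤ Lφ) (hL : ∀ u v, |φ u - φ v| ≤ Lφ * ‖u - v‖) :
    ∃ Q : Ω → ℝ, Measurable Q ∧ (∀ ω, 0 ≤ Q ω) ∧ Integrable (fun ω => Q ω ^ 4) P ∧
      ∫ ω, Q ω ^ 4 ∂P ≤ deviationConst σ Kmax pmax Lφ (Metric.diam Θ) * (d : ℝ) ^ 8 ∧
      ∀ ω, ∀ z ∈ Θ, |1 / (k * bandwidth d β k ^ d) *
        centredSum P X ζ s φ (bandwidth d β k) z ω| ≤ regParam d β k * Q ω := by
  set h := bandwidth d β k with hh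
  set ρ := regParam d β k with hρ
  have hh0 : 0 < h := bandwidth_pos hk
  have hh1 : h ≤ 1 := bandwidth_le_one hβ hk
  have hρ0 : 0 < ρ := regParam_pos hk
  have hρ1 : ρ ≤ 1 := regParam_le_one hβ hk
  have hρh : ρ ≤ h := regParam_le_bandwidth hβ hk
  have hKm := hK.Kmax_pos
  have hk' : (1 : ℝ) ≤ k := by exact_mod_cast hk
  have hd' : (1 : ℝ) ≤ d := by exact_mod_cast hd
  have hl := half_le_log hk
  set l := Real.log ((k : ℝ) + 1) with hl'
  have hl0 : 0 < l := by linarith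
  have hX := hD.measurable_design
  have hζ := hD.measurable_weight
  obtain ⟨N, hN1, hNΘ, hNcard, hNnet⟩ := exists_net hd hb hne hk
  set S : E d → Ω → ℝ := fun z => centredSum P X ζ s φ h z with hS
  have hSm : ∀ z, Measurable (S z) := fun z => measurable_centredSum hD s hφm h z
  set t := ρ / (2 * σ * Kmax) with ht
  have ht0 : 0 < t := by positivity
  set a := 4 * pmax / Kmax with ha
  have ha0 : 0 ≤ a := by positivity
  -- with this `t` the exponent of the moment bound is a multiple of `log (k + 1)`
  have hexponent : (s.card : ℝ) * (t ^ 2 * (16 * σ ^ 2 * Kmax * pmax * h ^ d)) = l * a := by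
    rw [hl', ← regParam_sq_mul (d := d) hβ hk, hs, ht, ha, ← hh, ← hρ]
    field_simp
    ring
  have hmom : ∀ z ∈ N, Integrable (fun ω => Real.exp (t * |S z ω|)) P ∧
      ∫ ω, Real.exp (t * |S z ω|) ∂P ≤ 2 * Real.exp (l * a) := by
    intro z hz
    have := exp_moment_abs_centredSum_le hσ hK hD s hφm hφ (hNΘ hz) hh0 hh1 ht0.le (by
      rw [ht, div_mul_eq_mul_div, mul_div_mul_right _ _ hKm.ne']
      exact div_le_div_of_nonneg_right hρ1 (by positivity))
    rwa [hexponent] at this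
  -- `log Y / t` dominates the maximum over the net
  set Y : Ω → ℝ := fun ω => ∑ z ∈ N, Real.exp (t * |S z ω|) with hY
  have hYm : Measurable Y := by fun_prop
  have hYi : Integrable Y P := integrable_finsetSum _ fun z hz => (hmom z hz).1
  have hSY : ∀ z ∈ N, ∀ ω, Real.exp (t * |S z ω|) ≤ Y ω := fun z hz ω =>
    Finset.single_le_sum (f := fun z => Real.exp (t * |S z ω|))
      (fun _ _ => (Real.exp_pos _).le) hz
  have hY1 : ∀ ω, 1 ≤ Y ω := by
    intro ω
    obtain ⟨z, hz⟩ := hN1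
    exact (Real.one_le_exp (by positivity)).trans (hSY z hz ω)
  set A := (N.card : ℝ) * (2 * Real.exp (l * a)) with hA
  have hN1' : (1 : ℝ) ≤ N.card := by exact_mod_cast hN1.card_pos
  have hA1 : 1 ≤ A := by
    have : 1 ≤ Real.exp (l * a) := Real.one_le_exp (by positivity)
    exact one_le_mul_of_one_le_of_one_le hN1' (by linarith)
  have hYA : ∫ ω, Y ω ∂P ≤ A := by
    rw [integral_finsetSum _ fun z hz => (hmom z hz).1]
    refine (Finset.sum_le_sum fun z hz => (hmom z hz).2).trans (le_of_eq ?_)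
    rw [Finset.sum_const, nsmul_eq_mul]
  have hlogpt : ∀ ω, Real.log (Y ω) ^ 4 ≤ 8 * Real.log A ^ 4 + 192 * (Y ω / A) := fun ω =>
    log_pow_four_le (hY1 ω) hA1
  have hrhs : Integrable (fun ω => 8 * Real.log A ^ 4 + 192 * (Y ω / A)) P :=
    (integrable_const _).add ((hYi.div_const A).const_mul 192)
  have hlogi : Integrable (fun ω => Real.log (Y ω) ^ 4) P :=
    hrhs.mono' (hYm.log.pow_const 4).aestronglyMeasurable (Filter.Eventually.of_forall fun ω => by
      rw [Real.norm_of_nonneg (by positivity)]; exact hlogpt ω)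
  have hlogint : ∫ ω, Real.log (Y ω) ^ 4 ∂P ≤ 8 * Real.log A ^ 4 + 192 := by
    refine (integral_mono hlogi hrhs hlogpt).trans ?_
    rw [integral_add (integrable_const _) ((hYi.div_const A).const_mul 192), integral_const_mul 192,
      integral_div]
    have : (∫ ω, Y ω ∂P) / A ≤ 1 := by rw [div_le_one (by linarith)]; exact hYA
    simp
    linarith
  have hlogA : Real.log A / l ≤ (2 * Real.log (2 * Metric.diam Θ + 1) + 4 + a) * d ^ 2 :=
    log_card_net_le hd hk Metric.diam_nonneg ha0 hN1' hNcard
  have hlogA0 : 0 ≤ Real.log A := Real.log_nonneg hA1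
  set Q₁ : Ω → ℝ := fun ω => 2 * σ * Kmax * (Real.log (Y ω) / l) with hQ₁
  set R : Ω → ℝ := fun ω => ∑ i ∈ s, (1 / (k : ℝ)) * |ζ i ω| with hR
  set Q₂ : Ω → ℝ := fun ω => 2 * Lφ * (R ω + 2 * σ) with hQ₂
  have hR0 : ∀ ω, 0 ≤ R ω := fun ω => Finset.sum_nonneg fun i _ => by positivity
  have hQ10 : ∀ ω, 0 ≤ Q₁ ω := fun ω => by
    have := Real.log_nonneg (hY1 ω)
    positivity
  have hQ20 : ∀ ω, 0 ≤ Q₂ ω := fun ω => by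
    have := hR0 ω
    positivity
  have hRm : Measurable R := by fun_prop
  have hQ1m : Measurable Q₁ := (hYm.log.div_const _).const_mul _
  have hQ1i : Integrable (fun ω => Q₁ ω ^ 4) P := by
    simp only [hQ₁, mul_pow, div_pow]
    exact (hlogi.div_const _).const_mul _
  have hQ1int : ∫ ω, Q₁ ω ^ 4 ∂P ≤ (2 * σ * Kmax) ^ 4 *
      (8 * (2 * Real.log (2 * Metric.diam Θ + 1) + 4 + a) ^ 4 + 3072) * (d : ℝ) ^ 8 := by
    have e : ∀ ω, Q₁ ω ^ 4 = (2 * σ * Kmax) ^ 4 * (Real.log (Y ω) ^ 4 / l ^ 4) := fun ω => by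
      simp only [hQ₁, mul_pow, div_pow]
    simp only [e]
    rw [integral_const_mul, integral_div, mul_assoc ((2 * σ * Kmax) ^ 4)]
    refine mul_le_mul_of_nonneg_left ?_ (by positivity)
    have h1 : (Real.log A / l) ^ 4
        ≤ ((2 * Real.log (2 * Metric.diam Θ + 1) + 4 + a) * d ^ 2) ^ 4 :=
      pow_le_pow_left₀ (div_nonneg hlogA0 hl0.le) hlogA 4
    have h2 : 192 / l ^ 4 ≤ 3072 := by
      rw [div_le_iff₀ (by positivity)]
      have : (1 / 2 : ℝ) ^ 4 ≤ l ^ 4 := pow_le_pow_left₀ (by norm_num) hl 4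
      norm_num at this
      linarith
    have h3 : (1 : ℝ) ≤ (d : ℝ) ^ 8 := one_le_pow₀ hd'
    calc (∫ ω, Real.log (Y ω) ^ 4 ∂P) / l ^ 4 ≤ (8 * Real.log A ^ 4 + 192) / l ^ 4 := by gcongr
      _ = 8 * (Real.log A / l) ^ 4 + 192 / l ^ 4 := by rw [div_pow]; ring
      _ ≤ 8 * ((2 * Real.log (2 * Metric.diam Θ + 1) + 4 + a) * d ^ 2) ^ 4 + 3072 * (d : ℝ) ^ 8 := by
          linarith
      _ = _ := by ring
  have hRpt : ∀ ω, R ω ^ 4 ≤ ∑ i ∈ s, (1 / (k : ℝ)) * |ζ i ω| ^ 4 := fun ω =>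
    Real.pow_arith_mean_le_arith_mean_pow s (fun _ => 1 / (k : ℝ)) (fun i => |ζ i ω|)
      (fun _ _ => by positivity)
      (by rw [Finset.sum_const, hs, nsmul_eq_mul]; field_simp) (fun _ _ => abs_nonneg _) 4
  have hζ4 : ∀ i, Integrable (fun ω => |ζ i ω| ^ 4) P := fun i =>
    integrable_abs_pow_four hσ (hζ i) (hD.exp_integrable i)
  have hRsi : Integrable (fun ω => ∑ i ∈ s, (1 / (k : ℝ)) * |ζ i ω| ^ 4) P :=
    integrable_finsetSum _ fun i _ => (hζ4 i).const_mul _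
  have hRsint : ∫ ω, ∑ i ∈ s, (1 / (k : ℝ)) * |ζ i ω| ^ 4 ∂P ≤ 48 * σ ^ 4 := by
    rw [integral_finsetSum _ fun i _ => (hζ4 i).const_mul _]
    calc _ ≤ ∑ i ∈ s, (1 / (k : ℝ)) * (48 * σ ^ 4) := by
          refine Finset.sum_le_sum fun i _ => ?_
          rw [integral_const_mul]
          gcongr
          exact integral_abs_pow_four_le hσ (hζ i) (hD.exp_integrable i) (hD.exp_le i)
      _ = _ := by rw [Finset.sum_const, hs, nsmul_eq_mul]; field_simp
  have hQ2pt : ∀ ω, Q₂ ω ^ 4 ≤ (2 * Lφ) ^ 4 *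
      (8 * (∑ i ∈ s, (1 / (k : ℝ)) * |ζ i ω| ^ 4 + (2 * σ) ^ 4)) := by
    intro ω
    simp only [hQ₂, mul_pow _ (R ω + 2 * σ)]
    gcongr
    refine (add_pow_four_le _ _).trans ?_
    linarith [hRpt ω]
  have hQ2rhs : Integrable (fun ω => (2 * Lφ) ^ 4 *
      (8 * (∑ i ∈ s, (1 / (k : ℝ)) * |ζ i ω| ^ 4 + (2 * σ) ^ 4))) P :=
    ((hRsi.add (integrable_const _)).const_mul 8).const_mul _
  have hQ2i : Integrable (fun ω => Q₂ ω ^ 4) P :=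
    hQ2rhs.mono' (by fun_prop) (Filter.Eventually.of_forall fun ω => by
      rw [Real.norm_of_nonneg (by positivity)]; exact hQ2pt ω)
  have hQ2int : ∫ ω, Q₂ ω ^ 4 ∂P ≤ (2 * Lφ) ^ 4 * (512 * σ ^ 4) * (d : ℝ) ^ 8 := by
    have h3 : (1 : ℝ) ≤ (d : ℝ) ^ 8 := one_le_pow₀ hd'
    refine le_trans ?_ (le_mul_of_one_le_right (by positivity) h3)
    refine (integral_mono hQ2i hQ2rhs hQ2pt).trans ?_
    rw [integral_const_mul, integral_const_mul, integral_add hRsi (integrable_const _)]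
    refine mul_le_mul_of_nonneg_left ?_ (by positivity)
    rw [integral_const, probReal_univ, one_smul]
    linarith
  refine ⟨fun ω => Q₁ ω + Q₂ ω, by fun_prop, fun ω => add_nonneg (hQ10 ω) (hQ20 ω), ?_, ?_,
    fun ω z hz => ?_⟩
  · refine ((hQ1i.add hQ2i).const_mul 8).mono' (by fun_prop)
      (Filter.Eventually.of_forall fun ω => ?_)
    rw [Real.norm_of_nonneg (by positivity)]
    exact add_pow_four_le _ _
  · have hsum : Integrable (fun ω => 8 * (Q₁ ω ^ 4 + Q₂ ω ^ 4)) P := (hQ1i.add hQ2i).const_mul 8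
    have hlhs : Integrable (fun ω => (Q₁ ω + Q₂ ω) ^ 4) P :=
      hsum.mono' (by fun_prop) (Filter.Eventually.of_forall fun ω => by
        rw [Real.norm_of_nonneg (by positivity)]
        exact add_pow_four_le _ _)
    refine (integral_mono hlhs hsum fun ω => add_pow_four_le _ _).trans ?_
    rw [integral_const_mul, integral_add hQ1i hQ2i, deviationConst, mul_assoc 8, add_mul]
    linarith
  · obtain ⟨z', hz', hzz'⟩ := hNnet z hz
    rw [inv_mul_bandwidth_pow hβ hk, ← hρ, ← hl', abs_mul,
      abs_of_pos (by positivity : 0 < ρ ^ 2 / l)]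
    have h1 : |S z ω| ≤ |S z' ω| + |S z ω - S z' ω| := by
      have := abs_add_le (S z' ω) (S z ω - S z' ω)
      rwa [add_sub_cancel] at this
    have h2 : ρ ^ 2 / l * |S z' ω| ≤ ρ * Q₁ ω := by
      have h3 : t * |S z' ω| ≤ Real.log (Y ω) := by
        rw [Real.le_log_iff_exp_le (by linarith [hY1 ω])]
        exact hSY z' hz' ω
      calc ρ ^ 2 / l * |S z' ω| = ρ * (2 * σ * Kmax * ((t * |S z' ω|) / l)) := by
            rw [ht]; field_simp
        _ ≤ ρ * (2 * σ * Kmax * (Real.log (Y ω) / l)) := by gcongr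
    have h4 : ρ ^ 2 / l * |S z ω - S z' ω| ≤ ρ * Q₂ ω := by
      have h5 := abs_centredSum_sub_le hσ hK hD s hφm hφ hL0 hL hh0 z z' ω
      have h6 : ∑ i ∈ s, (|ζ i ω| + 2 * σ) * (Lφ * (h⁻¹ * ‖z - z'‖))
          ≤ Lφ * h⁻¹ * (R ω + 2 * σ) := by
        calc _ ≤ ∑ i ∈ s, (|ζ i ω| + 2 * σ) * (Lφ * (h⁻¹ * (1 / k))) := by gcongr
          _ = Lφ * h⁻¹ * (R ω + s.card * (1 / k) * (2 * σ)) := by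
              simp only [hR]
              rw [← Finset.sum_mul, Finset.sum_add_distrib, Finset.sum_const, nsmul_eq_mul,
                ← Finset.mul_sum]
              ring
          _ = _ := by rw [hs]; field_simp
      have h7 : ρ * h⁻¹ ≤ 1 := by rw [mul_inv_le_iff₀ hh0, one_mul]; exact hρh
      have h8 : 1 / l ≤ 2 := by rw [div_le_iff₀ hl0]; linarith
      have h9 := hR0 ω
      calc ρ ^ 2 / l * |S z ω - S z' ω| ≤ ρ ^ 2 / l * (Lφ * h⁻¹ * (R ω + 2 * σ)) := by
            gcongr; exact h5.trans h6
        _ = ρ * ((ρ * h⁻¹) * (1 / l) * (Lφ * (R ω + 2 * σ))) := by ring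
        _ ≤ ρ * (1 * 2 * (Lφ * (R ω + 2 * σ))) := by gcongr
        _ = _ := by rw [hQ₂]; ring
    calc _ ≤ ρ ^ 2 / l * (|S z' ω| + |S z ω - S z' ω|) := by gcongr
      _ ≤ _ := by rw [mul_add, mul_add]; exact add_le_add h2 h4

end Uniform

/-! ### Mean squared error of the gradient estimator -/

section Sample

variable {d n : ℕ} {Θ : Set (E d)} {K f : E d → ℝ} {Kmax LK β L M : ℝ}
  {Ω : Type*} [MeasurableSpace Ω] {P : Measure Ω} {pmin pmax σ : ℝ}
  {X : Fin n → Ω → E d} {ξ : Fin n → Ω → ℝ}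

theorem IsSample.hasDensityBounds (hS : IsSample P Θ pmin pmax σ X ξ) (i : Fin n) :
    HasDensityBounds (P.map (X i)) Θ pmin pmax := by
  obtain ⟨p, hpm, hp0, hmap, hb⟩ := hS.density
  exact ⟨p, hpm, hp0, hmap i, hb⟩

theorem subset_enlarge (Θ : Set (E d)) : Θ ⊆ enlarge Θ := fun z hz =>
  ⟨z, hz, 0, by simp, by simp⟩

theorem IsSample.pmin_le_pmax (hS : IsSample P Θ pmin pmax σ X ξ) (hne : Θ.Nonempty) :
    pmin ≤ pmax := by
  obtain ⟨p, -, -, -, hb⟩ := hS.density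
  obtain ⟨z, hz⟩ := hne
  obtain ⟨h1, h2⟩ := hb z (subset_enlarge Θ hz)
  exact h1.trans h2

theorem IsSample.noise (hS : IsSample P Θ pmin pmax σ X ξ) :
    IsWeightedDesign P Θ pmin pmax σ X ξ where
  measurable_design := hS.measurable_design
  measurable_weight := hS.measurable_noise
  indep_pairs := hS.indep_pairs
  indep i := hS.indep_noise_design i i
  exp_integrable := hS.exp_integrable
  exp_le := hS.exp_le
  law := hS.hasDensityBounds

/-- The constant weight `1` is sub-exponential at the scale `1 / log 2`. -/
theorem IsSample.one [IsProbabilityMeasure P] (hS : IsSample P Θ pmin pmax σ X ξ) :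
    IsWeightedDesign P Θ pmin pmax (Real.log 2)⁻¹ X (fun _ _ => 1) where
  measurable_design := hS.measurable_design
  measurable_weight _ := measurable_const
  indep_pairs := hS.indep_pairs.comp (fun _ q => (q.1, (1 : ℝ))) fun _ => by fun_prop
  indep _ := indepFun_const_left 1 _
  exp_integrable _ := integrable_const _
  exp_le _ := by simp [Real.exp_log]
  law := hS.hasDensityBounds

theorem card_firstIdx {k : ℕ} (hk : k ≤ n) : (firstIdx n k).card = k := by
  rw [firstIdx, Fin.card_filter_val_lt, min_eq_right hk]

/-- The expectation of the matrix `B_k(z)`. -/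
noncomputable def meanBmat (P : Measure Ω) (β : ℝ) (K : E d → ℝ) (X : Fin n → Ω → E d) (k : ℕ)
    (z : E d) : Matrix (MIdx d (ell β)) (MIdx d (ell β)) ℝ :=
  fun m m' => 1 / (k * bandwidth d β k ^ d) * ∑ i ∈ firstIdx n k,
    ∫ ω, momentKernel K m m' ((bandwidth d β k)⁻¹ • (X i ω - z)) ∂P

theorem integrable_momentKernel_design [IsProbabilityMeasure P]
    (hS : IsSample P Θ pmin pmax σ X ξ) (hK : IsKernel K Kmax LK) {ℓ : ℕ} (m m' : MIdx d ℓ)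
    (i : Fin n) (h : ℝ) (z : E d) :
    Integrable (fun ω => momentKernel K m m' (h⁻¹ • (X i ω - z))) P := by
  have := integrable_weighted (inv_pos.2 (Real.log_pos one_lt_two)) hK hS.one
    (continuous_momentKernel hK m m').measurable (abs_momentKernel_le hK m m') i h z
  simpa using this

theorem meanBmat_quadForm_ge [IsProbabilityMeasure P] (hβ : 2 ≤ β)
    (hS : IsSample P Θ pmin pmax σ X ξ) (hpmin : 0 ≤ pmin) (hK : IsKernel K Kmax LK) {k : ℕ}
    (hk : 1 ≤ k) (hkn : k ≤ n) {z : E d} (hz : z ∈ Θ) (v : MIdx d (ell β) → ℝ) :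
    pmin * minEigenvalue (kernelGram β K) * ∑ m, v m ^ 2
      ≤ ∑ m, ∑ m', v m * meanBmat P β K X k z m m' * v m' := by
  set h := bandwidth d β k with hh
  have hh0 : 0 < h := bandwidth_pos hk
  have hk0 : (0 : ℝ) < k := by exact_mod_cast hk
  have hKc := hK.continuous
  have hone : ∀ i, pmin * (h ^ d * (minEigenvalue (kernelGram β K) * ∑ m, v m ^ 2))
      ≤ ∑ m, ∑ m', v m * (∫ ω, momentKernel K m m' (h⁻¹ • (X i ω - z)) ∂P) * v m' := by
    intro i
    rw [sum_mul_integral_momentKernel fun m m' =>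
      integrable_momentKernel_design hS hK m m' i h z]
    have hb := (integral_scaled_bounds (hS.hasDensityBounds i)
      (g := fun u => (∑ m, v m * monoVec d (ell β) u m) ^ 2 * K u)
      (fun u => mul_nonneg (sq_nonneg _) (hK.nonneg u))
      (fun u hu => by simp [hK.eq_zero hu]) (integrable_sq_mul_kernel hK v) hz hh0
      (bandwidth_le_one hβ hk)).2.1
    rw [integral_map (hS.measurable_design i).aemeasurable
      (Continuous.aestronglyMeasurable (by fun_prop))] at hb
    refine le_trans ?_ hb
    gcongr
    exact minEigenvalue_kernelGram_mul_le hK v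
  have e : ∑ m, ∑ m', v m * meanBmat P β K X k z m m' * v m'
      = 1 / (k * h ^ d) * ∑ i ∈ firstIdx n k,
        ∑ m, ∑ m', v m * (∫ ω, momentKernel K m m' (h⁻¹ • (X i ω - z)) ∂P) * v m' := by
    rw [Finset.sum_comm (s := firstIdx n k), Finset.mul_sum]
    refine Finset.sum_congr rfl fun m _ => ?_
    rw [Finset.sum_comm (s := firstIdx n k), Finset.mul_sum]
    refine Finset.sum_congr rfl fun m' _ => ?_
    rw [← Finset.sum_mul, ← Finset.mul_sum, meanBmat]
    ring
  rw [e]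
  calc _ = 1 / (k * h ^ d) * ∑ i ∈ firstIdx n k,
        pmin * (h ^ d * (minEigenvalue (kernelGram β K) * ∑ m, v m ^ 2)) := by
        rw [Finset.sum_const, card_firstIdx hkn, nsmul_eq_mul]
        field_simp
    _ ≤ _ := by gcongr with i; exact hone i

theorem meanBmat_zero_le [IsProbabilityMeasure P] (hβ : 2 ≤ β)
    (hS : IsSample P Θ pmin pmax σ X ξ) (hK : IsKernel K Kmax LK) {k : ℕ}
    (hk : 1 ≤ k) (hkn : k ≤ n) {z : E d} (hz : z ∈ Θ) :
    meanBmat P β K X k z (zeroIdx d _) (zeroIdx d _) ≤ pmax := by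
  set h := bandwidth d β k with hh
  have hh0 : 0 < h := bandwidth_pos hk
  have hk0 : (0 : ℝ) < k := by exact_mod_cast hk
  have hKc := hK.continuous
  have hone : ∀ i, ∫ ω, K (h⁻¹ • (X i ω - z)) ∂P ≤ pmax * h ^ d := by
    intro i
    have hb := (integral_scaled_bounds (hS.hasDensityBounds i) hK.nonneg (fun _ => hK.eq_zero)
      (integrable_kernel hK) hz hh0 (bandwidth_le_one hβ hk)).2.2
    rwa [integral_map (hS.measurable_design i).aemeasurable
      (Continuous.aestronglyMeasurable (by fun_prop)), hK.integral_eq_one, mul_one] at hb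
  simp only [meanBmat, momentKernel, monoVec_zeroIdx, one_mul, ← hh]
  calc _ ≤ 1 / (k * h ^ d) * ∑ i ∈ firstIdx n k, pmax * h ^ d := by gcongr with i; exact hone i
    _ = pmax := by
        rw [Finset.sum_const, card_firstIdx hkn, nsmul_eq_mul]
        field_simp

theorem sum_pow_four_le {ι : Type*} (s : Finset ι) {a : ι → ℝ} (ha : ∀ i, 0 ≤ a i) :
    (∑ i ∈ s, a i) ^ 4 ≤ (s.card : ℝ) ^ 3 * ∑ i ∈ s, a i ^ 4 := by
  rcases s.eq_empty_or_nonempty with rfl | hs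
  · simp
  have h := pow_sum_div_card_le_sum_pow (s := s) (f := a) (fun i _ => ha i) 3
  have hc : (0 : ℝ) < s.card := by exact_mod_cast hs.card_pos
  rwa [div_le_iff₀' (by positivity)] at h

theorem fourth_moment_sum_le {ι : Type*} [Fintype ι] {Q : ι → Ω → ℝ} {c : ℝ}
    (hQm : ∀ i, Measurable (Q i)) (hQ0 : ∀ i ω, 0 ≤ Q i ω)
    (hQi : ∀ i, Integrable (fun ω => Q i ω ^ 4) P) (hQ : ∀ i, ∫ ω, Q i ω ^ 4 ∂P ≤ c) :
    Integrable (fun ω => (∑ i, Q i ω) ^ 4) P ∧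
      ∫ ω, (∑ i, Q i ω) ^ 4 ∂P ≤ (Fintype.card ι : ℝ) ^ 4 * c := by
  have hpt : ∀ ω, (∑ i, Q i ω) ^ 4 ≤ (Fintype.card ι : ℝ) ^ 3 * ∑ i, Q i ω ^ 4 := fun ω =>
    sum_pow_four_le Finset.univ fun i => hQ0 i ω
  have hr : Integrable (fun ω => (Fintype.card ι : ℝ) ^ 3 * ∑ i, Q i ω ^ 4) P :=
    (integrable_finsetSum _ fun i _ => hQi i).const_mul _
  have hl : Integrable (fun ω => (∑ i, Q i ω) ^ 4) P :=
    hr.mono' (by fun_prop) (Filter.Eventually.of_forall fun ω => by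
      rw [Real.norm_of_nonneg (by positivity)]; exact hpt ω)
  refine ⟨hl, (integral_mono hl hr hpt).trans ?_⟩
  rw [integral_const_mul, integral_finsetSum _ fun i _ => hQi i]
  calc _ ≤ (Fintype.card ι : ℝ) ^ 3 * ∑ _i : ι, c := by gcongr with i; exact hQ i
    _ = _ := by rw [Finset.sum_const, Finset.card_univ, nsmul_eq_mul]; ring

theorem deviationConst_nonneg (σ Kmax pmax Lφ D : ℝ) : 0 ≤ deviationConst σ Kmax pmax Lφ D := by
  unfold deviationConst
  positivity

/-- The constant in the bound on the mean squared error of the gradient estimator, apart from the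
power of the dimension. -/
noncomputable def errorConst (β L M pmin pmax σ diamΘ Kmax LK κ : ℝ) : ℝ :=
  2 ^ (12 * ell β) *
    (4 * (pmin * κ / 2)⁻¹ ^ 4 * (((M + L) / Real.sqrt κ + L * pmax) ^ 4
      + 8 * (L ^ 4 * deviationConst (Real.log 2)⁻¹ Kmax pmax (2 * ell β * Kmax + LK) diamΘ
        + deviationConst σ Kmax pmax (2 * ell β * Kmax + LK) diamΘ))
      + 4 * (1 + deviationConst (Real.log 2)⁻¹ Kmax pmax (2 * ell β * Kmax + LK) diamΘ))

theorem errorConst_nonneg (β L M pmin pmax σ diamΘ Kmax LK κ : ℝ) :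
    0 ≤ errorConst β L M pmin pmax σ diamΘ Kmax LK κ := by
  have h1 := deviationConst_nonneg (Real.log 2)⁻¹ Kmax pmax (2 * ell β * Kmax + LK) diamΘ
  have h2 := deviationConst_nonneg σ Kmax pmax (2 * ell β * Kmax + LK) diamΘ
  unfold errorConst
  positivity

/-- The elementary inequality that reduces the mean squared error of the gradient estimator to
fourth moments of the deviations `Δ` and `Γ`. -/
theorem sq_error_le {T L pmax ν c Δ Γ : ℝ} (hν : 1 ≤ ν) :
    ((T + ν * (L * (pmax + Δ) + Γ)) / c * (1 + ν * Δ)) ^ 2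
      ≤ 4 * c⁻¹ ^ 4 * ν ^ 4 * ((|T| + |L * pmax|) ^ 4 + 8 * (L ^ 4 * Δ ^ 4 + Γ ^ 4))
        + 4 * (1 + ν ^ 4 * Δ ^ 4) := by
  set a := (T + ν * (L * (pmax + Δ) + Γ)) / c with ha
  set b := 1 + ν * Δ with hb
  have h1 : (a * b) ^ 2 ≤ (a ^ 4 + b ^ 4) / 2 := by nlinarith [sq_nonneg (a ^ 2 - b ^ 2)]
  have h2 : b ^ 4 ≤ 8 * (1 + ν ^ 4 * Δ ^ 4) := by
    have := add_pow_four_le 1 (ν * Δ)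
    rw [mul_pow, one_pow] at this
    exact this
  have h3 : a ^ 4 ≤ c⁻¹ ^ 4 * (8 * (ν ^ 4 * ((|T| + |L * pmax|) ^ 4
      + 8 * (L ^ 4 * Δ ^ 4 + Γ ^ 4)))) := by
    rw [ha, div_eq_mul_inv, mul_pow, mul_comm]
    refine mul_le_mul_of_nonneg_left ?_ (by positivity)
    have e : T + ν * (L * (pmax + Δ) + Γ) = (T + ν * (L * pmax)) + ν * (L * Δ + Γ) := by ring
    rw [e]
    refine (add_pow_four_le _ _).trans ?_
    have h4 : (T + ν * (L * pmax)) ^ 4 ≤ ν ^ 4 * (|T| + |L * pmax|) ^ 4 := by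
      rw [← mul_pow, ← Even.pow_abs (by decide : Even 4)]
      refine pow_le_pow_left₀ (abs_nonneg _) ?_ 4
      refine (abs_add_le _ _).trans ?_
      rw [abs_mul, abs_of_nonneg (by linarith : 0 ≤ ν), mul_add]
      gcongr
      exact le_mul_of_one_le_left (abs_nonneg _) hν
    have h5 : (ν * (L * Δ + Γ)) ^ 4 ≤ ν ^ 4 * (8 * (L ^ 4 * Δ ^ 4 + Γ ^ 4)) := by
      rw [mul_pow]
      refine mul_le_mul_of_nonneg_left ?_ (by positivity)
      have := add_pow_four_le (L * Δ) Γ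
      rwa [mul_pow] at this
    linarith
  linarith

/-- Uniformly over `Θ`, the squared error of the gradient estimator is of the order
`h_k ^ (2 (β - 1))`, up to a factor with bounded mean. -/
theorem exists_gradient_error_bound [IsProbabilityMeasure P] (hβ : 2 ≤ β) (hd : 1 ≤ d)
    (hL : 0 < L) (hpmin : 0 < pmin) (hσ : 0 < σ) (hb : Bornology.IsBounded Θ) (hne : Θ.Nonempty)
    (hK : IsKernel K Kmax LK) (hf : HolderClass β L f) (hM : ∀ x ∈ enlarge Θ, |f x| ≤ M)
    (hS : IsSample P Θ pmin pmax σ X ξ) {k : ℕ} (hk : 1 ≤ k) (hkn : k ≤ n) :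
    ∃ W : Ω → ℝ, Integrable W P ∧
      ∫ ω, W ω ∂P ≤ errorConst β L M pmin pmax σ (Metric.diam Θ) Kmax LK
        (minEigenvalue (kernelGram β K)) * (d : ℝ) ^ (12 * ell β + 8) ∧
      ∀ ω, ∀ z ∈ Θ, ‖gradEst β K (fun i => X i ω) (fun i => f (X i ω) + ξ i ω) k z
        - gradient f z‖ ^ 2 ≤ (Real.log (k + 1) / k) ^ (2 * (β - 1) / (2 * β + d)) * W ω := by
  have hpmax : 0 ≤ pmax := hpmin.le.trans (hS.pmin_le_pmax hne)
  have hκ := minEigenvalue_kernelGram_pos (β := β) hK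
  set κ := minEigenvalue (kernelGram β K) with hκdef
  set ℓ := ell β with hℓ
  set Lφ := 2 * ℓ * Kmax + LK with hLφ
  have hL0 : 0 ≤ Lφ := by
    have := hK.Kmax_pos
    have := hK.LK_nonneg hd
    positivity
  have hM0 : 0 ≤ M := by
    obtain ⟨z, hz⟩ := hne
    exact (abs_nonneg _).trans (hM z (subset_enlarge Θ hz))
  have hcard := card_firstIdx hkn
  have hlog2 : 0 < (Real.log 2)⁻¹ := inv_pos.2 (Real.log_pos one_lt_two)
  set C₁ := deviationConst (Real.log 2)⁻¹ Kmax pmax Lφ (Metric.diam Θ) with hC₁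
  set C₂ := deviationConst σ Kmax pmax Lφ (Metric.diam Θ) with hC₂
  have hC10 : 0 ≤ C₁ := deviationConst_nonneg _ _ _ _ _
  have hC20 : 0 ≤ C₂ := deviationConst_nonneg _ _ _ _ _
  choose Q hQm hQ0 hQi hQint hQ using fun q : MIdx d ℓ × MIdx d ℓ =>
    exists_uniform_deviation hβ hd hlog2 hpmax hb hne hK hS.one hk hcard
      (continuous_momentKernel hK q.1 q.2).measurable (abs_momentKernel_le hK q.1 q.2) hL0
      (momentKernel_lipschitz hK hd q.1 q.2)
  choose R hRm hR0 hRi hRint hR using fun m : MIdx d ℓ =>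
    exists_uniform_deviation hβ hd hσ hpmax hb hne hK hS.noise hk hcard
      (continuous_momentKernel hK m (zeroIdx d ℓ)).measurable
      (abs_momentKernel_le hK m (zeroIdx d ℓ)) hL0
      (momentKernel_lipschitz hK hd m (zeroIdx d ℓ))
  obtain ⟨hΔi, hΔint⟩ := fourth_moment_sum_le hQm hQ0 hQi hQint
  obtain ⟨hΓi, hΓint⟩ := fourth_moment_sum_le hRm hR0 hRi hRint
  set Δ : Ω → ℝ := fun ω => ∑ q, Q q ω with hΔ
  set Γ : Ω → ℝ := fun ω => ∑ m, R m ω with hΓ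
  set ν : ℝ := (Fintype.card (MIdx d ℓ) : ℝ) with hν
  have hν1 : 1 ≤ ν := by
    rw [hν]; exact_mod_cast Fintype.card_pos
  have hd' : (1 : ℝ) ≤ d := by exact_mod_cast hd
  have hνle : ν ≤ 2 ^ ℓ * d ^ ℓ := by
    calc ν ≤ ((d : ℝ) + 1) ^ ℓ := by rw [hν]; exact_mod_cast card_MIdx_le d ℓ
      _ ≤ (2 * d) ^ ℓ := by gcongr; linarith
      _ = _ := mul_pow _ _ _
  set T := (M + L) / Real.sqrt κ with hT
  have hT0 : 0 ≤ T := by positivity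
  set c := pmin * κ / 2 with hc
  have hc0 : 0 < c := by positivity
  set W : Ω → ℝ := fun ω => 4 * c⁻¹ ^ 4 * ν ^ 4 * ((T + L * pmax) ^ 4
    + 8 * (L ^ 4 * Δ ω ^ 4 + Γ ω ^ 4)) + 4 * (1 + ν ^ 4 * Δ ω ^ 4) with hW
  have hi1 : Integrable (fun ω => L ^ 4 * Δ ω ^ 4 + Γ ω ^ 4) P := (hΔi.const_mul _).add hΓi
  have hi2 : Integrable (fun ω => 4 * c⁻¹ ^ 4 * ν ^ 4 * ((T + L * pmax) ^ 4
      + 8 * (L ^ 4 * Δ ω ^ 4 + Γ ω ^ 4))) P :=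
    ((integrable_const _).add (hi1.const_mul 8)).const_mul _
  have hi3 : Integrable (fun ω => 4 * (1 + ν ^ 4 * Δ ω ^ 4)) P :=
    ((integrable_const _).add (hΔi.const_mul _)).const_mul _
  refine ⟨W, hi2.add hi3, ?_, fun ω z hz => ?_⟩
  · have hWint : ∫ ω, W ω ∂P = 4 * c⁻¹ ^ 4 * ν ^ 4 * ((T + L * pmax) ^ 4
        + 8 * (L ^ 4 * ∫ ω, Δ ω ^ 4 ∂P + ∫ ω, Γ ω ^ 4 ∂P))
        + 4 * (1 + ν ^ 4 * ∫ ω, Δ ω ^ 4 ∂P) := by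
      rw [hW, integral_add hi2 hi3, integral_const_mul, integral_const_mul 4,
        integral_add (integrable_const _) (hi1.const_mul 8), integral_const_mul 8,
        integral_add (hΔi.const_mul _) hΓi, integral_const_mul,
        integral_add (integrable_const _) (hΔi.const_mul _), integral_const_mul]
      simp only [integral_const, probReal_univ, one_smul, hΔ, hΓ]
    have hN1 : (1 : ℝ) ≤ (d : ℝ) ^ 8 := one_le_pow₀ hd'
    have hcardq : (Fintype.card (MIdx d ℓ × MIdx d ℓ) : ℝ) ^ 4 = ν ^ 8 := by
      rw [Fintype.card_prod, Nat.cast_mul, ← hν]; ring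
    rw [hcardq] at hΔint
    have hν4 : (1 : ℝ) ≤ ν ^ 4 := one_le_pow₀ hν1
    have hν8 : (1 : ℝ) ≤ ν ^ 8 := one_le_pow₀ hν1
    -- every term is at most a multiple of `N`
    set N := ν ^ 12 * (d : ℝ) ^ 8 with hN
    have hN0 : 0 ≤ N := by positivity
    have f0 : ν ^ 4 ≤ N := by
      calc ν ^ 4 = ν ^ 4 * 1 * 1 := by ring
        _ ≤ ν ^ 4 * ν ^ 8 * (d : ℝ) ^ 8 := by gcongr
        _ = N := by rw [hN]; ring
    have f1 : ν ^ 4 * ∫ ω, Δ ω ^ 4 ∂P ≤ C₁ * N := by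
      calc _ ≤ ν ^ 4 * (ν ^ 8 * (C₁ * (d : ℝ) ^ 8)) := by gcongr
        _ = _ := by rw [hN]; ring
    have f2 : ν ^ 4 * ∫ ω, Γ ω ^ 4 ∂P ≤ C₂ * N := by
      calc _ ≤ ν ^ 4 * (ν ^ 4 * (C₂ * (d : ℝ) ^ 8)) := by gcongr
        _ = ν ^ 8 * 1 * (C₂ * (d : ℝ) ^ 8) := by ring
        _ ≤ ν ^ 8 * ν ^ 4 * (C₂ * (d : ℝ) ^ 8) := by gcongr
        _ = _ := by rw [hN]; ring
    have hNle : N ≤ 2 ^ (12 * ℓ) * (d : ℝ) ^ (12 * ℓ + 8) := by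
      calc N ≤ (2 ^ ℓ * (d : ℝ) ^ ℓ) ^ 12 * (d : ℝ) ^ 8 := by rw [hN]; gcongr
        _ = _ := by rw [mul_pow, ← pow_mul, ← pow_mul, pow_add, mul_comm ℓ 12]; ring
    rw [hWint]
    calc _ = 4 * c⁻¹ ^ 4 * (ν ^ 4 * (T + L * pmax) ^ 4
          + 8 * (L ^ 4 * (ν ^ 4 * ∫ ω, Δ ω ^ 4 ∂P) + ν ^ 4 * ∫ ω, Γ ω ^ 4 ∂P))
          + 4 * (1 + ν ^ 4 * ∫ ω, Δ ω ^ 4 ∂P) := by ring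
      _ ≤ 4 * c⁻¹ ^ 4 * (N * (T + L * pmax) ^ 4 + 8 * (L ^ 4 * (C₁ * N) + C₂ * N))
          + 4 * (N + C₁ * N) := by
        have f3 : 1 ≤ N := hν4.trans f0
        gcongr
      _ = N * (4 * c⁻¹ ^ 4 * ((T + L * pmax) ^ 4 + 8 * (L ^ 4 * C₁ + C₂)) + 4 * (1 + C₁)) := by
        ring
      _ ≤ 2 ^ (12 * ℓ) * (d : ℝ) ^ (12 * ℓ + 8) *
          (4 * c⁻¹ ^ 4 * ((T + L * pmax) ^ 4 + 8 * (L ^ 4 * C₁ + C₂)) + 4 * (1 + C₁)) := by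
        gcongr
      _ = _ := by
        rw [errorConst, ← hℓ, ← hLφ, ← hC₁, ← hC₂, ← hT, ← hc]; ring
  · have hρ0 := regParam_pos (d := d) (β := β) hk
    have hΔq : ∀ q, Q q ω ≤ Δ ω := fun q =>
      Finset.single_le_sum (f := fun q => Q q ω) (fun q _ => hQ0 q ω) (Finset.mem_univ q)
    have hΓm : ∀ m, R m ω ≤ Γ ω := fun m =>
      Finset.single_le_sum (f := fun m => R m ω) (fun m _ => hR0 m ω) (Finset.mem_univ m)
    have hTsq : T ^ 2 = (M + L) ^ 2 / κ := by rw [hT, div_pow, Real.sq_sqrt hκ.le]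
    have herr := norm_gradEst_sub_le (x := fun i => X i ω) (ξ := fun i => ξ i ω) (z := z)
      (Bbar := meanBmat P β K X k z) (c := c) (pmax := pmax) (Δ := Δ ω) (Γ := Γ ω) (T := T)
      hβ hL hK hf hk hc0
      (fun v => by
        have := meanBmat_quadForm_ge hβ hS hpmin.le hK hk hkn hz v
        rwa [show 2 * c = pmin * κ by rw [hc]; ring])
      (meanBmat_zero_le hβ hS hK hk hkn hz) hT0
      (by
        rw [hTsq]
        exact sum_taylorVec_sq_le hβ hL hK hf hM hz (bandwidth_pos hk).le
          (bandwidth_le_one hβ hk))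
      (fun m m' => by
        refine le_trans ?_ (mul_le_mul_of_nonneg_left (hΔq (m, m')) hρ0.le)
        refine le_trans (le_of_eq ?_) (hQ (m, m') ω z hz)
        rw [Bmat_apply, meanBmat, centredSum, ← mul_sub, ← Finset.sum_sub_distrib]
        simp only [one_mul])
      (fun m => by
        refine le_trans ?_ (mul_le_mul_of_nonneg_left (hΓm m) hρ0.le)
        refine le_trans (le_of_eq ?_) (hR m ω z hz)
        congr 2
        rw [centredSum]
        refine Finset.sum_congr rfl fun i _ => ?_
        have hX := hS.measurable_design i
        have hφ := (continuous_momentKernel hK m (zeroIdx d ℓ)).measurable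
        have h0 : ∫ ω', ξ i ω' * momentKernel K m (zeroIdx d ℓ)
            ((bandwidth d β k)⁻¹ • (X i ω' - z)) ∂P = 0 := by
          have hind : IndepFun (ξ i) (fun ω' => momentKernel K m (zeroIdx d ℓ)
              ((bandwidth d β k)⁻¹ • (X i ω' - z))) P :=
            (hS.indep_noise_design i i).comp (φ := id) (ψ := fun x => momentKernel K m
              (zeroIdx d ℓ) ((bandwidth d β k)⁻¹ • (x - z))) measurable_id (by fun_prop)
          rw [hind.integral_fun_mul_eq_mul_integral
            (hS.measurable_noise i).aestronglyMeasurable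
            (Measurable.aestronglyMeasurable (by fun_prop)), hS.noise_mean i, zero_mul]
        rw [h0, sub_zero])
    refine (pow_le_pow_left₀ (norm_nonneg _) herr 2).trans ?_
    rw [mul_pow, sq_inv_bandwidth_mul_regParam hk]
    refine mul_le_mul_of_nonneg_left ?_ (Real.rpow_nonneg (log_div_pos hk).le _)
    refine (sq_error_le hν1).trans (le_of_eq ?_)
    rw [abs_of_nonneg hT0, abs_of_nonneg (by positivity : 0 ≤ L * pmax)]

end Sample

/-! ### Measurability of the iterates -/

section Measurability

variable {d n : ℕ} {Θ : Set (E d)} {K f : E d → ℝ} {Kmax LK β α : ℝ}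
  {Ω : Type*} [MeasurableSpace Ω]

theorem measurable_det {ι : Type*} [Fintype ι] [DecidableEq ι] {A : Ω → Matrix ι ι ℝ}
    (hA : ∀ i j, Measurable fun ω => A ω i j) : Measurable fun ω => (A ω).det := by
  simp only [Matrix.det_apply]
  fun_prop

theorem measurable_inv_apply {ι : Type*} [Fintype ι] [DecidableEq ι] {A : Ω → Matrix ι ι ℝ}
    (hA : ∀ i j, Measurable fun ω => A ω i j) (i j : ι) : Measurable fun ω => (A ω)⁻¹ i j := by
  simp only [Matrix.inv_def, Matrix.smul_apply, Ring.inverse_eq_inv', smul_eq_mul,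
    Matrix.adjugate_apply]
  refine (measurable_det hA).inv.mul (measurable_det fun a b => ?_)
  simp only [Matrix.updateRow_apply]
  split_ifs
  · exact measurable_const
  · exact hA a b

theorem measurable_gradEst (hK : IsKernel K Kmax LK) {x : Fin n → Ω → E d} {y : Fin n → Ω → ℝ}
    {z : Ω → E d} (hx : ∀ i, Measurable (x i)) (hy : ∀ i, Measurable (y i)) (hz : Measurable z)
    (k : ℕ) :
    Measurable fun ω => gradEst β K (fun i => x i ω) (fun i => y i ω) k (z ω) := by
  have hmk : ∀ m m' : MIdx d (ell β), Measurable (momentKernel K m m') := fun m m' =>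
    (continuous_momentKernel hK m m').measurable
  have hB : ∀ m m', Measurable fun ω => (Bmat β K (fun i => x i ω) k (z ω)
      + regParam d β k • (1 : Matrix (MIdx d (ell β)) (MIdx d (ell β)) ℝ)) m m' := by
    intro m m'
    simp only [Matrix.add_apply, Bmat_apply]
    fun_prop
  have hBinv := measurable_inv_apply hB
  have hD : ∀ m, Measurable fun ω =>
      Dvec β K (fun i => x i ω) (fun i => y i ω) k (z ω) m := by
    intro m
    simp only [Dvec_apply]
    fun_prop
  unfold gradEst
  refine (WithLp.measurable_toLp 2 _).comp (measurable_pi_lambda _ fun i => ?_)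
  simp only [Pi.smul_apply, Matrix.mulVec, dotProduct, smul_eq_mul]
  exact (Finset.measurable_sum _ fun m _ => (Finset.measurable_sum _ fun m' _ =>
    (hBinv m m').mul (hD m')).const_mul _).const_mul _

theorem measurable_iterate (hc : IsCompact Θ) (hconv : Convex ℝ Θ) (hne : Θ.Nonempty)
    (hK : IsKernel K Kmax LK) (z₁ : E d) {x : Fin n → Ω → E d} {y : Fin n → Ω → ℝ}
    (hx : ∀ i, Measurable (x i)) (hy : ∀ i, Measurable (y i)) (j : ℕ) :
    Measurable fun ω => iterate Θ β α K z₁ (fun i => x i ω) (fun i => y i ω) j := by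
  induction j with
  | zero => exact measurable_const
  | succ j ih =>
    have hg := measurable_gradEst (β := β) hK hx hy ih (j + 1)
    exact (continuous_proj hc hconv hne).measurable.comp (ih.sub (hg.fun_const_smul _))

theorem iterate_mem (hc : IsCompact Θ) {z₁ : E d} (hz₁ : z₁ ∈ Θ) (x : Fin n → E d)
    (y : Fin n → ℝ) (j : ℕ) : iterate Θ β α K z₁ x y j ∈ Θ := by
  cases j with
  | zero => exact hz₁
  | succ j => exact (proj_spec hc ⟨z₁, hz₁⟩ _).1

theorem average_mem (hc : IsCompact Θ) (hconv : Convex ℝ Θ) {z₁ : E d} (hz₁ : z₁ ∈ Θ)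
    (hn : 1 ≤ n) (x : Fin n → E d) (y : Fin n → ℝ) : average Θ β α K z₁ x y ∈ Θ := by
  rw [average, Finset.smul_sum]
  have hn0 : (n : ℝ) ≠ 0 := by positivity
  exact hconv.sum_mem (fun _ _ => by positivity) (by simp [hn0])
    fun j _ => iterate_mem hc hz₁ x y j

theorem HolderClass.continuous {L : ℝ} (hβ : 2 ≤ β) (hf : HolderClass β L f) : Continuous f := by
  have h := hf.differentiable 0 (one_le_ell hβ)
  rw [iteratedFDeriv_zero_eq_comp, LinearIsometryEquiv.comp_differentiable_iff] at h
  exact h.continuous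

end Measurability

/-! ### Expected optimization error -/

section Conclusion

variable {d n : ℕ} {Θ : Set (E d)} {K f : E d → ℝ} {Kmax LK β L M α : ℝ} {xstar z₁ : E d}

/-- Jensen's inequality, from the gradient inequality at the average. -/
theorem objective_average_le (hc : IsCompact Θ) (hconv : Convex ℝ Θ) (hα : 0 < α)
    (hf : IsObjective Θ β L M α f xstar) (hz₁ : z₁ ∈ Θ) (hn : 1 ≤ n) (x : Fin n → E d)
    (y : Fin n → ℝ) :
    f (average Θ β α K z₁ x y) - f xstar ≤
      1 / (n : ℝ) * ∑ j ∈ Finset.range n, (f (iterate Θ β α K z₁ x y j) - f xstar) := by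
  set zb := average Θ β α K z₁ x y with hzb
  have hmem : zb ∈ Θ := average_mem hc hconv hz₁ hn x y
  have hn0 : (n : ℝ) ≠ 0 := by positivity
  have hsum : ∑ j ∈ Finset.range n,
      inner ℝ (gradient f zb) (iterate Θ β α K z₁ x y j - zb) = 0 := by
    rw [← inner_sum, Finset.sum_sub_distrib, Finset.sum_const, Finset.card_range,
      ← Nat.cast_smul_eq_nsmul ℝ, hzb, average, smul_smul, mul_one_div_cancel hn0, one_smul,
      sub_self, inner_zero_right]
  have hpt : ∀ j ∈ Finset.range n, f zb - f xstar
      + inner ℝ (gradient f zb) (iterate Θ β α K z₁ x y j - zb)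
      ≤ f (iterate Θ β α K z₁ x y j) - f xstar := by
    intro j _
    have h1 := hf.strongConvex zb hmem _ (iterate_mem (K := K) (α := α) (β := β) hc hz₁ x y j)
    have h2 : 0 ≤ α / 2 * ‖zb - iterate Θ β α K z₁ x y j‖ ^ 2 := by positivity
    linarith
  have h := Finset.sum_le_sum hpt
  rw [Finset.sum_add_distrib, hsum, add_zero, Finset.sum_const, Finset.card_range,
    nsmul_eq_mul] at h
  rw [one_div, ← div_eq_inv_mul, le_div_iff₀ (by positivity)]
  linarith

theorem sum_objective_le (hc : IsCompact Θ) (hconv : Convex ℝ Θ) (hα : 0 < α)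
    (hf : IsObjective Θ β L M α f xstar) (hz₁ : z₁ ∈ Θ) (x : Fin n → E d) (y : Fin n → ℝ)
    {w : ℕ → ℝ} {T : ℝ}
    (hw : ∀ j < n, ∀ z ∈ Θ, ‖gradEst β K x y (j + 1) z - gradient f z‖ ^ 2 ≤ w j)
    (hT : ∀ z ∈ Θ, ‖gradient f z‖ ^ 2 ≤ T) :
    ∑ j ∈ Finset.range n, (f (iterate Θ β α K z₁ x y j) - f xstar)
      ≤ ∑ j ∈ Finset.range n, α⁻¹ * (3 * w j + 2 * T * (1 / (j + 1))) := by
  set z := iterate Θ β α K z₁ x y with hz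
  have hmem : ∀ j, z j ∈ Θ := iterate_mem hc hz₁ x y
  refine (sum_descent hα n (z := z) (g := fun j => gradEst β K x y (j + 1) (z j))
    (G := fun j => gradient f (z j)) (xs := xstar) (fun j _ => ?_) fun j _ => ?_).trans ?_
  · exact norm_proj_sub_le hc hconv _ hf.mem
  · have h := hf.strongConvex (z j) (hmem j) xstar hf.mem
    rw [← neg_sub (z j) xstar, inner_neg_right] at h
    linarith
  · refine Finset.sum_le_sum fun j hj => ?_
    have h1 := hw j (Finset.mem_range.1 hj) (z j) (hmem j)
    have h2 := hT (z j) (hmem j)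
    gcongr

theorem one_sub_rate {d : ℕ} (hβ : 2 ≤ β) :
    0 ≤ 2 * (β - 1) / (2 * β + d) ∧ 2 * (β - 1) / (2 * β + d) < 1 ∧
      2 / (1 - 2 * (β - 1) / (2 * β + d)) ≤ 2 * β := by
  have hd : (0 : ℝ) ≤ d := Nat.cast_nonneg d
  have h0 : 0 < 2 * β + d := by linarith
  have e : 1 - 2 * (β - 1) / (2 * β + d) = (2 + d) / (2 * β + d) := by
    field_simp; ring
  refine ⟨div_nonneg (by linarith) h0.le, by rw [div_lt_one h0]; linarith, ?_⟩
  rw [e, div_div_eq_mul_div, div_le_iff₀ (by linarith)]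
  nlinarith

/-- The rate `(log n / n) ^ r / α`, without the minimum with `1`. -/
theorem expected_error_le {Ω : Type*} [MeasurableSpace Ω] {P : Measure Ω} [IsProbabilityMeasure P]
    {pmin pmax σ : ℝ} {X : Fin n → Ω → E d} {ξ : Fin n → Ω → ℝ}
    (hβ : 2 ≤ β) (hd : 1 ≤ d) (hL : 0 < L) (hpmin : 0 < pmin) (hσ : 0 < σ)
    (hc : IsCompact Θ) (hconv : Convex ℝ Θ) (hK : IsKernel K Kmax LK) (hn : 2 ≤ n) (hα : 0 < α)
    (hf : IsObjective Θ β L M α f xstar) (hz₁ : z₁ ∈ Θ) (hS : IsSample P Θ pmin pmax σ X ξ)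
    (hint : Integrable (fun ω => f (average Θ β α K z₁ (fun i => X i ω)
      (fun i => f (X i ω) + ξ i ω)) - f xstar) P) :
    ∫ ω, (f (average Θ β α K z₁ (fun i => X i ω) (fun i => f (X i ω) + ξ i ω)) - f xstar) ∂P
      ≤ (6 * β * errorConst β L M pmin pmax σ (Metric.diam Θ) Kmax LK
          (minEigenvalue (kernelGram β K))
        + 6 * ((M + L) ^ 2 / minEigenvalue (kernelGram β K))) * (d : ℝ) ^ (12 * ell β + 8) *
        ((Real.log n / n) ^ (2 * (β - 1) / (2 * β + d)) * α⁻¹) := by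
  have hne : Θ.Nonempty := ⟨_, hz₁⟩
  have hκ := minEigenvalue_kernelGram_pos (β := β) hK
  set κ := minEigenvalue (kernelGram β K) with hκdef
  set C := errorConst β L M pmin pmax σ (Metric.diam Θ) Kmax LK κ with hC
  set r := 2 * (β - 1) / (2 * β + d) with hr
  obtain ⟨hr0, hr1, hr2⟩ := one_sub_rate (d := d) hβ
  rw [← hr] at hr0 hr1 hr2
  set D := (d : ℝ) ^ (12 * ell β + 8) with hD
  have hD1 : 1 ≤ D := one_le_pow₀ (by exact_mod_cast hd)
  set T := (M + L) ^ 2 / κ with hT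
  have hT0 : 0 ≤ T := by positivity
  have hW : ∀ j : ℕ, ∃ W : Ω → ℝ, j < n → (Integrable W P ∧ ∫ ω, W ω ∂P ≤ C * D ∧
      ∀ ω, ∀ z ∈ Θ, ‖gradEst β K (fun i => X i ω) (fun i => f (X i ω) + ξ i ω) (j + 1) z
        - gradient f z‖ ^ 2 ≤ (Real.log ((j : ℝ) + 1 + 1) / (j + 1)) ^ r * W ω) := by
    intro j
    by_cases hj : j < n
    · obtain ⟨W, h1, h2, h3⟩ := exists_gradient_error_bound hβ hd hL hpmin hσ hc.isBounded hne hK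
        hf.holder hf.bounded hS (k := j + 1) (by omega) hj
      refine ⟨W, fun _ => ⟨h1, h2, fun ω z hz => ?_⟩⟩
      simpa using h3 ω z hz
    · exact ⟨0, fun h => absurd h hj⟩
  choose W hW using hW
  have hgrad : ∀ z ∈ Θ, ‖gradient f z‖ ^ 2 ≤ T := fun z hz =>
    (norm_gradient_sq_le hβ f z).trans
      (sum_taylorVec_sq_le hβ hL hK hf.holder hf.bounded hz zero_le_one le_rfl)
  set v : ℕ → ℝ := fun j => (Real.log ((j : ℝ) + 1 + 1) / (j + 1)) ^ r with hv
  have hv0 : ∀ j, 0 ≤ v j := fun j => Real.rpow_nonneg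
    (div_nonneg (Real.log_nonneg (by linarith [Nat.cast_nonneg (α := ℝ) j])) (by positivity)) _
  have hpt : ∀ ω, f (average Θ β α K z₁ (fun i => X i ω) (fun i => f (X i ω) + ξ i ω)) - f xstar
      ≤ 1 / (n : ℝ) * ∑ j ∈ Finset.range n,
        α⁻¹ * (3 * (v j * W j ω) + 2 * T * (1 / (j + 1))) := by
    intro ω
    refine (objective_average_le hc hconv hα hf hz₁ (by omega) _ _).trans ?_
    refine mul_le_mul_of_nonneg_left ?_ (by positivity)
    exact sum_objective_le hc hconv hα hf hz₁ _ _ (fun j hj => (hW j hj).2.2 ω) hgrad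
  have hterm : ∀ j ∈ Finset.range n, Integrable (fun ω =>
      α⁻¹ * (3 * (v j * W j ω) + 2 * T * (1 / (j + 1)))) P := fun j hj =>
    (((((hW j (Finset.mem_range.1 hj)).1).const_mul _).const_mul _).add
      (integrable_const _)).const_mul _
  have hn0 : (0 : ℝ) < n := by exact_mod_cast (by omega : 0 < n)
  calc _ ≤ ∫ ω, 1 / (n : ℝ) * ∑ j ∈ Finset.range n,
        α⁻¹ * (3 * (v j * W j ω) + 2 * T * (1 / (j + 1))) ∂P :=
        integral_mono hint ((integrable_finsetSum _ hterm).const_mul _) hpt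
    _ = 1 / (n : ℝ) * ∑ j ∈ Finset.range n,
        α⁻¹ * (3 * (v j * ∫ ω, W j ω ∂P) + 2 * T * (1 / (j + 1))) := by
        rw [integral_const_mul, integral_finsetSum _ hterm]
        congr 1
        refine Finset.sum_congr rfl fun j hj => ?_
        have hWi := (hW j (Finset.mem_range.1 hj)).1
        rw [integral_const_mul, integral_add ((hWi.const_mul _).const_mul _) (integrable_const _),
          integral_const_mul, integral_const_mul, integral_const, probReal_univ, one_smul]
    _ ≤ 1 / (n : ℝ) * ∑ j ∈ Finset.range n,
        α⁻¹ * (3 * (v j * (C * D)) + 2 * T * (1 / (j + 1))) := by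
        gcongr with j hj
        · exact hv0 j
        · exact (hW j (Finset.mem_range.1 hj)).2.1
    _ = α⁻¹ * (3 * C * D * (1 / (n : ℝ) * ∑ j ∈ Finset.range n, v j)
        + 2 * T * (1 / (n : ℝ) * ∑ j ∈ Finset.range n, 1 / ((j : ℝ) + 1))) := by
        rw [← Finset.mul_sum, Finset.sum_add_distrib, ← Finset.mul_sum, ← Finset.mul_sum,
          ← Finset.sum_mul]
        ring
    _ ≤ α⁻¹ * (3 * C * D * (2 * β * (Real.log n / n) ^ r)
        + 2 * T * D * (3 * (Real.log n / n) ^ r)) := by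
        have hC0 : 0 ≤ C := errorConst_nonneg _ _ _ _ _ _ _ _ _ _
        have hlog : 0 ≤ Real.log n := Real.log_natCast_nonneg n
        have g1 : 1 / (n : ℝ) * ∑ j ∈ Finset.range n, v j ≤ 2 * β * (Real.log n / n) ^ r :=
          (avg_rate_le hr0 hr1 n hn).trans (mul_le_mul_of_nonneg_right hr2 (by positivity))
        have g2 := avg_inv_le hr1.le n hn
        refine mul_le_mul_of_nonneg_left (add_le_add ?_ ?_) (by positivity)
        · exact mul_le_mul_of_nonneg_left g1 (by positivity)
        · exact mul_le_mul (le_mul_of_one_le_right (by positivity) hD1) g2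
            (mul_nonneg (by positivity) (Finset.sum_nonneg fun j _ => by positivity))
            (by positivity)
    _ = _ := by ring

end Conclusion

end PassiveGD

/-- The constant is `C₀ * d ^ q`, where `q` depends only on `β`, and `C₀` depends on `Θ` and on `K`
only through the diameter of `Θ` and the bound, the Lipschitz constant and the smallest Gram
eigenvalue of `K`; in particular it does not depend on the dimension otherwise, nor on `n`, `α`,
`f`, the starting point or the law of the data. -/
theorem theorem2 (β : ℝ) (hβ : 2 ≤ β) :
    ∃ q : ℕ, ∀ L M pmin pmax σ diamΘ Kmax LK κ : ℝ, 0 < L → 0 < pmin → 0 < σ →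
      ∃ C₀ : ℝ, 0 < C₀ ∧
        ∀ (d : ℕ) (Θ : Set (E d)) (K : E d → ℝ), 1 ≤ d → IsCompact Θ → Convex ℝ Θ →
          Metric.diam Θ = diamΘ → IsKernel K Kmax LK → minEigenvalue (kernelGram β K) = κ →
        ∀ (n : ℕ) (α : ℝ) (f : E d → ℝ) (xstar z₁ : E d), 2 ≤ n → 0 < α →
          IsObjective Θ β L M α f xstar → z₁ ∈ Θ →
        ∀ (Ω : Type u) [MeasurableSpace Ω] (P : Measure Ω) [IsProbabilityMeasure P]
          (X : Fin n → Ω → E d) (ξ : Fin n → Ω → ℝ), IsSample P Θ pmin pmax σ X ξ →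
          let zbar : Ω → E d := fun ω =>
            average Θ β α K z₁ (fun i => X i ω) (fun i => f (X i ω) + ξ i ω)
          Integrable (fun ω => f (zbar ω) - f xstar) P ∧
          ∫ ω, (f (zbar ω) - f xstar) ∂P ≤
            C₀ * (d : ℝ) ^ q *
              min 1 ((Real.log n / n) ^ (2 * (β - 1) / (2 * β + d)) * α⁻¹) := by
  refine ⟨12 * ell β + 8, fun L M pmin pmax σ diamΘ Kmax LK κ hL hpmin hσ => ?_⟩
  refine ⟨max 1 (max (2 * M) (6 * β * errorConst β L M pmin pmax σ diamΘ Kmax LK κ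
    + 6 * ((M + L) ^ 2 / κ))), lt_max_of_lt_left one_pos, ?_⟩
  intro d Θ K hd hc hconv hdiam hK hκ n α f xstar z₁ hn hα hf hz₁ Ω _ P _ X ξ hS zbar
  have hfc := hf.holder.continuous hβ
  have hmem : ∀ ω, zbar ω ∈ Θ := fun ω => average_mem hc hconv hz₁ (by omega) _ _
  have hX := hS.measurable_design
  have hξ := hS.measurable_noise
  have hzm : Measurable zbar := by
    have hit := measurable_iterate (β := β) (α := α) hc hconv ⟨z₁, hz₁⟩ hK z₁ hX
      (y := fun i ω => f (X i ω) + ξ i ω)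
      (fun i => (hfc.measurable.comp (hX i)).add (hξ i))
    exact (Finset.measurable_sum _ fun j _ => hit j).fun_const_smul (1 / (n : ℝ))
  have hbd : ∀ ω, |f (zbar ω) - f xstar| ≤ 2 * M := by
    intro ω
    have h1 := abs_le.1 (hf.bounded _ (subset_enlarge Θ (hmem ω)))
    have h2 := abs_le.1 (hf.bounded _ (subset_enlarge Θ hf.mem))
    rw [abs_le]; constructor <;> linarith
  have hint : Integrable (fun ω => f (zbar ω) - f xstar) P :=
    (integrable_const (2 * M)).mono' ((hfc.measurable.comp hzm).sub_const _).aestronglyMeasurable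
      (Filter.Eventually.of_forall hbd)
  refine ⟨hint, ?_⟩
  set D := (d : ℝ) ^ (12 * ell β + 8) with hD
  have hD1 : 1 ≤ D := one_le_pow₀ (by exact_mod_cast hd)
  set R := (Real.log n / n) ^ (2 * (β - 1) / (2 * β + d)) * α⁻¹ with hR
  have hR0 : 0 ≤ R := by
    have : 0 ≤ Real.log n := Real.log_natCast_nonneg n
    positivity
  have hmain := expected_error_le hβ hd hL hpmin hσ hc hconv hK hn hα hf hz₁ hS hint
  rw [hdiam, hκ, ← hR, ← hD] at hmain
  set C := 6 * β * errorConst β L M pmin pmax σ diamΘ Kmax LK κ + 6 * ((M + L) ^ 2 / κ) with hC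
  set C₀ := max 1 (max (2 * M) C) with hC₀
  have hC1 : 1 ≤ C₀ := le_max_left _ _
  rcases min_cases 1 R with ⟨h, -⟩ | ⟨h, -⟩ <;> rw [h]
  · have h1 : ∫ ω, (f (zbar ω) - f xstar) ∂P ≤ ∫ _, 2 * M ∂P :=
      integral_mono hint (integrable_const _) fun ω => (le_abs_self _).trans (hbd ω)
    rw [integral_const, probReal_univ, one_smul] at h1
    have h2 : 2 * M ≤ C₀ := (le_max_left _ _).trans (le_max_right _ _)
    nlinarith
  · refine hmain.trans ?_
    have h2 : C ≤ C₀ := (le_max_right _ _).trans (le_max_right _ _)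
    gcongr
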